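/- **Theorem (Kummer–Pearson VII relation).** For a partition $\tau=(t_1\ge t_2\ge\dots\ge t_m\ge 0)$ of $t$ into at most $m$ parts and $\beta\in\mathbb C$ put $(\beta)_t=\beta(\beta+1)\cdots(\beta+t-1)$, $(\beta)_0=1$, and $(\beta)_\tau=\prod_{i=1}^m\bigl(\beta-\tfrac12(i-1)\bigr)_{t_i}$. For a real symmetric $m\times m$ matrix $X$ let $C_\tau(X)$ be the zonal polynomial of $X$: the $C_\tau$, $\tau$ running over the partitions of $t$ into at most $m$ parts, are the symmetric homogeneous polynomials of degree $t$ in the eigenvalues $y_1,\dots,y_m$ of $X$ such that $C_\tau$ is a multiple of $y_1^{t_1}\cdots y_m^{t_m}$ plus (up to permutation of the variables) monomials whose exponents are partitions smaller than $\tau$ in the dominance order, $C_\tau$ is an eigenfunction of $\sum_i y_i^2\partial_i^2+\sum_i\sum_{j\ne i}\frac{y_i^2}{y_i-y_j}\partial_i$ with eigenvalue $\sum_i t_i(t_i-i)+t(m-1)$, and $\sum_\tau C_\tau(X)=(\operatorname{tr}X)^t$. For $f:\mathbb N\to\mathbb C$ define $${}_1P_1\bigl(f(t):a;c;X\bigr)=\sum_{t=0}^\infty\frac{f(t)}{t!}\sum_{\tau}\frac{(a)_\tau}{(c)_\tau}\,C_\tau(X),$$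 the inner sum being over the partitions $\tau$ of $t$ into at most $m$ parts. Let $X$ be a real symmetric positive definite $m\times m$ matrix and let $a,c\in\mathbb C$ satisfy $\operatorname{Re}(a)>\frac12(m-1)$, $\operatorname{Re}(c)>\frac12(m-1)$ and $\operatorname{Re}(c-a)>\frac12(m-1)$. Let $b,d$ be real numbers such that either $|d|>\operatorname{tr}X$ and $|d-\operatorname{tr}X|>\operatorname{tr}X$ (that is, $d>2\operatorname{tr}X$ or $d<-\operatorname{tr}X$), or $b\in\{0,-1,-2,\dots\}$ and $d\neq\operatorname{tr}X$. Then the two series below (as series in $t$) converge absolutely and $${}_1P_1\bigl((b)_t\,d^{-b-t}:a;c;X\bigr)=(d-\operatorname{tr}X)^{-b}\;{}_1P_1\bigl((b)_t\,(d-\operatorname{tr}X)^{-t}:c-a;c;-X\bigr),$$ where powers of negative reals are taken with the principal branch and $0^0=1$. -/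

import Mathlib

noncomputable section

namespace KummerPearson

/-- The partitions `τ = (t₁ ≥ t₂ ≥ ⋯ ≥ t_m ≥ 0)` of `t` into at most `m` parts
(indices are shifted: `τ i` is the part `t_{i+1}`). -/
def partitions (m t : ℕ) : Finset (Fin m → ℕ) :=
  open Classical in
  (Finset.piAntidiag (Finset.univ : Finset (Fin m)) t).filter fun τ => Antitone τ

/-- Dominance order of partitions: every initial sum of `μ` is at most that of `κ`. -/
def Dominated {m : ℕ} (μ κ : Fin m → ℕ) : Prop :=
  ∀ r : Fin m, ∑ i ∈ Finset.Iic r, μ i ≤ ∑ i ∈ Finset.Iic r, κ i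

/-- The Laplace–Beltrami type operator
`Δ = ∑ᵢ yᵢ² ∂ᵢ² + ∑ᵢ ∑_{j ≠ i} yᵢ² / (yᵢ - yⱼ) ∂ᵢ`
applied to the polynomial `P` and evaluated at `y` (meant for pairwise distinct `yᵢ`). -/
def laplaceBeltrami {m : ℕ} (P : MvPolynomial (Fin m) ℝ) (y : Fin m → ℝ) : ℝ :=
  ∑ i, y i ^ 2 * MvPolynomial.eval y (MvPolynomial.pderiv i (MvPolynomial.pderiv i P)) +
    ∑ i, ∑ j ∈ Finset.univ.erase i,
      y i ^ 2 / (y i - y j) * MvPolynomial.eval y (MvPolynomial.pderiv i P)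

/-- The eigenvalue `∑ᵢ kᵢ (kᵢ - i) + k (m - 1)` of `Δ` that belongs to the partition `κ`
of `k`, where `i` runs from `1` to `m`. -/
def zonalEigenvalue {m : ℕ} (κ : Fin m → ℕ) : ℝ :=
  ∑ i, (κ i : ℝ) * ((κ i : ℝ) - ((i : ℕ) + 1)) + (∑ i, (κ i : ℝ)) * ((m : ℝ) - 1)

/-- `C` is the family of zonal polynomials of degree `t` in `m` variables: for each partition
`κ` of `t`, `C κ` is a symmetric homogeneous polynomial of degree `t` whose highest term is a
multiple of `y^κ`, all other partitions occurring in it being dominated by `κ`; it is an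
eigenfunction of `Δ`; and the `C κ` sum to `(y₁ + ⋯ + y_m)^t`. -/
structure IsZonalFamily (m t : ℕ) (C : (Fin m → ℕ) → MvPolynomial (Fin m) ℝ) : Prop where
  symmetric : ∀ κ ∈ partitions m t, (C κ).IsSymmetric
  homogeneous : ∀ κ ∈ partitions m t, (C κ).IsHomogeneous t
  triangular : ∀ κ ∈ partitions m t, ∀ μ ∈ partitions m t,
    (C κ).coeff (Finsupp.equivFunOnFinite.symm μ) ≠ 0 → Dominated μ κ
  eigenfunction : ∀ κ ∈ partitions m t, ∀ y : Fin m → ℝ, Function.Injective y →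
    laplaceBeltrami (C κ) y = zonalEigenvalue κ * MvPolynomial.eval y (C κ)
  sum_eq : ∑ κ ∈ partitions m t, C κ = (∑ i, MvPolynomial.X i) ^ t

/-- The zonal polynomial of the partition `κ` in the latent roots `y₁, …, y_m`. The conditions
in `IsZonalFamily` determine it uniquely: `Δ` is triangular for the dominance order on the
monomial symmetric polynomials, with eigenvalues that differ for comparable partitions. -/
def zonalPoly {m : ℕ} (κ : Fin m → ℕ) : MvPolynomial (Fin m) ℝ :=
  Classical.epsilon (IsZonalFamily m (∑ i, κ i)) κ

/-- The zonal polynomial `C_κ(X)` of a real symmetric matrix `X`. -/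
def zonal {m : ℕ} (κ : Fin m → ℕ) (X : Matrix (Fin m) (Fin m) ℝ) (hX : X.IsHermitian) : ℝ :=
  MvPolynomial.eval hX.eigenvalues (zonalPoly κ)

/-- The rising factorial `(β)_t = β (β + 1) ⋯ (β + t - 1)`. -/
def poch (β : ℂ) (t : ℕ) : ℂ := ∏ j ∈ Finset.range t, (β + j)

/-- The generalized rising factorial `(β)_τ = ∏ᵢ (β - (i - 1)/2)_{tᵢ}`, `i` from `1` to `m`. -/
def pochPartition {m : ℕ} (β : ℂ) (τ : Fin m → ℕ) : ℂ :=
  ∏ i : Fin m, poch (β - ((i : ℕ) : ℂ) / 2) (τ i)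

/-- The term of index `t` of the series `₁P₁(f(t) : a; c; X)`. -/
def onePoneTerm {m : ℕ} (f : ℕ → ℂ) (a c : ℂ) (X : Matrix (Fin m) (Fin m) ℝ)
    (hX : X.IsHermitian) (t : ℕ) : ℂ :=
  f t / (t.factorial : ℂ) *
    ∑ τ ∈ partitions m t, pochPartition a τ / pochPartition c τ * (zonal τ X hX : ℂ)

/-- `₁P₁(f(t) : a; c; X) = ∑_t f(t)/t! ∑_τ (a)_τ / (c)_τ C_τ(X)`. -/
def onePone {m : ℕ} (f : ℕ → ℂ) (a c : ℂ) (X : Matrix (Fin m) (Fin m) ℝ)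
    (hX : X.IsHermitian) : ℂ :=
  ∑' t, onePoneTerm f a c X hX t

end KummerPearson

end

/-!
The spherical polynomial of a partition `κ` is the mean over `H ∈ O(m)` of a product of powers of
the leading principal minors of `H diag(y) Hᵀ`, the power function of `κ`. Because power functions
are multiplicative for lower triangular factors, the mean of the power function of `g H Λ Hᵀ gᵀ`
separates into a function of `g gᵀ` times a function of `Λ`. Spherical polynomials are triangular
for the dominance order and, again because of the triangular factors, eigenfunctions of the
Laplace–Beltrami operator, so the zonal polynomials are multiples of them; the multiples are
nonnegative because the powers of the trace define a positive semidefinite kernel.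

Kummer's relation `∑_κ (a)_κ / (c)_κ C_κ(X) = ∑_k (t choose k) (tr X)^{t-k} (-1)^k
∑_κ (c - a)_κ / (c)_κ C_κ(X)` in degree `t` is elementary when `a = p / 2` and `c = (p + q) / 2`:
there both sides are moments `∫ tr(X Λ)^t = ∫ (tr X - tr(X (1 - Λ)))^t`, where `Λ` is the upper left
block of a random orthogonal projection of rank `p` in dimension `p + q`, and `(a)_κ`, `(c)_κ` are
moments of Gaussian Gram matrices. Cleared of denominators the relation is polynomial in `a` and
`c - a`, hence it holds for all parameters. The two series then arise from each other by summing one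
absolutely convergent double series in two ways; a finite sum takes its place if `b` is a
nonpositive integer.
-/

noncomputable section

namespace KummerPearson

open Matrix Finset MeasureTheory ProbabilityTheory
/-! ### Power functions of matrices -/

section PowerFunction

variable {m : ℕ} {R R' : Type*} [CommRing R] [CommRing R']

/-- The leading principal minor of size `i + 1`. -/
def leadMinor (S : Matrix (Fin m) (Fin m) R) (i : Fin m) : R :=
  (S.submatrix (Fin.castLE i.isLt) (Fin.castLE i.isLt)).det

/-- The sequence `κ₀, …, κ_{m-1}, 0, 0, …`, which avoids case distinctions at the last part. -/
def extendZero (κ : Fin m → ℕ) (j : ℕ) : ℕ := if h : j < m then κ ⟨j, h⟩ else 0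

/-- The difference `κᵢ - κᵢ₊₁` of consecutive parts, truncated at `0` where `κ` increases. -/
def partStep (κ : Fin m → ℕ) (i : Fin m) : ℕ := extendZero κ i - extendZero κ (i + 1)

/-- The power function `∏ᵢ Δᵢ(S) ^ (κᵢ - κᵢ₊₁)`, where `Δᵢ` are the leading principal minors. -/
def powerFn (κ : Fin m → ℕ) (S : Matrix (Fin m) (Fin m) R) : R :=
  ∏ i, leadMinor S i ^ partStep κ i

lemma extendZero_val (κ : Fin m → ℕ) (i : Fin m) : extendZero κ i = κ i := by
  simp [extendZero]

lemma extendZero_self (κ : Fin m → ℕ) : extendZero κ m = 0 := by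
  simp [extendZero]

lemma extendZero_antitone {κ : Fin m → ℕ} (hκ : Antitone κ) : Antitone (extendZero κ) := by
  intro a b hab
  unfold extendZero
  split_ifs with hb ha
  · exact hκ (by simpa using hab)
  · exact absurd (hab.trans_lt hb) ha
  · exact Nat.zero_le _
  · exact le_rfl

lemma sum_Ico_tsub_succ {e : ℕ → ℕ} (he : Antitone e) {a b : ℕ} (hab : a ≤ b) :
    ∑ i ∈ Ico a b, (e i - e (i + 1)) = e a - e b := by
  induction b, hab using Nat.le_induction with
  | base => simp
  | succ n hn ih =>
    rw [sum_Ico_succ_top hn, ih, tsub_add_tsub_cancel (he hn) (he n.le_succ)]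

lemma sum_Ici_partStep {κ : Fin m → ℕ} (hκ : Antitone κ) (j : Fin m) :
    ∑ i ∈ Ici j, partStep κ i = κ j := by
  have h := sum_Ico_tsub_succ (extendZero_antitone hκ) j.isLt.le
  rw [extendZero_self, extendZero_val, Nat.sub_zero, ← Fin.map_valEmbedding_Ici, sum_map] at h
  exact h

lemma sum_partStep_mul_sum_Iic {A : Type*} [CommSemiring A] {κ : Fin m → ℕ} (hκ : Antitone κ)
    (x : Fin m → A) : ∑ i, (partStep κ i : A) * ∑ j ∈ Iic i, x j = ∑ j, (κ j : A) * x j := by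
  simp_rw [mul_sum]
  rw [sum_comm' (t' := univ) (s' := fun j => Ici j) (by simp)]
  refine sum_congr rfl fun j _ => ?_
  rw [← sum_mul, ← Nat.cast_sum, sum_Ici_partStep hκ]

lemma sum_succ_mul_partStep {κ : Fin m → ℕ} (hκ : Antitone κ) :
    ∑ i : Fin m, ((i : ℕ) + 1) * partStep κ i = ∑ i, κ i := by
  simpa [mul_comm] using sum_partStep_mul_sum_Iic hκ (fun _ => (1 : ℕ))

lemma map_leadMinor (φ : R →+* R') (S : Matrix (Fin m) (Fin m) R) (i : Fin m) :
    φ (leadMinor S i) = leadMinor (S.map φ) i := by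
  simp only [leadMinor, RingHom.map_det]
  rfl

lemma map_powerFn (φ : R →+* R') (κ : Fin m → ℕ) (S : Matrix (Fin m) (Fin m) R) :
    φ (powerFn κ S) = powerFn κ (S.map φ) := by
  simp only [powerFn, map_prod, map_pow, map_leadMinor]

lemma map_castLEEmb_univ (i : Fin m) : univ.map (Fin.castLEEmb i.isLt) = Iic i := by
  ext j
  simp only [mem_map, mem_univ, true_and, mem_Iic, Fin.le_def]
  exact ⟨by rintro ⟨a, rfl⟩; exact Nat.le_of_lt_succ a.isLt,
    fun h => ⟨⟨j, Nat.lt_succ_of_le h⟩, rfl⟩⟩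

lemma sum_castLE_eq_sum_Iic {M : Type*} [AddCommMonoid M] (i : Fin m) (f : Fin m → M) :
    ∑ a : Fin (i + 1), f (Fin.castLE i.isLt a) = ∑ j ∈ Iic i, f j := by
  rw [← map_castLEEmb_univ, sum_map]
  rfl

lemma submatrix_castLE_mul_of_lowerTriangular {n k : ℕ} {α β : Type*} (h : k ≤ n)
    {T : Matrix (Fin n) (Fin n) R} (hT : T.IsLowerTriangular) (A : Matrix (Fin n) β R)
    (e : α → β) :
    (T * A).submatrix (Fin.castLE h) e =
      T.submatrix (Fin.castLE h) (Fin.castLE h) * A.submatrix (Fin.castLE h) e := by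
  ext a b
  simp only [submatrix_apply, mul_apply]
  refine (sum_of_injOn (Fin.castLE h) (Fin.castLE_injective h).injOn (by simp)
    (fun j _ hj => ?_) fun _ _ => rfl).symm
  have haj : Fin.castLE h a < j := by
    refine lt_of_lt_of_le (b := k) a.isLt (not_lt.1 fun hjk => hj ⟨⟨j, hjk⟩, ?_⟩)
    simp
  have hzero : T (Fin.castLE h a) j = 0 := hT haj
  rw [hzero, zero_mul]

lemma submatrix_castLE_lowerTriangular_conj {T : Matrix (Fin m) (Fin m) R}
    (hT : T.IsLowerTriangular) (S : Matrix (Fin m) (Fin m) R) (i : Fin m) :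
    (T * S * Tᵀ).submatrix (Fin.castLE i.isLt) (Fin.castLE i.isLt) =
      T.submatrix (Fin.castLE i.isLt) (Fin.castLE i.isLt) *
        S.submatrix (Fin.castLE i.isLt) (Fin.castLE i.isLt) *
          (T.submatrix (Fin.castLE i.isLt) (Fin.castLE i.isLt))ᵀ := by
  have hright : (S * Tᵀ).submatrix (Fin.castLE i.isLt) (Fin.castLE i.isLt) =
      S.submatrix (Fin.castLE i.isLt) (Fin.castLE i.isLt) *
        (T.submatrix (Fin.castLE i.isLt) (Fin.castLE i.isLt))ᵀ := by
    rw [← transpose_transpose (S * Tᵀ), transpose_mul, transpose_transpose, ← transpose_submatrix,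
      submatrix_castLE_mul_of_lowerTriangular i.isLt hT, transpose_mul, transpose_submatrix,
      transpose_transpose]
  rw [Matrix.mul_assoc, submatrix_castLE_mul_of_lowerTriangular i.isLt hT, hright, Matrix.mul_assoc]

lemma leadMinor_lowerTriangular_conj {T : Matrix (Fin m) (Fin m) R}
    (hT : T.IsLowerTriangular) (S : Matrix (Fin m) (Fin m) R) (i : Fin m) :
    leadMinor (T * S * Tᵀ) i = leadMinor (T * Tᵀ) i * leadMinor S i := by
  have hone := submatrix_castLE_lowerTriangular_conj hT 1 i
  rw [Matrix.mul_one, submatrix_one _ (Fin.castLE_injective _), Matrix.mul_one] at hone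
  simp only [leadMinor, submatrix_castLE_lowerTriangular_conj hT, hone, det_mul]
  ring

lemma powerFn_lowerTriangular_conj {T : Matrix (Fin m) (Fin m) R}
    (hT : T.IsLowerTriangular) (κ : Fin m → ℕ) (S : Matrix (Fin m) (Fin m) R) :
    powerFn κ (T * S * Tᵀ) = powerFn κ (T * Tᵀ) * powerFn κ S := by
  simp only [powerFn, leadMinor_lowerTriangular_conj hT, mul_pow, prod_mul_distrib]

lemma leadMinor_one (i : Fin m) : leadMinor (1 : Matrix (Fin m) (Fin m) R) i = 1 := by
  rw [leadMinor, submatrix_one _ (Fin.castLE_injective _), det_one]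

lemma leadMinor_one_add_vecMulVec (v w : Fin m → R) (i : Fin m) :
    leadMinor (1 + vecMulVec v w) i = 1 + ∑ j ∈ Iic i, w j * v j := by
  have hsub : (vecMulVec v w).submatrix (Fin.castLE i.isLt) (Fin.castLE i.isLt) =
      vecMulVec (v ∘ Fin.castLE i.isLt) (w ∘ Fin.castLE i.isLt) := rfl
  rw [leadMinor, submatrix_add, Pi.add_apply, Pi.add_apply,
    submatrix_one _ (Fin.castLE_injective _), hsub, vecMulVec_eq Unit,
    det_one_add_replicateCol_mul_replicateRow, ← sum_castLE_eq_sum_Iic i fun j => w j * v j]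
  rfl

lemma leadMinor_smul (c : R) (S : Matrix (Fin m) (Fin m) R) (i : Fin m) :
    leadMinor (c • S) i = c ^ ((i : ℕ) + 1) * leadMinor S i := by
  rw [leadMinor, submatrix_smul, Pi.smul_apply, Pi.smul_apply, det_smul, Fintype.card_fin,
    leadMinor]

lemma powerFn_smul {κ : Fin m → ℕ} (hκ : Antitone κ) (c : R) (S : Matrix (Fin m) (Fin m) R) :
    powerFn κ (c • S) = c ^ (∑ i, κ i) * powerFn κ S := by
  simp only [powerFn, leadMinor_smul, mul_pow, prod_mul_distrib, ← pow_mul]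
  rw [prod_pow_eq_pow_sum, sum_succ_mul_partStep hκ]

lemma leadMinor_nonneg {S : Matrix (Fin m) (Fin m) ℝ} (hS : S.PosSemidef) (i : Fin m) :
    0 ≤ leadMinor S i :=
  (hS.submatrix _).det_nonneg

lemma powerFn_nonneg (κ : Fin m → ℕ) {S : Matrix (Fin m) (Fin m) ℝ} (hS : S.PosSemidef) :
    0 ≤ powerFn κ S :=
  prod_nonneg fun i _ => pow_nonneg (leadMinor_nonneg hS i) _

lemma continuous_leadMinor {α : Type*} [TopologicalSpace α] [TopologicalSpace R]
    [IsTopologicalRing R] {S : α → Matrix (Fin m) (Fin m) R} (hS : Continuous S) (i : Fin m) :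
    Continuous fun x => leadMinor (S x) i :=
  (hS.matrix_submatrix _ _).matrix_det

lemma continuous_powerFn (κ : Fin m → ℕ) {α : Type*} [TopologicalSpace α] [TopologicalSpace R]
    [IsTopologicalRing R] {S : α → Matrix (Fin m) (Fin m) R} (hS : Continuous S) :
    Continuous fun x => powerFn κ (S x) :=
  continuous_finsetProd _ fun i _ => (continuous_leadMinor hS i).pow _

end PowerFunction
/-! ### Leading exponents of power functions -/

section Dominance

variable {m : ℕ} {R : Type*} [CommSemiring R]

lemma eq_of_sum_Iic_eq {M : Type*} [AddCancelCommMonoid M] {f g : Fin m → M}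
    (h : ∀ r, ∑ i ∈ Iic r, f i = ∑ i ∈ Iic r, g i) : f = g := by
  funext i
  induction i using WellFoundedLT.induction with
  | ind i ih =>
    have hi := h i
    rw [← Iio_insert, sum_insert (by simp), sum_insert (by simp),
      sum_congr rfl fun j hj => ih j (by simpa using hj)] at hi
    exact add_right_cancel hi

lemma Dominated.refl (μ : Fin m → ℕ) : Dominated μ μ := fun _ => le_rfl

lemma Dominated.antisymm {μ κ : Fin m → ℕ} (h : Dominated μ κ) (h' : Dominated κ μ) : μ = κ :=
  eq_of_sum_Iic_eq fun r => le_antisymm (h r) (h' r)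

lemma Dominated.add {μ μ' κ κ' : Fin m → ℕ} (h : Dominated μ κ) (h' : Dominated μ' κ') :
    Dominated (μ + μ') (κ + κ') := fun r => by
  simp only [Pi.add_apply, sum_add_distrib]
  exact add_le_add (h r) (h' r)

lemma Dominated.eq_and_eq_of_add_eq {μ μ' κ κ' : Fin m → ℕ} (h : Dominated μ κ)
    (h' : Dominated μ' κ') (heq : μ + μ' = κ + κ') : μ = κ ∧ μ' = κ' := by
  have hsum : ∀ r, ∑ i ∈ Iic r, μ i + ∑ i ∈ Iic r, μ' i =
      ∑ i ∈ Iic r, κ i + ∑ i ∈ Iic r, κ' i := fun r => by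
    rw [← sum_add_distrib, ← sum_add_distrib]
    exact sum_congr rfl fun i _ => congrFun heq i
  exact ⟨eq_of_sum_Iic_eq fun r => by have := h r; have := h' r; have := hsum r; omega,
    eq_of_sum_Iic_eq fun r => by have := h r; have := h' r; have := hsum r; omega⟩

/-- All exponents of `P` are dominated by `κ`, so that `κ` is the only candidate for a leading
exponent of `P`. -/
def DomBounded (P : MvPolynomial (Fin m) R) (κ : Fin m →₀ ℕ) : Prop :=
  ∀ s, P.coeff s ≠ 0 → Dominated s κ

namespace DomBounded

variable {P Q : MvPolynomial (Fin m) R} {κ μ : Fin m →₀ ℕ}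

lemma mul (hP : DomBounded P κ) (hQ : DomBounded Q μ) : DomBounded (P * Q) (κ + μ) := by
  classical
  intro s hs
  rw [MvPolynomial.coeff_mul] at hs
  obtain ⟨x, hx, hne⟩ := exists_ne_zero_of_sum_ne_zero hs
  rw [← HasAntidiagonal.mem_antidiagonal.1 hx, Finsupp.coe_add, Finsupp.coe_add]
  exact (hP _ (left_ne_zero_of_mul hne)).add (hQ _ (right_ne_zero_of_mul hne))

lemma coeff_mul (hP : DomBounded P κ) (hQ : DomBounded Q μ) :
    (P * Q).coeff (κ + μ) = P.coeff κ * Q.coeff μ := by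
  classical
  rw [MvPolynomial.coeff_mul, sum_eq_single (κ, μ)]
  · rintro ⟨x, y⟩ hxy hne
    by_contra h
    have heq : (x : Fin m → ℕ) + y = κ + μ :=
      congrArg DFunLike.coe (HasAntidiagonal.mem_antidiagonal.1 hxy)
    obtain ⟨hx, hy⟩ := (hP x (left_ne_zero_of_mul h)).eq_and_eq_of_add_eq
      (hQ y (right_ne_zero_of_mul h)) heq
    exact hne (Prod.ext (DFunLike.coe_injective hx) (DFunLike.coe_injective hy))
  · exact fun h => absurd (by simp) h

lemma one : DomBounded (1 : MvPolynomial (Fin m) R) 0 := by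
  classical
  intro s hs
  rw [MvPolynomial.coeff_one] at hs
  rw [← of_not_not fun h => hs (if_neg h)]
  exact Dominated.refl _

lemma pow (hP : DomBounded P κ) (n : ℕ) : DomBounded (P ^ n) (n • κ) := by
  induction n with
  | zero => simpa using one
  | succ n ih => rw [pow_succ, succ_nsmul]; exact ih.mul hP

lemma coeff_pow (hP : DomBounded P κ) (n : ℕ) : (P ^ n).coeff (n • κ) = P.coeff κ ^ n := by
  induction n with
  | zero => simp
  | succ n ih => rw [pow_succ, succ_nsmul, pow_succ, (hP.pow n).coeff_mul hP, ih]

variable {ι : Type*} {F : ι → MvPolynomial (Fin m) R} {e : ι → Fin m →₀ ℕ}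

lemma prod (hF : ∀ i, DomBounded (F i) (e i)) (s : Finset ι) :
    DomBounded (∏ i ∈ s, F i) (∑ i ∈ s, e i) := by
  classical
  induction s using Finset.induction_on with
  | empty => simpa using one
  | insert i s hi ih => rw [prod_insert hi, sum_insert hi]; exact (hF i).mul ih

lemma coeff_prod (hF : ∀ i, DomBounded (F i) (e i)) (s : Finset ι) :
    (∏ i ∈ s, F i).coeff (∑ i ∈ s, e i) = ∏ i ∈ s, (F i).coeff (e i) := by
  classical
  induction s using Finset.induction_on with
  | empty => simp
  | insert i s hi ih =>
    rw [prod_insert hi, sum_insert hi, prod_insert hi, (hF i).coeff_mul (prod hF s), ih]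

end DomBounded

end Dominance

section ConjDiag

variable {m : ℕ} {R : Type*} [CommRing R]

lemma det_mul_diagonal_mul_transpose {n p : Type*} [Fintype n] [DecidableEq n] [Fintype p]
    [DecidableEq p] (A : Matrix n p R) (x : p → R) :
    (A * diagonal x * Aᵀ).det =
      ∑ f : n → p, (∏ a, x (f a)) * ((∏ a, A a (f a)) * (A.submatrix id f).det) := by
  have hrows : A * diagonal x * Aᵀ = fun a => ∑ j, (x j * A a j) • fun b => A b j := by
    funext a b
    simp [mul_apply, diagonal_apply, mul_comm]
  rw [hrows]
  change detRowAlternating.toMultilinearMap (fun a => ∑ j, (x j * A a j) • fun b => A b j) = _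
  rw [MultilinearMap.map_sum]
  refine sum_congr rfl fun f _ => ?_
  rw [MultilinearMap.map_smul_univ _ (fun a => x (f a) * A a (f a)) fun a b => A b (f a),
    prod_mul_distrib, smul_eq_mul, mul_assoc, ← det_transpose (A.submatrix id f)]
  rfl

/-- The matrix `H diag(X₁, …, X_m) Hᵀ` over the polynomials in the latent roots `X₁, …, X_m`. -/
def conjDiag (H : Matrix (Fin m) (Fin m) R) : Matrix (Fin m) (Fin m) (MvPolynomial (Fin m) R) :=
  H.map MvPolynomial.C * diagonal MvPolynomial.X * (H.map MvPolynomial.C)ᵀ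

/-- The exponent of `X₁ ⋯ Xᵢ₊₁`, the leading monomial of the leading minor of size `i + 1`. -/
def initialSegment (i : Fin m) : Fin m →₀ ℕ := ∑ j ∈ Iic i, Finsupp.single j 1

lemma conjDiag_map_eval (H : Matrix (Fin m) (Fin m) R) (y : Fin m → R) :
    (conjDiag H).map (MvPolynomial.eval y) = H * diagonal y * Hᵀ := by
  have hcancel : ∀ A : Matrix (Fin m) (Fin m) R,
      (A.map MvPolynomial.C).map (MvPolynomial.eval y) = A := fun A => by ext; simp
  rw [conjDiag, Matrix.map_mul, Matrix.map_mul, ← transpose_map, hcancel, hcancel,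
    diagonal_map (map_zero _)]
  simp only [MvPolynomial.eval_X]

lemma leadMinor_conjDiag (H : Matrix (Fin m) (Fin m) R) (i : Fin m) :
    leadMinor (conjDiag H) i = ∑ f : Fin (i + 1) → Fin m,
      MvPolynomial.monomial (∑ a, Finsupp.single (f a) 1)
        ((∏ a, H (Fin.castLE i.isLt a) (f a)) * (H.submatrix (Fin.castLE i.isLt) f).det) := by
  refine (det_mul_diagonal_mul_transpose
    ((H.map MvPolynomial.C).submatrix (Fin.castLE i.isLt) id) MvPolynomial.X).trans ?_
  refine sum_congr rfl fun f _ => ?_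
  have hdet : ((H.map MvPolynomial.C).submatrix (Fin.castLE i.isLt) f).det =
      (MvPolynomial.C (H.submatrix (Fin.castLE i.isLt) f).det : MvPolynomial (Fin m) R) := by
    rw [RingHom.map_det]
    rfl
  rw [submatrix_submatrix, Function.comp_id, Function.id_comp, hdet,
    MvPolynomial.monomial_sum_index, map_mul, map_prod, mul_comm]
  rfl

lemma det_submatrix_eq_zero_of_not_injective {n p q : Type*} [Fintype n] [DecidableEq n]
    (A : Matrix p q R) (e : n → p) {f : n → q} (hf : ¬ Function.Injective f) :
    (A.submatrix e f).det = 0 := by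
  obtain ⟨a, b, hab, hne⟩ := Function.not_injective_iff.1 hf
  exact det_zero_of_column_eq hne fun x => by simp only [submatrix_apply, hab]

lemma sum_single_one_apply (s : Finset (Fin m)) (j : Fin m) :
    (∑ k ∈ s, Finsupp.single k 1 : Fin m →₀ ℕ) j = if j ∈ s then 1 else 0 := by
  simp [Finsupp.finsetSum_apply, Finsupp.single_apply]

lemma sum_single_one_injective :
    Function.Injective fun s : Finset (Fin m) => (∑ k ∈ s, Finsupp.single k 1 : Fin m →₀ ℕ) := by
  intro s s' h
  ext j
  have hj := DFunLike.congr_fun h j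
  simp only [sum_single_one_apply] at hj
  split_ifs at hj <;> simp_all

lemma dominated_initialSegment {s : Finset (Fin m)} {i : Fin m} (hs : #s ≤ i + 1) :
    Dominated (∑ k ∈ s, Finsupp.single k 1 : Fin m →₀ ℕ) (initialSegment i) := by
  intro r
  have hcard : ∀ s' : Finset (Fin m), ∑ j ∈ Iic r, (∑ k ∈ s', Finsupp.single k 1 : Fin m →₀ ℕ) j =
      #(Iic r ∩ s') := fun s' => by simp [sum_single_one_apply]
  rw [initialSegment, hcard, hcard]
  rcases le_total i r with hir | hri
  · rw [inter_eq_right.2 (Iic_subset_Iic.2 hir), Fin.card_Iic]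
    exact (card_le_card inter_subset_right).trans hs
  · rw [inter_eq_left.2 (Iic_subset_Iic.2 hri)]
    exact card_le_card inter_subset_left

lemma domBounded_leadMinor_conjDiag (H : Matrix (Fin m) (Fin m) R) (i : Fin m) :
    DomBounded (leadMinor (conjDiag H) i) (initialSegment i) := by
  classical
  intro s hs
  rw [leadMinor_conjDiag, MvPolynomial.coeff_sum] at hs
  obtain ⟨f, -, hf⟩ := exists_ne_zero_of_sum_ne_zero hs
  rw [MvPolynomial.coeff_monomial] at hf
  obtain ⟨rfl, hne⟩ := ite_ne_right_iff.1 hf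
  have hinj : Function.Injective f := by
    by_contra hn
    exact hne (by rw [det_submatrix_eq_zero_of_not_injective H _ hn, mul_zero])
  rw [← sum_image (f := fun k => Finsupp.single k 1) hinj.injOn]
  exact dominated_initialSegment (by rw [card_image_of_injective _ hinj]; simp)

lemma sum_single_eq_initialSegment_iff {i : Fin m} {f : Fin (i + 1) → Fin m}
    (hf : Function.Injective f) :
    ∑ a, Finsupp.single (f a) 1 = initialSegment i ↔ ∀ a, f a ≤ i := by
  classical
  rw [← sum_image (f := fun k => Finsupp.single k 1) hf.injOn, initialSegment,
    sum_single_one_injective.eq_iff]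
  have hcard : #(Iic i) ≤ #(univ.image f) := by rw [card_image_of_injective _ hf]; simp
  rw [← (subset_iff_eq_of_card_le hcard), image_subset_iff]
  simp

/-- Setting the variables after the `i`-th to `0` and the others to `1` isolates this coefficient
and turns the minor into that of `H Hᵀ` for the leading block of `H`. -/
lemma coeff_leadMinor_conjDiag (H : Matrix (Fin m) (Fin m) R) (i : Fin m) :
    (leadMinor (conjDiag H) i).coeff (initialSegment i) = leadMinor H i ^ 2 := by
  classical
  set y : Fin m → R := fun j => if j ≤ i then 1 else 0
  set A := H.submatrix (Fin.castLE i.isLt) id with hA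
  have hsq : leadMinor H i ^ 2 = (A * diagonal y * Aᵀ).det := by
    rw [sq, leadMinor]
    nth_rewrite 2 [← det_transpose]
    rw [← det_mul]
    congr 1
    ext a b
    rw [mul_apply, mul_apply]
    simp only [hA, mul_diagonal, transpose_apply, submatrix_apply, id]
    rw [sum_castLE_eq_sum_Iic i fun j => H (Fin.castLE i.isLt a) j * H (Fin.castLE i.isLt b) j]
    simp only [y, mul_ite, mul_one, mul_zero, ite_mul, zero_mul, ← sum_filter]
    congr 1
    ext; simp
  rw [hsq, det_mul_diagonal_mul_transpose, leadMinor_conjDiag, MvPolynomial.coeff_sum]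
  refine sum_congr rfl fun f _ => ?_
  rw [MvPolynomial.coeff_monomial, hA, submatrix_submatrix, Function.comp_id, Function.id_comp]
  by_cases hf : Function.Injective f
  · simp only [sum_single_eq_initialSegment_iff hf, y, prod_ite_zero, prod_const_one, mem_univ,
      true_imp_iff, ite_mul, one_mul, zero_mul, submatrix_apply, id]
  · simp only [det_submatrix_eq_zero_of_not_injective H _ hf, mul_zero, ite_self]

lemma sum_partStep_smul_initialSegment {κ : Fin m → ℕ} (hκ : Antitone κ) :
    ∑ i, partStep κ i • initialSegment i = Finsupp.equivFunOnFinite.symm κ := by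
  ext j
  rw [Finsupp.finsetSum_apply]
  simp only [Finsupp.smul_apply, initialSegment, sum_single_one_apply,
    mem_Iic, Finsupp.equivFunOnFinite_symm_apply_apply, smul_eq_mul, mul_ite, mul_one, mul_zero]
  rw [← sum_filter, filter_le_eq_Ici]
  exact sum_Ici_partStep hκ j

lemma domBounded_powerFn_conjDiag {κ : Fin m → ℕ} (hκ : Antitone κ)
    (H : Matrix (Fin m) (Fin m) R) :
    DomBounded (powerFn κ (conjDiag H)) (Finsupp.equivFunOnFinite.symm κ) := by
  rw [← sum_partStep_smul_initialSegment hκ]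
  exact DomBounded.prod (fun i => (domBounded_leadMinor_conjDiag H i).pow _) univ

lemma coeff_powerFn_conjDiag {κ : Fin m → ℕ} (hκ : Antitone κ) (H : Matrix (Fin m) (Fin m) R) :
    (powerFn κ (conjDiag H)).coeff (Finsupp.equivFunOnFinite.symm κ) =
      ∏ i, (leadMinor H i ^ 2) ^ partStep κ i := by
  rw [← sum_partStep_smul_initialSegment hκ, powerFn,
    DomBounded.coeff_prod fun i => (domBounded_leadMinor_conjDiag H i).pow _]
  exact prod_congr rfl fun i _ => by
    rw [(domBounded_leadMinor_conjDiag H i).coeff_pow, coeff_leadMinor_conjDiag]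

lemma isHomogeneous_powerFn_conjDiag {κ : Fin m → ℕ} (hκ : Antitone κ)
    (H : Matrix (Fin m) (Fin m) R) : (powerFn κ (conjDiag H)).IsHomogeneous (∑ i, κ i) := by
  rw [← sum_succ_mul_partStep hκ]
  refine MvPolynomial.IsHomogeneous.prod _ _ _ fun i _ => MvPolynomial.IsHomogeneous.pow ?_ _
  rw [leadMinor_conjDiag]
  refine MvPolynomial.IsHomogeneous.sum _ _ _ fun f _ => ?_
  exact MvPolynomial.isHomogeneous_monomial _ (by rw [map_sum]; simp)

end ConjDiag

/-! ### Means over the orthogonal group -/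

section Haar

variable {m n : ℕ}

instance : MeasurableSpace (orthogonalGroup (Fin n) ℝ) := borel _

instance : BorelSpace (orthogonalGroup (Fin n) ℝ) := ⟨rfl⟩

lemma mul_transpose_of_orthogonal (Q : orthogonalGroup (Fin n) ℝ) : Q.1 * Q.1ᵀ = 1 :=
  (mem_orthogonalGroup_iff _ _).1 Q.2

lemma transpose_mul_of_orthogonal (Q : orthogonalGroup (Fin n) ℝ) : Q.1ᵀ * Q.1 = 1 :=
  (mem_orthogonalGroup_iff' _ _).1 Q.2

lemma isClosed_orthogonalGroup :
    IsClosed (orthogonalGroup (Fin n) ℝ : Set (Matrix (Fin n) (Fin n) ℝ)) := by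
  have hset : (orthogonalGroup (Fin n) ℝ : Set (Matrix (Fin n) (Fin n) ℝ)) = {A | A * Aᵀ = 1} :=
    Set.ext fun A => mem_orthogonalGroup_iff _ _
  rw [hset]
  exact isClosed_eq (continuous_id.matrix_mul continuous_id.matrix_transpose) continuous_const

instance : CompactSpace (orthogonalGroup (Fin n) ℝ) := by
  refine isCompact_iff_compactSpace.1 (IsCompact.of_isClosed_subset
    (isCompact_univ_pi fun _ : Fin n => isCompact_univ_pi fun _ : Fin n =>
      isCompact_Icc (a := (-1 : ℝ)) (b := 1)) isClosed_orthogonalGroup ?_)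
  intro A hA i _ j _
  exact abs_le.1 (entry_norm_bound_of_unitary hA i j)

/-- The invariant probability measure on the orthogonal group. -/
def haarO (n : ℕ) : Measure (orthogonalGroup (Fin n) ℝ) := Measure.haarMeasure ⊤

instance : IsProbabilityMeasure (haarO n) := ⟨Measure.haarMeasure_self (K₀ := ⊤)⟩

instance : (haarO n).IsHaarMeasure := inferInstanceAs (Measure.haarMeasure _).IsHaarMeasure

instance : (haarO n).IsMulRightInvariant := by
  refine ⟨fun g => ?_⟩
  have : IsProbabilityMeasure ((haarO n).map (· * g)) :=
    Measure.isProbabilityMeasure_map (measurable_mul_const g).aemeasurable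
  exact Measure.isHaarMeasure_eq_of_isProbabilityMeasure _ _

lemma integrable_haarO {E : Type*} [NormedAddCommGroup E] {f : orthogonalGroup (Fin n) ℝ → E}
    (hf : Continuous f) : Integrable f (haarO n) :=
  hf.integrable_of_hasCompactSupport (HasCompactSupport.of_compactSpace f)

/-- The first `m` rows of a square matrix of size `n ≥ m`. -/
def topRows {α : Type*} (h : m ≤ n) (Q : Matrix (Fin n) (Fin n) α) : Matrix (Fin m) (Fin n) α :=
  Q.submatrix (Fin.castLE h) id

lemma topRows_mul (h : m ≤ n) (K Q : Matrix (Fin n) (Fin n) ℝ) :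
    topRows h (K * Q) = topRows h K * Q := rfl

lemma topRows_mul_transpose_of_orthogonal (h : m ≤ n) (K : orthogonalGroup (Fin n) ℝ) :
    topRows h K.1 * (topRows h K.1)ᵀ = 1 := by
  change (K.1 * K.1ᵀ).submatrix (Fin.castLE h) (Fin.castLE h) = 1
  rw [mul_transpose_of_orthogonal, submatrix_one _ (Fin.castLE_injective h)]

lemma exists_lowerTriangular_mul_orthogonal (A : Matrix (Fin n) (Fin n) ℝ) :
    ∃ T : Matrix (Fin n) (Fin n) ℝ, T.IsLowerTriangular ∧
      ∃ K : orthogonalGroup (Fin n) ℝ, A = T * K.1 := by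
  set f : Fin n → EuclideanSpace ℝ (Fin n) := fun i => WithLp.toLp 2 (A i)
  set e := EuclideanSpace.basisFun (Fin n) ℝ
  set b := InnerProductSpace.gramSchmidtOrthonormalBasis (𝕜 := ℝ)
    (by simp : Module.finrank ℝ (EuclideanSpace ℝ (Fin n)) = Fintype.card (Fin n)) f
  have hK : (e.toBasis.toMatrix b)ᵀ ∈ orthogonalGroup (Fin n) ℝ := by
    rw [mem_orthogonalGroup_iff, transpose_transpose]
    exact (mem_orthogonalGroup_iff' _ _).1 (e.toMatrix_orthonormalBasis_mem_orthogonal b)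
  have hA : A = (e.toBasis.toMatrix f)ᵀ := by
    ext i j
    simp [Module.Basis.toMatrix_apply, e, f]
  refine ⟨(b.toBasis.toMatrix f)ᵀ, fun i j hij =>
    InnerProductSpace.gramSchmidtOrthonormalBasis_inv_triangular' _ f hij, ⟨_, hK⟩, ?_⟩
  rw [← transpose_mul, ← b.coe_toBasis, Module.Basis.toMatrix_mul_toMatrix]
  exact hA

lemma exists_lowerTriangular_mul_topRows (h : m ≤ n) (g : Matrix (Fin m) (Fin n) ℝ) :
    ∃ T : Matrix (Fin m) (Fin m) ℝ, T.IsLowerTriangular ∧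
      ∃ K : orthogonalGroup (Fin n) ℝ, g = T * topRows h K.1 := by
  set A : Matrix (Fin n) (Fin n) ℝ :=
    of fun i => if hi : (i : ℕ) < m then g ⟨i, hi⟩ else 0 with hA
  obtain ⟨T, hT, K, hTK⟩ := exists_lowerTriangular_mul_orthogonal A
  refine ⟨T.submatrix (Fin.castLE h) (Fin.castLE h), fun i j hij => hT hij, K, ?_⟩
  rw [topRows, ← submatrix_castLE_mul_of_lowerTriangular h hT, ← hTK]
  ext i j
  simp [hA]

/-- The mean of the power function over the orbit of `Λ`, cut down to size `m`. -/
def orbitMean (h : m ≤ n) (κ : Fin m → ℕ) (Λ : Matrix (Fin n) (Fin n) ℝ) : ℝ :=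
  ∫ Q : orthogonalGroup (Fin n) ℝ, powerFn κ (topRows h Q.1 * Λ * (topRows h Q.1)ᵀ) ∂haarO n

/-- Writing `g = T K` with `T` lower triangular and `K` orthonormal, `T` factors out of the power
function and `K` is absorbed by the invariance of the mean. -/
lemma integral_powerFn_conj (h : m ≤ n) (κ : Fin m → ℕ) (g : Matrix (Fin m) (Fin n) ℝ)
    (Λ : Matrix (Fin n) (Fin n) ℝ) :
    ∫ Q : orthogonalGroup (Fin n) ℝ, powerFn κ (g * (Q.1 * Λ * Q.1ᵀ) * gᵀ) ∂haarO n =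
      powerFn κ (g * gᵀ) * orbitMean h κ Λ := by
  obtain ⟨T, hT, K, hg⟩ := exists_lowerTriangular_mul_topRows h g
  have hgram : g * gᵀ = T * Tᵀ := by
    rw [hg, transpose_mul, Matrix.mul_assoc, ← Matrix.mul_assoc (topRows h K.1),
      topRows_mul_transpose_of_orthogonal, Matrix.one_mul]
  have hconj : ∀ Q : orthogonalGroup (Fin n) ℝ, g * (Q.1 * Λ * Q.1ᵀ) * gᵀ =
      T * (topRows h (K * Q).1 * Λ * (topRows h (K * Q).1)ᵀ) * Tᵀ := fun Q => by
    rw [hg, Submonoid.coe_mul, topRows_mul]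
    simp only [transpose_mul, Matrix.mul_assoc]
  simp_rw [hconj, powerFn_lowerTriangular_conj hT]
  rw [integral_const_mul, hgram, orbitMean, integral_mul_left_eq_self (μ := haarO n)
    (fun Q => powerFn κ (topRows h Q.1 * Λ * (topRows h Q.1)ᵀ)) K]

end Haar

/-! ### Spherical polynomials -/

section SphericalPoly

variable {m : ℕ} {κ : Fin m → ℕ}

/-- The spherical polynomial: the mean of the power function over the orthogonal orbit of a
diagonal matrix, as a polynomial in the diagonal entries. -/
def sphericalPoly (κ : Fin m → ℕ) : MvPolynomial (Fin m) ℝ :=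
  ∑ s ∈ finsuppAntidiag univ (∑ i, κ i), MvPolynomial.monomial s
    (∫ H : orthogonalGroup (Fin m) ℝ, (powerFn κ (conjDiag H.1)).coeff s ∂haarO m)

lemma mem_finsuppAntidiag_univ {ι : Type*} [Fintype ι] [DecidableEq ι] {t : ℕ} {s : ι →₀ ℕ} :
    s ∈ finsuppAntidiag univ t ↔ s.degree = t := by
  rw [mem_finsuppAntidiag, Finsupp.degree_eq_sum]
  simp

lemma eval_eq_sum_finsuppAntidiag {ι R : Type*} [Fintype ι] [DecidableEq ι] [CommSemiring R]
    {P : MvPolynomial ι R} {t : ℕ} (hP : P.IsHomogeneous t) (y : ι → R) :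
    MvPolynomial.eval y P = ∑ s ∈ finsuppAntidiag univ t, P.coeff s * ∏ i, y i ^ s i := by
  rw [MvPolynomial.eval_eq']
  refine sum_subset (fun s hs => ?_) fun s _ hs => ?_
  · rw [mem_finsuppAntidiag_univ]
    by_contra hne
    exact MvPolynomial.mem_support_iff.1 hs (hP.coeff_eq_zero hne)
  · rw [MvPolynomial.notMem_support_iff.1 hs, zero_mul]

lemma continuous_coeff_mul {α σ R : Type*} [TopologicalSpace α] [CommSemiring R]
    [TopologicalSpace R] [IsTopologicalSemiring R] {P Q : α → MvPolynomial σ R}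
    (hP : ∀ s, Continuous fun x => (P x).coeff s) (hQ : ∀ s, Continuous fun x => (Q x).coeff s)
    (s : σ →₀ ℕ) : Continuous fun x => (P x * Q x).coeff s := by
  classical
  simp only [MvPolynomial.coeff_mul]
  exact continuous_finsetSum _ fun x _ => (hP _).mul (hQ _)

lemma continuous_coeff_pow {α σ R : Type*} [TopologicalSpace α] [CommSemiring R]
    [TopologicalSpace R] [IsTopologicalSemiring R] {P : α → MvPolynomial σ R}
    (hP : ∀ s, Continuous fun x => (P x).coeff s) (k : ℕ) (s : σ →₀ ℕ) :
    Continuous fun x => (P x ^ k).coeff s := by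
  induction k generalizing s with
  | zero => simpa only [pow_zero] using continuous_const
  | succ k ih => simpa only [pow_succ] using continuous_coeff_mul ih hP s

lemma continuous_coeff_prod {ι α σ R : Type*} [TopologicalSpace α] [CommSemiring R]
    [TopologicalSpace R] [IsTopologicalSemiring R] {P : ι → α → MvPolynomial σ R}
    (hP : ∀ i s, Continuous fun x => (P i x).coeff s) (I : Finset ι) (s : σ →₀ ℕ) :
    Continuous fun x => (∏ i ∈ I, P i x).coeff s := by
  classical
  induction I using Finset.induction_on generalizing s with
  | empty => simpa only [prod_empty] using continuous_const
  | insert i I hi ih => simpa only [prod_insert hi] using continuous_coeff_mul (hP i) ih s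

lemma continuous_coeff_powerFn_conjDiag (κ : Fin m → ℕ) (s : Fin m →₀ ℕ) :
    Continuous fun H : orthogonalGroup (Fin m) ℝ => (powerFn κ (conjDiag H.1)).coeff s := by
  have hentry : ∀ i j, Continuous fun H : orthogonalGroup (Fin m) ℝ => H.1 i j :=
    fun i j => continuous_subtype_val.matrix_elem i j
  refine continuous_coeff_prod (fun i => continuous_coeff_pow (fun s => ?_) _) univ s
  simp only [leadMinor_conjDiag, MvPolynomial.coeff_sum, MvPolynomial.coeff_monomial]
  refine continuous_finsetSum _ fun f _ => ?_
  split_ifs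
  · exact (continuous_finsetProd _ fun a _ => hentry _ _).mul
      (continuous_matrix fun a b => hentry _ _).matrix_det
  · exact continuous_const

lemma coeff_sphericalPoly (hκ : Antitone κ) (s : Fin m →₀ ℕ) :
    (sphericalPoly κ).coeff s = ∫ H : orthogonalGroup (Fin m) ℝ,
      (powerFn κ (conjDiag H.1)).coeff s ∂haarO m := by
  classical
  simp only [sphericalPoly, MvPolynomial.coeff_sum, MvPolynomial.coeff_monomial]
  rw [sum_ite_eq', ite_eq_left_iff, mem_finsuppAntidiag_univ]
  intro hs
  simp only [(isHomogeneous_powerFn_conjDiag hκ _).coeff_eq_zero hs, integral_zero]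

lemma isHomogeneous_sphericalPoly (κ : Fin m → ℕ) :
    (sphericalPoly κ).IsHomogeneous (∑ i, κ i) :=
  MvPolynomial.IsHomogeneous.sum _ _ _ fun _ hs =>
    MvPolynomial.isHomogeneous_monomial _ (mem_finsuppAntidiag_univ.1 hs)

lemma eval_sphericalPoly (hκ : Antitone κ) (y : Fin m → ℝ) :
    MvPolynomial.eval y (sphericalPoly κ) = ∫ H : orthogonalGroup (Fin m) ℝ,
      powerFn κ (H.1 * diagonal y * H.1ᵀ) ∂haarO m := by
  simp_rw [← conjDiag_map_eval, ← map_powerFn,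
    eval_eq_sum_finsuppAntidiag (isHomogeneous_powerFn_conjDiag hκ _)]
  rw [integral_finsetSum _ fun s _ =>
    (integrable_haarO (continuous_coeff_powerFn_conjDiag κ s)).mul_const _,
    eval_eq_sum_finsuppAntidiag (isHomogeneous_sphericalPoly κ)]
  simp only [coeff_sphericalPoly hκ, integral_mul_const]

lemma integral_powerFn_conj_diagonal (hκ : Antitone κ) (U : orthogonalGroup (Fin m) ℝ)
    (y : Fin m → ℝ) :
    ∫ H : orthogonalGroup (Fin m) ℝ,
      powerFn κ (H.1 * (U.1 * diagonal y * U.1ᵀ) * H.1ᵀ) ∂haarO m =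
        MvPolynomial.eval y (sphericalPoly κ) := by
  rw [eval_sphericalPoly hκ, ← integral_mul_right_eq_self (μ := haarO m)
    (fun H => powerFn κ (H.1 * diagonal y * H.1ᵀ)) U]
  simp only [Submonoid.coe_mul, transpose_mul, Matrix.mul_assoc]

lemma exists_orthogonal_diagonalization {S : Matrix (Fin m) (Fin m) ℝ} (hS : S.IsHermitian) :
    ∃ U : orthogonalGroup (Fin m) ℝ, S = U.1 * diagonal hS.eigenvalues * U.1ᵀ :=
  ⟨hS.eigenvectorUnitary, hS.spectral_theorem⟩

lemma integral_powerFn_conj_hermitian (hκ : Antitone κ) {S : Matrix (Fin m) (Fin m) ℝ}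
    (hS : S.IsHermitian) :
    ∫ H : orthogonalGroup (Fin m) ℝ, powerFn κ (H.1 * S * H.1ᵀ) ∂haarO m =
      MvPolynomial.eval hS.eigenvalues (sphericalPoly κ) := by
  obtain ⟨U, hU⟩ := exists_orthogonal_diagonalization hS
  conv_lhs => rw [hU]
  exact integral_powerFn_conj_diagonal hκ U _

lemma isSymmetric_sphericalPoly (hκ : Antitone κ) : (sphericalPoly κ).IsSymmetric := by
  intro σ
  refine MvPolynomial.funext fun y => ?_
  set P : Matrix (Fin m) (Fin m) ℝ := (1 : Matrix (Fin m) (Fin m) ℝ).submatrix id σ with hP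
  have hmem : P ∈ orthogonalGroup (Fin m) ℝ := by
    rw [mem_orthogonalGroup_iff, hP, transpose_submatrix, transpose_one, submatrix_mul_equiv,
      Matrix.one_mul, submatrix_id_id]
  have hconj : P * diagonal (y ∘ σ) * Pᵀ = diagonal y := by
    rw [← submatrix_diagonal_equiv, hP, transpose_submatrix, transpose_one, submatrix_mul_equiv,
      submatrix_mul_equiv, Matrix.one_mul, Matrix.mul_one, submatrix_id_id]
  rw [MvPolynomial.eval_rename, ← integral_powerFn_conj_diagonal hκ ⟨P, hmem⟩,
    eval_sphericalPoly hκ]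
  simp only [hconj]

lemma domBounded_sphericalPoly (hκ : Antitone κ) :
    DomBounded (sphericalPoly κ) (Finsupp.equivFunOnFinite.symm κ) := by
  intro s
  contrapose!
  intro hs
  have hcoeff : ∀ H : orthogonalGroup (Fin m) ℝ, (powerFn κ (conjDiag H.1)).coeff s = 0 :=
    fun H => not_imp_comm.1 (domBounded_powerFn_conjDiag hκ H.1 s) hs
  simp only [coeff_sphericalPoly hκ, hcoeff, integral_zero]

lemma coeff_sphericalPoly_self_pos (hκ : Antitone κ) :
    0 < (sphericalPoly κ).coeff (Finsupp.equivFunOnFinite.symm κ) := by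
  rw [coeff_sphericalPoly hκ]
  refine (continuous_coeff_powerFn_conjDiag κ _).integral_pos_of_hasCompactSupport_nonneg_nonzero
    (HasCompactSupport.of_compactSpace _) (fun H => ?_) (x := 1) ?_
  · simp only [coeff_powerFn_conjDiag hκ]
    exact prod_nonneg fun i _ => pow_nonneg (sq_nonneg _) _
  · simp [coeff_powerFn_conjDiag hκ, leadMinor_one]

lemma eval_sphericalPoly_nonneg (hκ : Antitone κ) {y : Fin m → ℝ} (hy : 0 ≤ y) :
    0 ≤ MvPolynomial.eval y (sphericalPoly κ) := by
  rw [eval_sphericalPoly hκ]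
  refine integral_nonneg fun H => powerFn_nonneg κ ?_
  simpa only [conjTranspose_eq_transpose_of_trivial] using
    (PosSemidef.diagonal hy).mul_mul_conjTranspose_same H.1

end SphericalPoly

/-! ### Rank one perturbations of a diagonal matrix -/

section Taylor

variable {σ R A : Type*} [Fintype σ] [CommRing R] [CommRing A] [Algebra R A]

/-- The differential of `F` at `z` in the direction `δ`. -/
def firstDiff (z δ : σ → A) (F : MvPolynomial σ R) : A :=
  ∑ i, MvPolynomial.aeval z (MvPolynomial.pderiv i F) * δ i

/-- The Hessian form of `F` at `z` in the direction `δ`. -/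
def secondDiff (z δ : σ → A) (F : MvPolynomial σ R) : A :=
  ∑ i, ∑ j, MvPolynomial.aeval z (MvPolynomial.pderiv i (MvPolynomial.pderiv j F)) * (δ i * δ j)

lemma firstDiff_mul (z δ : σ → A) (F G : MvPolynomial σ R) :
    firstDiff z δ (F * G) = firstDiff z δ F * MvPolynomial.aeval z G +
      MvPolynomial.aeval z F * firstDiff z δ G := by
  simp only [firstDiff, MvPolynomial.pderiv_mul, map_add, map_mul, add_mul, sum_add_distrib,
    sum_mul, mul_sum]
  congr 1 <;> exact sum_congr rfl fun i _ => by ring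

lemma secondDiff_mul (z δ : σ → A) (F G : MvPolynomial σ R) :
    secondDiff z δ (F * G) = secondDiff z δ F * MvPolynomial.aeval z G +
      2 * (firstDiff z δ F * firstDiff z δ G) + MvPolynomial.aeval z F * secondDiff z δ G := by
  have hcross : ∑ i, ∑ j, MvPolynomial.aeval z (MvPolynomial.pderiv j F) *
      MvPolynomial.aeval z (MvPolynomial.pderiv i G) * (δ i * δ j) =
        firstDiff z δ F * firstDiff z δ G := by
    rw [firstDiff, firstDiff, sum_mul_sum, sum_comm]
    exact sum_congr rfl fun i _ => sum_congr rfl fun j _ => by ring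
  have hcross' : ∑ i, ∑ j, MvPolynomial.aeval z (MvPolynomial.pderiv i F) *
      MvPolynomial.aeval z (MvPolynomial.pderiv j G) * (δ i * δ j) =
        firstDiff z δ F * firstDiff z δ G := by
    rw [← hcross, sum_comm]
    exact sum_congr rfl fun i _ => sum_congr rfl fun j _ => by ring
  rw [two_mul]
  nth_rewrite 1 [← hcross]
  rw [← hcross']
  simp only [secondDiff, MvPolynomial.pderiv_mul, map_add, map_mul, sum_mul, mul_sum,
    ← sum_add_distrib]
  exact sum_congr rfl fun i _ => sum_congr rfl fun j _ => by ring

lemma firstDiff_X (z δ : σ → A) (k : σ) :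
    firstDiff z δ (MvPolynomial.X k : MvPolynomial σ R) = δ k := by
  classical
  rw [firstDiff, sum_eq_single k (fun i _ hik => ?_) (by simp)]
  · simp
  · rw [MvPolynomial.pderiv_X_of_ne hik.symm, map_zero, zero_mul]

lemma secondDiff_X (z δ : σ → A) (k : σ) :
    secondDiff z δ (MvPolynomial.X k : MvPolynomial σ R) = 0 := by
  classical
  refine sum_eq_zero fun i _ => sum_eq_zero fun j _ => ?_
  rw [MvPolynomial.pderiv_X, Pi.single_apply, apply_ite (MvPolynomial.pderiv i)]
  simp

lemma secondDiff_mul_eq_zero {δ : σ → A} (hδ : ∀ i j k, δ i * δ j * δ k = 0) (z : σ → A)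
    (F : MvPolynomial σ R) (k : σ) : secondDiff z δ F * δ k = 0 := by
  simp only [secondDiff, sum_mul]
  exact sum_eq_zero fun i _ => sum_eq_zero fun j _ => by rw [mul_assoc, hδ, mul_zero]

lemma two_mul_aeval_add {δ : σ → A} (hδ : ∀ i j k, δ i * δ j * δ k = 0) (z : σ → A)
    (F : MvPolynomial σ R) :
    2 * MvPolynomial.aeval (z + δ) F =
      2 * MvPolynomial.aeval z F + 2 * firstDiff z δ F + secondDiff z δ F := by
  induction F using MvPolynomial.induction_on with
  | C a => simp [firstDiff, secondDiff]
  | add p q hp hq =>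
    simp only [firstDiff, secondDiff, map_add, add_mul, sum_add_distrib] at hp hq ⊢
    linear_combination hp + hq
  | mul_X p k hp =>
    simp only [firstDiff_mul, secondDiff_mul, firstDiff_X, secondDiff_X, map_mul,
      MvPolynomial.aeval_X, Pi.add_apply]
    linear_combination (z k + δ k) * hp + secondDiff_mul_eq_zero hδ z p k

end Taylor

lemma pderiv_prod_X {σ R : Type*} [DecidableEq σ] [CommSemiring R] (s : Finset σ) (i : σ) :
    MvPolynomial.pderiv i (∏ k ∈ s, MvPolynomial.X k : MvPolynomial σ R) =
      if i ∈ s then ∏ k ∈ s.erase i, MvPolynomial.X k else 0 := by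
  induction s using Finset.induction_on with
  | empty => simp
  | insert a s ha ih =>
    rw [prod_insert ha, MvPolynomial.pderiv_mul, ih, MvPolynomial.pderiv_X, Pi.single_apply]
    obtain rfl | hia := eq_or_ne a i
    · simp [ha]
    · rw [if_neg hia, zero_mul, zero_add, mul_ite, mul_zero, erase_insert_of_ne hia,
        prod_insert (mt mem_of_mem_erase ha)]
      simp only [mem_insert, hia.symm, false_or]

section EigenShift

variable {m : ℕ} {A : Type*} [CommRing A] [Algebra ℝ A]

/-- The shift of the eigenvalue `yᵢ` of `diag(y)` under the perturbation `e v vᵀ`, up to second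
order in `e`, where `wᵢ = vᵢ²`. The term `j = i` vanishes because of the division by zero. -/
def eigenShift (y w : Fin m → ℝ) (e : A) (i : Fin m) : A :=
  algebraMap ℝ A (w i) * e + algebraMap ℝ A (∑ j, w i * w j / (y i - y j)) * e ^ 2

lemma eigenShift_mul {e : A} (he : e ^ 3 = 0) (y w : Fin m → ℝ) (i j : Fin m) :
    eigenShift y w e i * eigenShift y w e j = algebraMap ℝ A (w i * w j) * e ^ 2 := by
  rw [eigenShift, eigenShift, map_mul]
  generalize algebraMap ℝ A (∑ k, w i * w k / (y i - y k)) = a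
  generalize algebraMap ℝ A (∑ k, w j * w k / (y j - y k)) = b
  linear_combination (algebraMap ℝ A (w i) * b + algebraMap ℝ A (w j) * a + a * b * e) * he

lemma eigenShift_mul_mul {e : A} (he : e ^ 3 = 0) (y w : Fin m → ℝ) (i j k : Fin m) :
    eigenShift y w e i * eigenShift y w e j * eigenShift y w e k = 0 := by
  rw [eigenShift_mul he, eigenShift]
  generalize algebraMap ℝ A (∑ l, w k * w l / (y k - y l)) = c
  linear_combination (algebraMap ℝ A (w i * w j) * (algebraMap ℝ A (w k) + c * e)) * he

/-- The partial fraction `1 / (zᵢ zⱼ) = (1 / zᵢ - 1 / zⱼ) / (zⱼ - zᵢ)` multiplied by `∏ zₖ`. -/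
lemma aeval_pderiv_pderiv_prod_X {y : Fin m → ℝ} (hy : Function.Injective y) {z : Fin m → A}
    (hz : ∀ i j, z i - z j = algebraMap ℝ A (y j - y i)) (c : ℝ) (i j : Fin m) :
    MvPolynomial.aeval z (MvPolynomial.pderiv i (MvPolynomial.pderiv j
        (∏ k, MvPolynomial.X k : MvPolynomial (Fin m) ℝ))) * algebraMap ℝ A c =
      algebraMap ℝ A (c / (y i - y j)) *
        (∏ k ∈ univ.erase i, z k - ∏ k ∈ univ.erase j, z k) := by
  rw [pderiv_prod_X, if_pos (mem_univ j), pderiv_prod_X]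
  obtain rfl | hij := eq_or_ne i j
  · simp
  · have hji : ∏ k ∈ univ.erase j, z k = z i * ∏ k ∈ (univ.erase j).erase i, z k :=
      (mul_prod_erase _ _ (by simp [hij])).symm
    have hij' : ∏ k ∈ univ.erase i, z k = z j * ∏ k ∈ (univ.erase j).erase i, z k := by
      rw [erase_right_comm]
      exact (mul_prod_erase _ _ (by simp [hij.symm])).symm
    rw [if_pos (by simp [hij]), map_prod, hji, hij', ← sub_mul, hz, ← mul_assoc, ← map_mul,
      div_mul_cancel₀ _ (sub_ne_zero.2 (hy.ne hij)), mul_comm]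
    simp only [MvPolynomial.aeval_X]

lemma secondDiff_prod_X {y : Fin m → ℝ} (hy : Function.Injective y) {z : Fin m → A}
    (hz : ∀ i j, z i - z j = algebraMap ℝ A (y j - y i)) {w : Fin m → ℝ} {e : A} {δ : Fin m → A}
    (hδ : ∀ i j, δ i * δ j = algebraMap ℝ A (w i * w j) * e ^ 2) :
    secondDiff z δ (∏ k, MvPolynomial.X k : MvPolynomial (Fin m) ℝ) =
      2 * e ^ 2 * ∑ i, algebraMap ℝ A (∑ j, w i * w j / (y i - y j)) *
        ∏ k ∈ univ.erase i, z k := by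
  have hterm : ∀ i j, MvPolynomial.aeval z (MvPolynomial.pderiv i (MvPolynomial.pderiv j
      (∏ k, MvPolynomial.X k : MvPolynomial (Fin m) ℝ))) * (δ i * δ j) =
        algebraMap ℝ A (w i * w j / (y i - y j)) * (∏ k ∈ univ.erase i, z k) * e ^ 2 +
          algebraMap ℝ A (w j * w i / (y j - y i)) * (∏ k ∈ univ.erase j, z k) * e ^ 2 := by
    intro i j
    have hswap : w j * w i / (y j - y i) = -(w i * w j / (y i - y j)) := by
      rw [← neg_sub (y i), div_neg, mul_comm]
    rw [hδ, ← mul_assoc, aeval_pderiv_pderiv_prod_X hy hz, hswap, map_neg]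
    ring
  simp only [secondDiff, hterm, sum_add_distrib]
  rw [sum_comm (f := fun i j => algebraMap ℝ A (w j * w i / (y j - y i)) *
    (∏ k ∈ univ.erase j, z k) * e ^ 2), ← two_mul, mul_assoc]
  congr 1
  simp only [map_sum, sum_mul, mul_sum]
  exact sum_congr rfl fun i _ => sum_congr rfl fun j _ => by ring

lemma prod_sub_eigenShift {y : Fin m → ℝ} (hy : Function.Injective y) {z : Fin m → A}
    (hz : ∀ i j, z i - z j = algebraMap ℝ A (y j - y i)) {e : A} (he : e ^ 3 = 0)
    (w : Fin m → ℝ) :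
    ∏ i, (z i - eigenShift y w e i) =
      ∏ i, z i - e * ∑ i, algebraMap ℝ A (w i) * ∏ k ∈ univ.erase i, z k := by
  set δ : Fin m → A := fun i => -eigenShift y w e i
  have hδδ : ∀ i j, δ i * δ j = algebraMap ℝ A (w i * w j) * e ^ 2 := fun i j => by
    rw [neg_mul_neg, eigenShift_mul he]
  have hδδδ : ∀ i j k, δ i * δ j * δ k = 0 := fun i j k => by
    rw [neg_mul_neg, mul_neg, eigenShift_mul_mul he, neg_zero]
  have hfirst : firstDiff z δ (∏ k, MvPolynomial.X k : MvPolynomial (Fin m) ℝ) =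
      -(e * ∑ i, algebraMap ℝ A (w i) * ∏ k ∈ univ.erase i, z k) - e ^ 2 *
        ∑ i, algebraMap ℝ A (∑ j, w i * w j / (y i - y j)) * ∏ k ∈ univ.erase i, z k := by
    rw [firstDiff, mul_sum, mul_sum, ← sum_neg_distrib, ← sum_sub_distrib]
    refine sum_congr rfl fun i _ => ?_
    rw [pderiv_prod_X, if_pos (mem_univ i), map_prod]
    simp only [MvPolynomial.aeval_X, δ, eigenShift]
    ring
  have htaylor := two_mul_aeval_add hδδδ z (∏ k, MvPolynomial.X k : MvPolynomial (Fin m) ℝ)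
  rw [secondDiff_prod_X hy hz hδδ, hfirst, map_prod, map_prod] at htaylor
  simp only [MvPolynomial.aeval_X, Pi.add_apply] at htaylor
  have htwo : algebraMap ℝ A (1 / 2) * 2 = 1 := by
    rw [← map_ofNat (algebraMap ℝ A) 2, ← map_mul]
    norm_num
  simp only [sub_eq_add_neg, δ] at htaylor ⊢
  linear_combination algebraMap ℝ A (1 / 2) * htaylor - (∏ i, (z i + -eigenShift y w e i) -
    ∏ i, z i + e * ∑ i, algebraMap ℝ A (w i) * ∏ k ∈ univ.erase i, z k) * htwo

end EigenShift

section RankOne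

open Polynomial

variable {m : ℕ}

lemma det_diagonal_add_vecMulVec_of_field {n K : Type*} [Fintype n] [DecidableEq n] [Field K]
    {z u w : n → K} (hz : ∀ i, z i ≠ 0) :
    (diagonal z + vecMulVec u w).det = ∏ i, z i + ∑ i, u i * w i * ∏ k ∈ univ.erase i, z k := by
  have hfactor : diagonal z + vecMulVec u w = diagonal z *
      (1 + replicateCol Unit (fun i => u i / z i) * replicateRow Unit w) := by
    rw [← vecMulVec_eq, Matrix.mul_add, Matrix.mul_one]
    ext i j
    rw [Matrix.add_apply, Matrix.add_apply, diagonal_mul, vecMulVec_apply, vecMulVec_apply,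
      ← mul_assoc, mul_div_cancel₀ _ (hz i)]
  rw [hfactor, det_mul, det_diagonal, det_one_add_replicateCol_mul_replicateRow, mul_add, mul_one,
    dotProduct, mul_sum]
  congr 1
  refine sum_congr rfl fun i _ => ?_
  rw [← mul_prod_erase univ z (mem_univ i)]
  field_simp [hz i]

lemma det_diagonal_add_vecMulVec {n D : Type*} [Fintype n] [DecidableEq n] [CommRing D]
    [IsDomain D] {z u w : n → D} (hz : ∀ i, z i ≠ 0) :
    (diagonal z + vecMulVec u w).det = ∏ i, z i + ∑ i, u i * w i * ∏ k ∈ univ.erase i, z k := by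
  set φ := algebraMap D (FractionRing D)
  have hφ : Function.Injective φ := IsFractionRing.injective D (FractionRing D)
  have hmap : (diagonal z + vecMulVec u w).map φ =
      diagonal (φ ∘ z) + vecMulVec (φ ∘ u) (φ ∘ w) := by
    rw [Matrix.map_add _ (map_add φ), diagonal_map (map_zero φ)]
    congr 1
    ext i j
    exact map_mul φ _ _
  apply hφ
  rw [RingHom.map_det, RingHom.mapMatrix_apply, hmap,
    det_diagonal_add_vecMulVec_of_field (z := φ ∘ z) fun i => (map_ne_zero_iff φ hφ).2 (hz i)]
  simp only [map_add, map_sum, map_mul, map_prod, Function.comp_apply]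

lemma exists_map_eq_aeval_roots {R A : Type*} [CommRing R] [CommRing A] [Algebra R A]
    {F : MvPolynomial (Fin m) R} (hF : F.IsSymmetric) (p : A[X]) :
    ∃ q : A, ∀ {B : Type} [CommRing B] [Algebra R B] (φ : A →ₐ[R] B) (l : Fin m → B),
      p.map (φ : A →+* B) = ∏ i, (X - C (l i)) → φ q = MvPolynomial.aeval l F := by
  obtain ⟨G, hG⟩ := MvPolynomial.esymmAlgHom_surjective (σ := Fin m) R (n := m) (by simp) ⟨F, hF⟩
  refine ⟨MvPolynomial.aeval (fun k : Fin m => (-1) ^ ((k : ℕ) + 1) * p.coeff (m - (k + 1))) G,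
    fun {B} _ _ φ l hp => ?_⟩
  have hGF : MvPolynomial.aeval (fun k : Fin m => MvPolynomial.esymm (Fin m) R (k + 1)) G = F := by
    simpa only [MvPolynomial.esymmAlgHom_apply] using congrArg Subtype.val hG
  rw [← hGF, ← AlgHom.comp_apply, ← AlgHom.comp_apply, MvPolynomial.comp_aeval,
    MvPolynomial.comp_aeval]
  congr 2
  funext k
  have hcoeff : φ (p.coeff (m - (k + 1))) =
      (-1) ^ ((k : ℕ) + 1) * (univ.val.map l).esymm (k + 1) := by
    have hvieta := Multiset.prod_X_sub_C_coeff (univ.val.map l) (k := m - (k + 1)) (by simp)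
    have hk : m - (m - ((k : ℕ) + 1)) = k + 1 := by have := k.isLt; omega
    simp only [Multiset.map_map, Multiset.card_map, card_val, card_univ, Fintype.card_fin, hk]
      at hvieta
    rw [← hvieta, ← RingHom.coe_coe φ, ← coeff_map, hp]
    rfl
  rw [map_mul, hcoeff, MvPolynomial.aeval_esymm_eq_multiset_esymm, ← mul_assoc]
  simp only [map_pow, map_neg, map_one, ← mul_pow, neg_mul_neg, one_mul, one_pow]

/-- Polynomials in one variable modulo the cube of the variable. -/
abbrev Jet : Type := ℝ[X] ⧸ Ideal.span {(X : ℝ[X]) ^ 3}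

/-- Reduction of polynomials modulo the cube of the variable. -/
def toJet : ℝ[X] →ₐ[ℝ] Jet := Ideal.Quotient.mkₐ ℝ _

lemma coeff_two_eq_of_toJet_eq {p q : ℝ[X]} (h : toJet p = toJet q) : p.coeff 2 = q.coeff 2 := by
  have hdvd : (X : ℝ[X]) ^ 3 ∣ p - q := Ideal.mem_span_singleton.1 (Ideal.Quotient.eq.1 h)
  rw [← sub_eq_zero, ← coeff_sub]
  exact X_pow_dvd_iff.1 hdvd 2 (by norm_num)

lemma toJet_X_pow_three : toJet X ^ 3 = 0 := by
  rw [← map_pow]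
  exact Ideal.Quotient.eq_zero_iff_mem.2 (Ideal.mem_span_singleton_self _)

/-- The matrix `diag(y) + ε v vᵀ` over the polynomials in `ε`. -/
def rankOneMatrix (y v : Fin m → ℝ) : Matrix (Fin m) (Fin m) ℝ[X] :=
  diagonal (fun i => C (y i)) + vecMulVec (fun i => X * C (v i)) fun i => C (v i)

lemma rankOneMatrix_map_eval (y v : Fin m → ℝ) (ε : ℝ) :
    (rankOneMatrix y v).map (eval ε) = diagonal y + ε • vecMulVec v v := by
  ext i j
  simp [rankOneMatrix, vecMulVec_apply, diagonal_apply, apply_ite (eval ε)]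
  ring

lemma charpoly_rankOneMatrix (y v : Fin m → ℝ) :
    (rankOneMatrix y v).charpoly = ∏ i, (X - C (C (y i))) -
      C X * ∑ i, C (C (v i ^ 2)) * ∏ k ∈ univ.erase i, (X - C (C (y k))) := by
  have hchar : charmatrix (rankOneMatrix y v) = diagonal (fun i => (X - C (C (y i)) : ℝ[X][X])) +
      vecMulVec (fun i => -C (X * C (v i))) fun i => C (C (v i)) := by
    ext1 i j
    simp only [charmatrix, rankOneMatrix, vecMulVec_apply, diagonal_apply, Matrix.sub_apply,
      Matrix.add_apply, Matrix.scalar_apply, RingHom.mapMatrix_apply, Matrix.map_apply, map_add,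
      apply_ite (C : ℝ[X] →+* ℝ[X][X]), map_mul, map_zero]
    split_ifs <;> ring
  rw [charpoly, hchar, det_diagonal_add_vecMulVec fun i => X_sub_C_ne_zero _, sub_eq_add_neg,
    mul_sum, ← sum_neg_distrib]
  congr 1
  refine sum_congr rfl fun i _ => ?_
  simp only [map_mul, map_pow]
  ring

lemma charpoly_rankOneMatrix_map_toJet {y : Fin m → ℝ} (hy : Function.Injective y)
    (v : Fin m → ℝ) : (rankOneMatrix y v).charpoly.map (toJet : ℝ[X] →+* Jet) =
      ∏ i, (X - C (algebraMap ℝ Jet (y i) + eigenShift y (fun i => v i ^ 2) (toJet X) i)) := by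
  have hshift := prod_sub_eigenShift hy (A := Jet[X]) (e := C (toJet X))
    (z := fun i => X - C (algebraMap ℝ Jet (y i)))
    (fun i j => by rw [Polynomial.algebraMap_apply]; simp)
    (by rw [← map_pow, toJet_X_pow_three, map_zero]) fun i => v i ^ 2
  have hC : ∀ a : ℝ, toJet (C a) = algebraMap ℝ Jet a := fun a => toJet.commutes a
  have hCshift : ∀ i, C (eigenShift y (fun i => v i ^ 2) (toJet X) i) =
      eigenShift y (fun i => v i ^ 2) (C (toJet X)) i := fun i => by
    simp only [eigenShift, map_add, map_mul, map_pow, Polynomial.algebraMap_apply]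
  simp only [map_add, hCshift, ← sub_sub, hshift, charpoly_rankOneMatrix, Polynomial.map_sub,
    Polynomial.map_mul, Polynomial.map_prod, Polynomial.map_sum, Polynomial.map_X,
    Polynomial.map_C, RingHom.coe_coe, hC, Polynomial.algebraMap_apply]

lemma aeval_algebraMap_toJet (y : Fin m → ℝ) (P : MvPolynomial (Fin m) ℝ) :
    MvPolynomial.aeval (fun i => algebraMap ℝ Jet (y i)) P = toJet (C (MvPolynomial.eval y P)) := by
  exact (MvPolynomial.aeval_algebraMap_apply Jet y P).trans (toJet.commutes _).symm

lemma two_mul_aeval_add_eigenShift (F : MvPolynomial (Fin m) ℝ) (y w : Fin m → ℝ) :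
    2 * MvPolynomial.aeval (fun i => algebraMap ℝ Jet (y i) + eigenShift y w (toJet X) i) F =
      toJet (C (2 * MvPolynomial.eval y F) +
        C (2 * ∑ i, MvPolynomial.eval y (MvPolynomial.pderiv i F) * w i) * X +
        C (2 * ∑ i, MvPolynomial.eval y (MvPolynomial.pderiv i F) *
            ∑ j, w i * w j / (y i - y j) +
          ∑ i, ∑ j, MvPolynomial.eval y (MvPolynomial.pderiv i (MvPolynomial.pderiv j F)) *
            (w i * w j)) * X ^ 2) := by
  have htaylor := two_mul_aeval_add (eigenShift_mul_mul toJet_X_pow_three y w)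
    (fun i => algebraMap ℝ Jet (y i)) F
  refine htaylor.trans ?_
  simp only [secondDiff, eigenShift_mul toJet_X_pow_three]
  simp only [firstDiff, eigenShift, aeval_algebraMap_toJet]
  have hC : ∀ a : ℝ, algebraMap ℝ Jet a = toJet (C a) := fun a => (toJet.commutes a).symm
  simp only [hC, ← map_pow, ← map_mul, ← map_add, ← map_sum, ← map_ofNat toJet 2,
    ← map_ofNat (C : ℝ →+* ℝ[X]) 2]
  congr 1
  simp only [map_add, map_mul, map_sum, mul_add, sum_add_distrib, ← mul_assoc, ← sum_mul]
  ring

/-- The second coefficient is computed from the eigenvalues modulo `ε³`. -/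
lemma exists_poly_eval_eigenvalues_rankOne {F : MvPolynomial (Fin m) ℝ} (hF : F.IsSymmetric)
    {y : Fin m → ℝ} (hy : Function.Injective y) (v : Fin m → ℝ) :
    ∃ q : ℝ[X], (∀ (ε : ℝ) (hS : (diagonal y + ε • vecMulVec v v).IsHermitian),
        q.eval ε = MvPolynomial.eval hS.eigenvalues F) ∧
      2 * q.coeff 2 = 2 * ∑ i, MvPolynomial.eval y (MvPolynomial.pderiv i F) *
          ∑ j, v i ^ 2 * v j ^ 2 / (y i - y j) +
        ∑ i, ∑ j, MvPolynomial.eval y (MvPolynomial.pderiv i (MvPolynomial.pderiv j F)) *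
          (v i ^ 2 * v j ^ 2) := by
  obtain ⟨q, hq⟩ := exists_map_eq_aeval_roots hF (rankOneMatrix y v).charpoly
  refine ⟨q, fun ε hS => ?_, ?_⟩
  · have hmap : (rankOneMatrix y v).map ((Polynomial.aeval ε : ℝ[X] →ₐ[ℝ] ℝ) : ℝ[X] →+* ℝ) =
        diagonal y + ε • vecMulVec v v := rankOneMatrix_map_eval y v ε
    have hroots := hq (Polynomial.aeval ε) hS.eigenvalues
      (by rw [← charpoly_map, hmap, hS.charpoly_eq]; rfl)
    rwa [coe_aeval_eq_eval, MvPolynomial.aeval_eq_eval] at hroots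
  · have hjet := two_mul_aeval_add_eigenShift F y fun i => v i ^ 2
    rw [← hq toJet _ (charpoly_rankOneMatrix_map_toJet hy v), ← map_ofNat toJet 2, ← map_mul]
      at hjet
    have hcoeff := coeff_two_eq_of_toJet_eq hjet
    rwa [← map_ofNat (C : ℝ →+* ℝ[X]) 2, coeff_C_mul, coeff_add, coeff_add,
      coeff_C_of_ne_zero two_ne_zero, coeff_C_mul_X, if_neg (by norm_num), coeff_C_mul_X_pow,
      if_pos rfl, zero_add, zero_add] at hcoeff

end RankOne

/-! ### The Laplace–Beltrami operator on spherical polynomials -/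

section GrowthPoly

open Polynomial

/-- `p = exp(a ε - b ε² / 2 + ⋯)` to second order in `ε`. -/
def HasLogJet (p : ℝ[X]) (a b : ℝ) : Prop :=
  p.coeff 0 = 1 ∧ p.coeff 1 = a ∧ 2 * p.coeff 2 = a ^ 2 - b

lemma hasLogJet_one : HasLogJet 1 0 0 := by
  simp [HasLogJet, coeff_one]

lemma hasLogJet_one_add_C_mul_X (c : ℝ) : HasLogJet (1 + C c * X) c (c ^ 2) := by
  simp [HasLogJet, coeff_one, coeff_X]

lemma HasLogJet.mul {p q : ℝ[X]} {a b a' b' : ℝ} (hp : HasLogJet p a b) (hq : HasLogJet q a' b') :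
    HasLogJet (p * q) (a + a') (b + b') := by
  obtain ⟨hp₀, hp₁, hp₂⟩ := hp
  obtain ⟨hq₀, hq₁, hq₂⟩ := hq
  refine ⟨by rw [mul_coeff_zero, hp₀, hq₀, one_mul], ?_, ?_⟩
  · rw [mul_coeff_one, hp₀, hp₁, hq₀, hq₁]
    ring
  · rw [coeff_mul, Nat.sum_antidiagonal_eq_sum_range_succ_mk]
    simp only [sum_range_succ, sum_range_zero, Nat.sub_zero, Nat.reduceSub, hp₀, hp₁, hq₀, hq₁]
    linear_combination hp₂ + hq₂

lemma HasLogJet.pow {p : ℝ[X]} {a b : ℝ} (hp : HasLogJet p a b) (n : ℕ) :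
    HasLogJet (p ^ n) (n * a) (n * b) := by
  induction n with
  | zero => simpa using hasLogJet_one
  | succ n ih =>
    rw [pow_succ]
    convert ih.mul hp using 1 <;> push_cast <;> ring

lemma HasLogJet.prod {ι : Type*} (s : Finset ι) {p : ι → ℝ[X]} {a b : ι → ℝ}
    (hp : ∀ i, HasLogJet (p i) (a i) (b i)) :
    HasLogJet (∏ i ∈ s, p i) (∑ i ∈ s, a i) (∑ i ∈ s, b i) := by
  classical
  induction s using Finset.induction_on with
  | empty => simpa using hasLogJet_one
  | insert i s hi ih =>
    rw [prod_insert hi, sum_insert hi, sum_insert hi]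
    exact (hp i).mul ih

variable {m : ℕ}

/-- The power function of `1 + ε u uᵀ` as a polynomial in `ε`. -/
def growthPoly (κ : Fin m → ℕ) (u : Fin m → ℝ) : ℝ[X] :=
  ∏ i, (1 + C (∑ j ∈ Iic i, u j ^ 2) * X) ^ partStep κ i

lemma eval_growthPoly (κ : Fin m → ℕ) (u : Fin m → ℝ) (ε : ℝ) :
    (growthPoly κ u).eval ε = powerFn κ (1 + vecMulVec (ε • u) u) := by
  rw [powerFn, growthPoly, eval_prod]
  refine prod_congr rfl fun i _ => ?_
  rw [leadMinor_one_add_vecMulVec, eval_pow, eval_add, eval_one, eval_mul, eval_C, eval_X, sum_mul]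
  refine congrArg (fun s => (1 + s) ^ _) (sum_congr rfl fun j _ => ?_)
  rw [Pi.smul_apply, smul_eq_mul]
  ring

lemma natDegree_growthPoly_le (κ : Fin m → ℕ) (u : Fin m → ℝ) :
    (growthPoly κ u).natDegree ≤ ∑ i, partStep κ i := by
  refine (natDegree_prod_le _ _).trans (sum_le_sum fun i _ => ?_)
  have hlinear : (1 + C (∑ j ∈ Iic i, u j ^ 2) * X).natDegree ≤ 1 := by compute_degree
  exact natDegree_pow_le.trans (mul_le_of_le_one_right' hlinear)

lemma two_mul_coeff_two_growthPoly {κ : Fin m → ℕ} (hκ : Antitone κ) (u : Fin m → ℝ) :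
    2 * (growthPoly κ u).coeff 2 = ∑ a, ∑ b, (κ a * κ b : ℝ) * (u a ^ 2 * u b ^ 2) -
      ∑ i, (partStep κ i : ℝ) * ∑ a ∈ Iic i, ∑ b ∈ Iic i, u a ^ 2 * u b ^ 2 := by
  obtain ⟨-, -, hsecond⟩ := HasLogJet.prod univ fun i =>
    (hasLogJet_one_add_C_mul_X (∑ j ∈ Iic i, u j ^ 2)).pow (partStep κ i)
  rw [growthPoly, hsecond, sum_partStep_mul_sum_Iic hκ, sq, sum_mul_sum]
  simp only [sq (∑ _ ∈ Iic _, _), sum_mul_sum, mul_mul_mul_comm]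

end GrowthPoly

section Perturbation

variable {m : ℕ}

/-- The perturbation `√Y (1 + ε h hᵀ) √Y` of the matrix `Y = diag(y)`. -/
def scaledRankOne (y h : Fin m → ℝ) (ε : ℝ) : Matrix (Fin m) (Fin m) ℝ :=
  diagonal y + ε • vecMulVec (fun i => √(y i) * h i) fun i => √(y i) * h i

lemma isHermitian_scaledRankOne (y h : Fin m → ℝ) (ε : ℝ) : (scaledRankOne y h ε).IsHermitian := by
  refine (isHermitian_diagonal y).add ?_
  ext i j
  simp only [conjTranspose_apply, Matrix.smul_apply, vecMulVec_apply, star_trivial, mul_comm]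

lemma scaledRankOne_eq {y : Fin m → ℝ} (hy : ∀ i, 0 ≤ y i) (h : Fin m → ℝ) (ε : ℝ) :
    scaledRankOne y h ε = diagonal (fun i => √(y i)) * (1 + ε • vecMulVec h h) *
      (diagonal fun i => √(y i))ᵀ := by
  ext i j
  rw [diagonal_transpose, mul_diagonal, diagonal_mul, scaledRankOne]
  obtain rfl | hij := eq_or_ne i j
  · simp only [Matrix.add_apply, diagonal_apply_eq, Matrix.smul_apply, vecMulVec_apply, smul_eq_mul,
      one_apply_eq]
    linear_combination -Real.mul_self_sqrt (hy i)
  · simp only [Matrix.add_apply, diagonal_apply_ne _ hij, Matrix.smul_apply, vecMulVec_apply,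
      smul_eq_mul, one_apply_ne hij]
    ring

lemma orthogonal_conj_one_add_smul_vecMulVec (K : orthogonalGroup (Fin m) ℝ) (h : Fin m → ℝ)
    (ε : ℝ) : K.1 * (1 + ε • vecMulVec h h) * K.1ᵀ = 1 + vecMulVec (ε • K.1 *ᵥ h) (K.1 *ᵥ h) := by
  rw [Matrix.mul_add, Matrix.add_mul, Matrix.mul_one, mul_transpose_of_orthogonal, Matrix.mul_smul,
    Matrix.smul_mul, mul_vecMulVec, vecMulVec_mul, vecMul_transpose, ← smul_vecMulVec]

/-- Write `H √Y = T K` with `T` lower triangular and `K` orthogonal. -/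
lemma exists_powerFn_conj_scaledRankOne (κ : Fin m → ℕ) {y : Fin m → ℝ} (hy : ∀ i, 0 ≤ y i)
    (H : Matrix (Fin m) (Fin m) ℝ) :
    ∃ K : orthogonalGroup (Fin m) ℝ, ∀ (h : Fin m → ℝ) (ε : ℝ),
      powerFn κ (H * scaledRankOne y h ε * Hᵀ) =
        powerFn κ (H * diagonal y * Hᵀ) * (growthPoly κ (K.1 *ᵥ h)).eval ε := by
  obtain ⟨T, hT, K, hTK⟩ := exists_lowerTriangular_mul_orthogonal (H * diagonal fun i => √(y i))
  have hconj : ∀ h ε, H * scaledRankOne y h ε * Hᵀ =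
      T * (1 + vecMulVec (ε • K.1 *ᵥ h) (K.1 *ᵥ h)) * Tᵀ := fun h ε => by
    calc H * scaledRankOne y h ε * Hᵀ = (H * diagonal fun i => √(y i)) *
          (1 + ε • vecMulVec h h) * (H * diagonal fun i => √(y i))ᵀ := by
          rw [scaledRankOne_eq hy, transpose_mul]
          simp only [Matrix.mul_assoc]
      _ = T * (K.1 * (1 + ε • vecMulVec h h) * K.1ᵀ) * Tᵀ := by
          rw [hTK, transpose_mul]
          simp only [Matrix.mul_assoc]
      _ = _ := by rw [orthogonal_conj_one_add_smul_vecMulVec]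
  have hunperturbed : H * diagonal y * Hᵀ = T * Tᵀ := by
    simpa [scaledRankOne] using hconj 0 0
  refine ⟨K, fun h ε => ?_⟩
  rw [hconj, powerFn_lowerTriangular_conj hT, hunperturbed, eval_growthPoly]

lemma exists_coeff_eq_sum_eval (N k : ℕ) : ∃ (s : Finset ℕ) (β : ℕ → ℝ),
    ∀ p : Polynomial ℝ, p.natDegree ≤ N → p.coeff k = ∑ x ∈ s, p.eval (x : ℝ) * β x := by
  refine ⟨range (N + 1), fun x => (Lagrange.basis (range (N + 1)) (fun n : ℕ => (n : ℝ)) x).coeff k,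
    fun p hp => ?_⟩
  have hdegree : p.degree < #(range (N + 1)) := by
    rw [card_range]
    exact Polynomial.degree_le_natDegree.trans_lt (by exact_mod_cast Nat.lt_succ_of_le hp)
  conv_lhs => rw [Lagrange.eq_interpolate (v := fun n : ℕ => (n : ℝ))
    Nat.cast_injective.injOn hdegree]
  simp [Lagrange.interpolate_apply, Polynomial.finsetSum_coeff]

lemma coeff_eq_integral_coeff {α : Type*} [MeasurableSpace α] {μ : Measure α} {N : ℕ}
    {p : α → Polynomial ℝ} (hdegree : ∀ x, (p x).natDegree ≤ N)
    (hint : ∀ ε, Integrable (fun x => (p x).eval ε) μ) {q : Polynomial ℝ}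
    (hq : ∀ ε, q.eval ε = ∫ x, (p x).eval ε ∂μ) (k : ℕ) :
    Integrable (fun x => (p x).coeff k) μ ∧ q.coeff k = ∫ x, (p x).coeff k ∂μ := by
  obtain ⟨s, β, hβ⟩ := exists_coeff_eq_sum_eval (max q.natDegree N) k
  have hsum : (fun x => (p x).coeff k) = fun x => ∑ n ∈ s, (p x).eval (n : ℝ) * β n :=
    funext fun x => hβ _ ((hdegree x).trans (le_max_right _ _))
  have hterm : ∀ n ∈ s, Integrable (fun x => (p x).eval (n : ℝ) * β n) μ :=
    fun n _ => (hint n).mul_const _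
  rw [hsum]
  refine ⟨integrable_finsetSum _ hterm, ?_⟩
  rw [integral_finsetSum _ hterm, hβ q (le_max_left _ _)]
  exact sum_congr rfl fun n _ => by rw [integral_mul_const, hq]

lemma continuous_orthogonal_conj (S : Matrix (Fin m) (Fin m) ℝ) :
    Continuous fun Q : orthogonalGroup (Fin m) ℝ => Q.1 * S * Q.1ᵀ :=
  (continuous_subtype_val.matrix_mul continuous_const).matrix_mul
    continuous_subtype_val.matrix_transpose

lemma integrable_powerFn_conj (κ : Fin m → ℕ) (S : Matrix (Fin m) (Fin m) ℝ) :
    Integrable (fun H : orthogonalGroup (Fin m) ℝ => powerFn κ (H.1 * S * H.1ᵀ)) (haarO m) :=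
  integrable_haarO (continuous_powerFn κ (continuous_orthogonal_conj S))

end Perturbation

section QuarticMean

variable {m : ℕ}

/-- A finite functional that integrates quartic forms like the standard normal distribution. -/
def quarticMean (Q : (Fin m → ℝ) → ℝ) : ℝ :=
  (∑ i, ∑ j, (Q (Pi.single i 1 + Pi.single j 1) + Q (Pi.single i 1 - Pi.single j 1))) / 4 -
    m * ∑ i, Q (Pi.single i 1)

lemma quarticMean_sq_mul_sq (u w : Fin m → ℝ) :
    quarticMean (fun h => (u ⬝ᵥ h) ^ 2 * (w ⬝ᵥ h) ^ 2) =
      (u ⬝ᵥ u) * (w ⬝ᵥ w) + 2 * (u ⬝ᵥ w) ^ 2 := by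
  have hpolar : ∀ i j, (u i + u j) ^ 2 * (w i + w j) ^ 2 + (u i - u j) ^ 2 * (w i - w j) ^ 2 =
      2 * (u i * w i) ^ 2 + 2 * (u j * w j) ^ 2 + 2 * ((u i * u i) * (w j * w j)) +
        2 * ((w i * w i) * (u j * u j)) + 8 * ((u i * w i) * (u j * w j)) := fun i j => by ring
  have hsq : ∀ i, u i ^ 2 * w i ^ 2 = (u i * w i) ^ 2 := fun i => (mul_pow _ _ _).symm
  simp only [quarticMean, dotProduct_add, dotProduct_sub, dotProduct_single_one, hpolar, hsq,
    sum_add_distrib, ← mul_sum, ← sum_mul, sum_const, card_univ, Fintype.card_fin, nsmul_eq_mul]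
  simp only [dotProduct]
  ring

lemma quarticMean_add (Q Q' : (Fin m → ℝ) → ℝ) :
    quarticMean (fun h => Q h + Q' h) = quarticMean Q + quarticMean Q' := by
  simp only [quarticMean, sum_add_distrib]
  ring

lemma quarticMean_const_mul (c : ℝ) (Q : (Fin m → ℝ) → ℝ) :
    quarticMean (fun h => c * Q h) = c * quarticMean Q := by
  simp only [quarticMean, ← mul_sum, ← mul_add]
  ring

lemma quarticMean_sum {ι : Type*} (s : Finset ι) (Q : ι → (Fin m → ℝ) → ℝ) :
    quarticMean (fun h => ∑ i ∈ s, Q i h) = ∑ i ∈ s, quarticMean (Q i) := by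
  classical
  induction s using Finset.induction_on with
  | empty => simp [quarticMean]
  | insert i s hi ih => simp only [sum_insert hi, quarticMean_add, ih]

lemma quarticMean_integral {α : Type*} [MeasurableSpace α] {μ : Measure α}
    {Q : (Fin m → ℝ) → α → ℝ} (hQ : ∀ h, Integrable (Q h) μ) :
    quarticMean (fun h => ∫ x, Q h x ∂μ) = ∫ x, quarticMean (fun h => Q h x) ∂μ := by
  have hpair : ∀ i j : Fin m, Integrable (fun x => Q (Pi.single i 1 + Pi.single j 1) x +
      Q (Pi.single i 1 - Pi.single j 1) x) μ := fun i j => (hQ _).add (hQ _)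
  have hpairs : ∀ i : Fin m, Integrable (fun x => ∑ j : Fin m,
      (Q (Pi.single i 1 + Pi.single j 1) x + Q (Pi.single i 1 - Pi.single j 1) x)) μ :=
    fun i => integrable_finsetSum _ fun j _ => hpair i j
  have hsingle : Integrable (fun x => ∑ i : Fin m, Q (Pi.single i 1) x) μ :=
    integrable_finsetSum _ fun i _ => hQ _
  simp only [quarticMean]
  rw [integral_sub ((integrable_finsetSum _ fun i _ => hpairs i).div_const _)
    (hsingle.const_mul _), integral_const_mul, integral_finsetSum _ (fun i _ => hQ _), integral_div,
    integral_finsetSum _ (fun i _ => hpairs i)]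
  simp only [integral_finsetSum univ (fun j _ => hpair _ j), integral_add (hQ _) (hQ _)]

lemma quarticMean_orthogonal (K : orthogonalGroup (Fin m) ℝ) (a b : Fin m) :
    quarticMean (fun h => (K.1 *ᵥ h) a ^ 2 * (K.1 *ᵥ h) b ^ 2) = 1 + if a = b then 2 else 0 := by
  have hrows : ∀ a b, K.1 a ⬝ᵥ K.1 b = if a = b then 1 else 0 := fun a b => by
    rw [← Matrix.one_apply, ← mul_transpose_of_orthogonal K]
    rfl
  refine (quarticMean_sq_mul_sq (K.1 a) (K.1 b)).trans ?_
  rw [hrows, hrows, hrows, if_pos rfl, if_pos rfl]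
  split_ifs <;> norm_num

lemma quarticMean_sum_sum_orthogonal (K : orthogonalGroup (Fin m) ℝ) (N : Fin m → Fin m → ℝ) :
    quarticMean (fun h => ∑ a, ∑ b, N a b * ((K.1 *ᵥ h) a ^ 2 * (K.1 *ᵥ h) b ^ 2)) =
      ∑ a, ∑ b, N a b + 2 * ∑ a, N a a := by
  simp only [quarticMean_sum, quarticMean_const_mul, quarticMean_orthogonal, mul_add, mul_one,
    mul_ite, mul_zero, sum_add_distrib, sum_ite_eq, mem_univ, if_true, mul_sum, mul_comm]

lemma sum_Iic_sum_Iic_one_add_ite (i : Fin m) :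
    ∑ a ∈ Iic i, ∑ b ∈ Iic i, ((1 : ℝ) + if a = b then 2 else 0) =
      ∑ j ∈ Iic i, (2 * ((j : ℕ) : ℝ) + 3) := by
  have harith : ∀ n : ℕ, ∑ j ∈ range (n + 1), (2 * (j : ℝ) + 3) = (n + 1) * (n + 1) + (n + 1) * 2 :=
    fun n => by
      induction n with
      | zero => norm_num
      | succ n ih =>
        rw [sum_range_succ, ih]
        push_cast
        ring
  rw [← sum_castLE_eq_sum_Iic i fun j => 2 * ((j : ℕ) : ℝ) + 3]
  simp only [Fin.val_castLE]
  rw [Fin.sum_univ_eq_sum_range (fun n : ℕ => 2 * (n : ℝ) + 3), harith]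
  simp only [sum_add_distrib, sum_const, Fin.card_Iic, nsmul_eq_mul, mul_one, sum_ite_eq,
    sum_ite_mem, inter_self]
  push_cast
  ring

lemma two_mul_quarticMean_coeff_two_growthPoly {κ : Fin m → ℕ} (hκ : Antitone κ)
    (K : orthogonalGroup (Fin m) ℝ) :
    2 * quarticMean (fun h => (growthPoly κ (K.1 *ᵥ h)).coeff 2) =
      (∑ i, (κ i : ℝ)) ^ 2 + 2 * ∑ i, (κ i : ℝ) ^ 2 - ∑ i, (κ i : ℝ) * (2 * (i : ℕ) + 3) := by
  have hsteps : quarticMean (fun h : Fin m → ℝ => ∑ i, (partStep κ i : ℝ) *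
      ∑ a ∈ Iic i, ∑ b ∈ Iic i, (K.1 *ᵥ h) a ^ 2 * (K.1 *ᵥ h) b ^ 2) =
        ∑ i, (κ i : ℝ) * (2 * (i : ℕ) + 3) := by
    simp only [quarticMean_const_mul, quarticMean_sum, quarticMean_orthogonal,
      sum_Iic_sum_Iic_one_add_ite, sum_partStep_mul_sum_Iic hκ]
  rw [← quarticMean_const_mul]
  simp only [two_mul_coeff_two_growthPoly hκ, sub_eq_add_neg, neg_eq_neg_one_mul (∑ _, _ * _)]
  rw [quarticMean_add, quarticMean_const_mul, hsteps, quarticMean_sum_sum_orthogonal, sq,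
    sum_mul_sum]
  simp only [← sq]

end QuarticMean

section Eigenfunction

variable {m : ℕ}

lemma sum_mul_eval_pderiv {F : MvPolynomial (Fin m) ℝ} {k : ℕ} (hF : F.IsHomogeneous k)
    (y : Fin m → ℝ) :
    ∑ i, y i * MvPolynomial.eval y (MvPolynomial.pderiv i F) = k * MvPolynomial.eval y F := by
  simpa using congrArg (MvPolynomial.eval y) hF.sum_X_mul_pderiv

lemma sum_mul_eval_pderiv_pderiv {F : MvPolynomial (Fin m) ℝ} {k : ℕ} (hF : F.IsHomogeneous k)
    (y : Fin m → ℝ) :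
    ∑ i, ∑ j, y i * y j * MvPolynomial.eval y (MvPolynomial.pderiv i (MvPolynomial.pderiv j F)) =
      ((k : ℝ) ^ 2 - k) * MvPolynomial.eval y F := by
  have hinner : ∀ j,
      ∑ i, y i * MvPolynomial.eval y (MvPolynomial.pderiv i (MvPolynomial.pderiv j F)) =
        (k - 1) * MvPolynomial.eval y (MvPolynomial.pderiv j F) := fun j => by
    have heuler := sum_mul_eval_pderiv (hF.pderiv (i := j)) y
    obtain rfl | hk := k.eq_zero_or_pos
    · rw [← MvPolynomial.totalDegree_zero_iff_isHomogeneous,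
        MvPolynomial.totalDegree_eq_zero_iff_eq_C] at hF
      rw [hF]
      simp
    · rwa [Nat.cast_pred hk] at heuler
  calc ∑ i, ∑ j, y i * y j * MvPolynomial.eval y (MvPolynomial.pderiv i (MvPolynomial.pderiv j F))
    _ = ∑ j, y j * ∑ i, y i *
          MvPolynomial.eval y (MvPolynomial.pderiv i (MvPolynomial.pderiv j F)) := by
        rw [sum_comm]
        simp only [mul_sum, mul_assoc, mul_left_comm]
    _ = (k - 1) * ∑ j, y j * MvPolynomial.eval y (MvPolynomial.pderiv j F) := by
        simp only [hinner, mul_left_comm (y _), mul_sum]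
    _ = _ := by
        rw [sum_mul_eval_pderiv hF]
        ring

/-- Twice the second order term of the symmetric polynomial `F` along `scaledRankOne y h` is
`∑ a, ∑ b, perturbationKernel F y a b * (h a ^ 2 * h b ^ 2)`. -/
def perturbationKernel (F : MvPolynomial (Fin m) ℝ) (y : Fin m → ℝ) (a b : Fin m) : ℝ :=
  2 * (y a * y b / (y a - y b)) * MvPolynomial.eval y (MvPolynomial.pderiv a F) +
    y a * y b * MvPolynomial.eval y (MvPolynomial.pderiv a (MvPolynomial.pderiv b F))

lemma exists_poly_eval_eigenvalues_scaledRankOne {F : MvPolynomial (Fin m) ℝ} (hF : F.IsSymmetric)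
    {y : Fin m → ℝ} (hy : Function.Injective y) (hpos : ∀ i, 0 ≤ y i) (h : Fin m → ℝ) :
    ∃ q : Polynomial ℝ, (∀ ε, q.eval ε =
        MvPolynomial.eval (isHermitian_scaledRankOne y h ε).eigenvalues F) ∧
      2 * q.coeff 2 = ∑ a, ∑ b, perturbationKernel F y a b * (h a ^ 2 * h b ^ 2) := by
  obtain ⟨q, hq, hcoeff⟩ := exists_poly_eval_eigenvalues_rankOne hF hy fun i => √(y i) * h i
  refine ⟨q, fun ε => hq ε (isHermitian_scaledRankOne y h ε), hcoeff.trans ?_⟩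
  simp only [mul_sum, ← sum_add_distrib, mul_pow, Real.sq_sqrt (hpos _), perturbationKernel]
  exact sum_congr rfl fun a _ => sum_congr rfl fun b _ => by ring

lemma sum_mul_div_sub {y : Fin m → ℝ} (hy : Function.Injective y) (a : Fin m) :
    ∑ b, y a * y b / (y a - y b) = ∑ b ∈ univ.erase a, y a ^ 2 / (y a - y b) - (m - 1) * y a := by
  have hterm : ∀ b ∈ univ.erase a, y a * y b / (y a - y b) = y a ^ 2 / (y a - y b) - y a :=
    fun b hb => by
      have hne : y a - y b ≠ 0 := sub_ne_zero.2 (hy.ne (ne_of_mem_erase hb).symm)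
      field_simp
      ring
  rw [← add_sum_erase _ _ (mem_univ a), sub_self, div_zero, zero_add, sum_congr rfl hterm,
    sum_sub_distrib, sum_const, card_erase_of_mem (mem_univ a), card_univ, Fintype.card_fin,
    nsmul_eq_mul, Nat.cast_pred (Nat.zero_lt_of_lt a.isLt)]

lemma sum_perturbationKernel {F : MvPolynomial (Fin m) ℝ} {k : ℕ} (hF : F.IsHomogeneous k)
    {y : Fin m → ℝ} (hy : Function.Injective y) :
    ∑ a, ∑ b, perturbationKernel F y a b + 2 * ∑ a, perturbationKernel F y a a =
      2 * laplaceBeltrami F y + (k ^ 2 - k - 2 * (m - 1) * k) * MvPolynomial.eval y F := by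
  have hdiag : ∀ a, perturbationKernel F y a a =
      y a ^ 2 * MvPolynomial.eval y (MvPolynomial.pderiv a (MvPolynomial.pderiv a F)) :=
    fun a => by simp [perturbationKernel, sq]
  have hrow : ∀ a, ∑ b, perturbationKernel F y a b =
      2 * (∑ b ∈ univ.erase a, y a ^ 2 / (y a - y b) *
        MvPolynomial.eval y (MvPolynomial.pderiv a F)) -
      2 * (m - 1) * (y a * MvPolynomial.eval y (MvPolynomial.pderiv a F)) +
      ∑ b, y a * y b * MvPolynomial.eval y (MvPolynomial.pderiv a (MvPolynomial.pderiv b F)) :=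
    fun a => by
      simp only [perturbationKernel, sum_add_distrib, ← sum_mul, ← mul_sum, sum_mul_div_sub hy]
      ring
  simp only [hdiag, hrow, sum_add_distrib, sum_sub_distrib, ← mul_sum, sum_mul_eval_pderiv hF,
    sum_mul_eval_pderiv_pderiv hF, laplaceBeltrami]
  ring

lemma two_mul_zonalEigenvalue (κ : Fin m → ℕ) :
    2 * zonalEigenvalue κ = 2 * ∑ i, (κ i : ℝ) ^ 2 -
      ∑ i, (κ i : ℝ) * (2 * (i : ℕ) + 3) + ∑ i, (κ i : ℝ) + 2 * (m - 1) * ∑ i, (κ i : ℝ) := by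
  rw [zonalEigenvalue, mul_add, mul_sum, mul_sum, ← sum_sub_distrib, ← sum_add_distrib]
  congr 1
  · exact sum_congr rfl fun i _ => by ring
  · ring

/-- Average the second order terms along `scaledRankOne y h` over `h`, once through the
eigenvalues and once through the power functions. -/
lemma laplaceBeltrami_sphericalPoly_of_nonneg {κ : Fin m → ℕ} (hκ : Antitone κ) {y : Fin m → ℝ}
    (hy : Function.Injective y) (hpos : ∀ i, 0 ≤ y i) :
    laplaceBeltrami (sphericalPoly κ) y =
      zonalEigenvalue κ * MvPolynomial.eval y (sphericalPoly κ) := by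
  choose K hK using fun H : orthogonalGroup (Fin m) ℝ =>
    exists_powerFn_conj_scaledRankOne κ hpos H.1
  choose q hq hkernel using
    exists_poly_eval_eigenvalues_scaledRankOne (isSymmetric_sphericalPoly hκ) hy hpos
  have hmean : ∀ h, Integrable (fun H : orthogonalGroup (Fin m) ℝ => powerFn κ (H.1 * diagonal y *
      H.1ᵀ) * (growthPoly κ ((K H).1 *ᵥ h)).coeff 2) (haarO m) ∧ (q h).coeff 2 =
        ∫ H : orthogonalGroup (Fin m) ℝ, powerFn κ (H.1 * diagonal y * H.1ᵀ) *
          (growthPoly κ ((K H).1 *ᵥ h)).coeff 2 ∂haarO m := fun h => by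
    have hp := coeff_eq_integral_coeff (μ := haarO m) (q := q h) (N := ∑ i, partStep κ i)
      (p := fun H : orthogonalGroup (Fin m) ℝ =>
        Polynomial.C (powerFn κ (H.1 * diagonal y * H.1ᵀ)) * growthPoly κ ((K H).1 *ᵥ h))
      (fun H => (Polynomial.natDegree_C_mul_le _ _).trans (natDegree_growthPoly_le _ _))
    simp only [Polynomial.eval_C_mul, ← hK, Polynomial.coeff_C_mul] at hp
    exact hp (fun ε => integrable_powerFn_conj κ _)
      (fun ε => by rw [hq, integral_powerFn_conj_hermitian hκ (isHermitian_scaledRankOne y h ε)]) 2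
  have heigenvalues : quarticMean (fun h => 2 * (q h).coeff 2) =
      ∑ a, ∑ b, perturbationKernel (sphericalPoly κ) y a b +
        2 * ∑ a, perturbationKernel (sphericalPoly κ) y a a := by
    simpa [hkernel] using quarticMean_sum_sum_orthogonal 1 (perturbationKernel (sphericalPoly κ) y)
  have hpower : quarticMean (fun h => 2 * (q h).coeff 2) = ((∑ i, (κ i : ℝ)) ^ 2 +
      2 * ∑ i, (κ i : ℝ) ^ 2 - ∑ i, (κ i : ℝ) * (2 * (i : ℕ) + 3)) *
        MvPolynomial.eval y (sphericalPoly κ) := by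
    rw [quarticMean_const_mul]
    simp only [(hmean _).2]
    rw [quarticMean_integral fun h => (hmean h).1, ← integral_const_mul]
    simp only [quarticMean_const_mul, mul_left_comm (2 : ℝ),
      two_mul_quarticMean_coeff_two_growthPoly hκ]
    rw [integral_mul_const, eval_sphericalPoly hκ, mul_comm]
  have hcompare := heigenvalues.symm.trans hpower
  rw [sum_perturbationKernel (isHomogeneous_sphericalPoly κ) hy] at hcompare
  push_cast at hcompare
  linear_combination hcompare / 2 -
    MvPolynomial.eval y (sphericalPoly κ) / 2 * two_mul_zonalEigenvalue κ

/-- The product of all differences of distinct variables. -/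
def diffProd (m : ℕ) : MvPolynomial (Fin m) ℝ :=
  ∏ p ∈ (univ : Finset (Fin m)).offDiag, (MvPolynomial.X p.1 - MvPolynomial.X p.2)

lemma eval_diffProd_ne_zero {y : Fin m → ℝ} :
    MvPolynomial.eval y (diffProd m) ≠ 0 ↔ Function.Injective y := by
  simp only [diffProd, map_prod, prod_ne_zero_iff, map_sub, MvPolynomial.eval_X, sub_ne_zero,
    mem_offDiag, mem_univ, true_and, Prod.forall, Function.Injective, not_imp_not, ne_eq]

lemma exists_poly_laplaceBeltrami (P : MvPolynomial (Fin m) ℝ) : ∃ Q : MvPolynomial (Fin m) ℝ,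
    ∀ y, Function.Injective y →
      MvPolynomial.eval y Q = MvPolynomial.eval y (diffProd m) * laplaceBeltrami P y := by
  refine ⟨diffProd m * ∑ i, MvPolynomial.X i ^ 2 * MvPolynomial.pderiv i (MvPolynomial.pderiv i P) +
    ∑ i, ∑ j ∈ univ.erase i, MvPolynomial.X i ^ 2 *
      (∏ p ∈ (univ : Finset (Fin m)).offDiag.erase (i, j),
        (MvPolynomial.X p.1 - MvPolynomial.X p.2)) * MvPolynomial.pderiv i P, fun y hy => ?_⟩
  simp only [laplaceBeltrami, mul_add, map_add, map_mul, map_sum, map_pow, MvPolynomial.eval_X,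
    add_right_inj, mul_sum]
  refine sum_congr rfl fun i _ => sum_congr rfl fun j hj => ?_
  have hij : i ≠ j := (ne_of_mem_erase hj).symm
  have hne : y i - y j ≠ 0 := sub_ne_zero.2 (hy.ne hij)
  rw [diffProd, ← mul_prod_erase _ _ (show (i, j) ∈ univ.offDiag by simp [hij])]
  simp only [map_mul, map_sub, MvPolynomial.eval_X]
  field_simp

lemma laplaceBeltrami_sphericalPoly {κ : Fin m → ℕ} (hκ : Antitone κ) {y : Fin m → ℝ}
    (hy : Function.Injective y) : laplaceBeltrami (sphericalPoly κ) y =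
      zonalEigenvalue κ * MvPolynomial.eval y (sphericalPoly κ) := by
  obtain ⟨Q, hQ⟩ := exists_poly_laplaceBeltrami (sphericalPoly κ)
  have hcleared : diffProd m * Q = diffProd m *
      (diffProd m * (MvPolynomial.C (zonalEigenvalue κ) * sphericalPoly κ)) := by
    refine MvPolynomial.funext_set (fun _ => Set.Ici (0 : ℝ)) (fun _ => Set.Ici_infinite 0)
      fun x hx => ?_
    rw [map_mul, map_mul (MvPolynomial.eval x)]
    by_cases hx₀ : MvPolynomial.eval x (diffProd m) = 0
    · rw [hx₀, zero_mul, zero_mul]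
    · have hinj := eval_diffProd_ne_zero.1 hx₀
      rw [hQ x hinj, laplaceBeltrami_sphericalPoly_of_nonneg hκ hinj fun i => hx i (Set.mem_univ i),
        map_mul, map_mul, MvPolynomial.eval_C]
  have hy₀ := eval_diffProd_ne_zero.2 hy
  have heval := congrArg (MvPolynomial.eval y) hcleared
  simp only [map_mul, hQ y hy, MvPolynomial.eval_C] at heval
  exact mul_left_cancel₀ hy₀ (mul_left_cancel₀ hy₀ heval)

end Eigenfunction

/-! ### Zonal families -/

section Spanning

variable {m t : ℕ}

lemma mem_partitions {κ : Fin m → ℕ} : κ ∈ partitions m t ↔ ∑ i, κ i = t ∧ Antitone κ := by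
  simp [partitions]

lemma Dominated.eq_of_sum_le {μ ν : Fin m → ℕ} (h : Dominated μ ν)
    (hle : ∑ r, ∑ i ∈ Iic r, ν i ≤ ∑ r, ∑ i ∈ Iic r, μ i) : μ = ν :=
  have hsum := le_antisymm (sum_le_sum fun r _ => h r) hle
  h.antisymm fun r => ((sum_eq_sum_iff_of_le fun r _ => h r).1 hsum r (mem_univ r)).ge

/-- A dominance-maximal index with nonzero coefficient contributes a monomial that no other
summand contains. -/
lemma exists_coeff_sum_sphericalPoly_ne_zero {S : Finset (Fin m → ℕ)}
    (hanti : ∀ κ ∈ S, Antitone κ) {c : (Fin m → ℕ) → ℝ} (hc : ∃ κ ∈ S, c κ ≠ 0) :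
    ∃ μ ∈ S, c μ ≠ 0 ∧
      (∑ ν ∈ S, c ν • sphericalPoly ν).coeff (Finsupp.equivFunOnFinite.symm μ) ≠ 0 := by
  obtain ⟨κ, hκ, hκc⟩ := hc
  obtain ⟨μ, hμ, hmax⟩ := exists_max_image (S.filter fun ν => c ν ≠ 0)
    (fun ν => ∑ r, ∑ i ∈ Iic r, ν i) ⟨κ, mem_filter.2 ⟨hκ, hκc⟩⟩
  obtain ⟨hμS, hμc⟩ := mem_filter.1 hμ
  refine ⟨μ, hμS, hμc, ?_⟩
  rw [MvPolynomial.coeff_sum, sum_eq_single_of_mem μ hμS, MvPolynomial.coeff_smul, smul_eq_mul]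
  · exact mul_ne_zero hμc (coeff_sphericalPoly_self_pos (hanti μ hμS)).ne'
  · intro ν hν hne
    rw [MvPolynomial.coeff_smul, smul_eq_mul]
    by_contra hprod
    have hdom : Dominated μ ν :=
      domBounded_sphericalPoly (hanti ν hν) _ (right_ne_zero_of_mul hprod)
    exact hne (hdom.eq_of_sum_le
      (hmax ν (mem_filter.2 ⟨hν, left_ne_zero_of_mul hprod⟩))).symm

lemma eq_zero_of_coeff_sum_sphericalPoly_eq_zero {c : (Fin m → ℕ) → ℝ}
    (h : ∀ μ ∈ partitions m t, (∑ ν ∈ partitions m t, c ν • sphericalPoly ν).coeff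
      (Finsupp.equivFunOnFinite.symm μ) = 0) : ∀ κ ∈ partitions m t, c κ = 0 := by
  by_contra! hne
  obtain ⟨μ, hμ, -, hcoeff⟩ :=
    exists_coeff_sum_sphericalPoly_ne_zero (fun κ hκ => (mem_partitions.1 hκ).2) hne
  exact hcoeff (h μ hμ)

lemma exists_coeff_sum_sphericalPoly_eq (g : (Fin m → ℕ) → ℝ) : ∃ c : (Fin m → ℕ) → ℝ,
    ∀ μ ∈ partitions m t, (∑ ν ∈ partitions m t, c ν • sphericalPoly ν).coeff
      (Finsupp.equivFunOnFinite.symm μ) = g μ := by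
  classical
  let M : Matrix (partitions m t) (partitions m t) ℝ := fun μ ν =>
    (sphericalPoly ν.1).coeff (Finsupp.equivFunOnFinite.symm μ.1)
  have hM : ∀ (c : (Fin m → ℕ) → ℝ) (μ : partitions m t),
      (∑ ν ∈ partitions m t, c ν • sphericalPoly ν).coeff (Finsupp.equivFunOnFinite.symm μ.1) =
        (M *ᵥ fun ν => c ν) μ := fun c μ => by
    rw [MvPolynomial.coeff_sum, ← sum_coe_sort]
    exact sum_congr rfl fun ν _ => by rw [MvPolynomial.coeff_smul, smul_eq_mul, mul_comm]
  have hextend : ∀ b : partitions m t → ℝ, ∃ c : (Fin m → ℕ) → ℝ,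
      (fun ν : partitions m t => c ν) = b := fun b =>
    ⟨Function.extend Subtype.val b 0, funext fun ν => Subtype.val_injective.extend_apply b 0 ν⟩
  have hinj : Function.Injective M.mulVecLin := by
    refine (injective_iff_map_eq_zero _).2 fun b hb => ?_
    obtain ⟨c, rfl⟩ := hextend b
    exact funext fun ν => eq_zero_of_coeff_sum_sphericalPoly_eq_zero
      (fun μ hμ => (hM c ⟨μ, hμ⟩).trans (congrFun hb ⟨μ, hμ⟩)) ν.1 ν.2
  obtain ⟨b, hb⟩ := LinearMap.injective_iff_surjective.1 hinj fun μ => g μ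
  obtain ⟨c, rfl⟩ := hextend b
  exact ⟨c, fun μ hμ => (hM c ⟨μ, hμ⟩).trans (congrFun hb ⟨μ, hμ⟩)⟩

lemma exists_perm_antitone (s : Fin m → ℕ) : ∃ σ : Equiv.Perm (Fin m), Antitone (s ∘ σ) :=
  ⟨Fin.revPerm.trans (Tuple.sort s), fun _ _ hij =>
    Tuple.monotone_sort s (Fin.rev_le_rev.2 hij)⟩

lemma eq_zero_of_coeff_partitions {f : MvPolynomial (Fin m) ℝ} (hsymm : f.IsSymmetric)
    (hhom : f.IsHomogeneous t)
    (h : ∀ μ ∈ partitions m t, f.coeff (Finsupp.equivFunOnFinite.symm μ) = 0) : f = 0 := by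
  ext s
  rw [MvPolynomial.coeff_zero]
  by_contra hne
  have hdegree : s.degree = t := not_imp_comm.1 hhom.coeff_eq_zero hne
  obtain ⟨σ, hσ⟩ := exists_perm_antitone s
  have hperm : f.coeff (s.mapDomain σ.symm) = f.coeff s := by
    conv_lhs => rw [← hsymm σ.symm]
    exact MvPolynomial.coeff_rename_mapDomain _ σ.symm.injective _ _
  have hsort : s.mapDomain σ.symm = Finsupp.equivFunOnFinite.symm (s ∘ σ) := by
    ext i
    simp
  rw [hsort, h _ (mem_partitions.2 ⟨?_, hσ⟩)] at hperm
  · exact hne hperm.symm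
  · rw [← hdegree, Finsupp.degree_eq_sum]
    exact Equiv.sum_comp σ s

lemma isHomogeneous_smul_sphericalPoly {κ : Fin m → ℕ} (hκ : κ ∈ partitions m t) (c : ℝ) :
    (c • sphericalPoly κ).IsHomogeneous t :=
  (MvPolynomial.homogeneousSubmodule _ _ _).smul_mem c
    ((mem_partitions.1 hκ).1 ▸ isHomogeneous_sphericalPoly κ)

lemma isSymmetric_smul_sphericalPoly {κ : Fin m → ℕ} (hκ : κ ∈ partitions m t) (c : ℝ) :
    (c • sphericalPoly κ).IsSymmetric :=
  (MvPolynomial.symmetricSubalgebra (Fin m) ℝ).smul_mem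
    (isSymmetric_sphericalPoly (mem_partitions.1 hκ).2) c

lemma exists_eq_sum_sphericalPoly {f : MvPolynomial (Fin m) ℝ} (hsymm : f.IsSymmetric)
    (hhom : f.IsHomogeneous t) :
    ∃ c : (Fin m → ℕ) → ℝ, f = ∑ κ ∈ partitions m t, c κ • sphericalPoly κ := by
  obtain ⟨c, hc⟩ := exists_coeff_sum_sphericalPoly_eq (t := t)
    fun μ => f.coeff (Finsupp.equivFunOnFinite.symm μ)
  refine ⟨c, sub_eq_zero.1 (eq_zero_of_coeff_partitions (t := t) ?_ ?_ fun μ hμ => ?_)⟩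
  · exact (MvPolynomial.symmetricSubalgebra (Fin m) ℝ).sub_mem hsymm
      (sum_mem fun κ hκ => isSymmetric_smul_sphericalPoly hκ _)
  · exact hhom.sub (.sum _ _ _ fun κ hκ => isHomogeneous_smul_sphericalPoly hκ _)
  · rw [MvPolynomial.coeff_sub, hc μ hμ, sub_self]

end Spanning

section Eigenvalues

variable {m t : ℕ}

lemma sum_mul_nonneg_of_antitone {κ : Fin m → ℕ} (hκ : Antitone κ) {x : Fin m → ℝ}
    (hx : ∀ r, 0 ≤ ∑ i ∈ Iic r, x i) : 0 ≤ ∑ i, (κ i : ℝ) * x i := by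
  rw [← sum_partStep_mul_sum_Iic hκ x]
  exact sum_nonneg fun i _ => mul_nonneg (Nat.cast_nonneg _) (hx i)

lemma sum_sub_mul_eq_sum_sum_Iic (x : Fin m → ℝ) :
    ∑ i : Fin m, ((m : ℝ) - (i : ℕ)) * x i = ∑ i, ∑ j ∈ Iic i, x j := by
  have hanti : Antitone fun i : Fin m => m - (i : ℕ) :=
    fun i j hij => Nat.sub_le_sub_left (Fin.le_def.1 hij) m
  have hstep : ∀ i : Fin m, partStep (fun i : Fin m => m - (i : ℕ)) i = 1 := fun i => by
    have := i.isLt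
    simp only [partStep, extendZero]
    split_ifs <;> omega
  have hsum := sum_partStep_mul_sum_Iic hanti x
  simp only [hstep, Nat.cast_one, one_mul] at hsum
  rw [hsum]
  exact sum_congr rfl fun i _ => by rw [Nat.cast_sub i.isLt.le]

lemma zonalEigenvalue_sub_zonalEigenvalue {μ κ : Fin m → ℕ} (h : ∑ i, κ i = ∑ i, μ i) :
    zonalEigenvalue κ - zonalEigenvalue μ =
      ∑ i, ((κ i + μ i : ℕ) : ℝ) * ((κ i : ℝ) - μ i) +
        ∑ i, ∑ j ∈ Iic i, ((κ j : ℝ) - μ j) := by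
  have hsum : ∑ i, (κ i : ℝ) = ∑ i, (μ i : ℝ) := mod_cast h
  have hzero : (m + 1) * ∑ i, ((κ i : ℝ) - μ i) = 0 := by
    rw [sum_sub_distrib, hsum, sub_self, mul_zero]
  rw [zonalEigenvalue, zonalEigenvalue, hsum, add_sub_add_right_eq_sub, ← sum_sub_distrib,
    ← sum_sub_mul_eq_sum_sum_Iic, ← sum_add_distrib, ← add_zero (∑ _, (_ - _)), ← hzero, mul_sum,
    ← sum_add_distrib]
  refine sum_congr rfl fun i _ => ?_
  push_cast
  ring

lemma Dominated.eq_of_zonalEigenvalue_eq {μ κ : Fin m → ℕ} (hdom : Dominated μ κ)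
    (hμ : μ ∈ partitions m t) (hκ : κ ∈ partitions m t)
    (heigen : zonalEigenvalue μ = zonalEigenvalue κ) : μ = κ := by
  rw [mem_partitions] at hμ hκ
  have hpartial : ∀ r, 0 ≤ ∑ i ∈ Iic r, ((κ i : ℝ) - μ i) := fun r => by
    rw [sum_sub_distrib, sub_nonneg]
    exact_mod_cast hdom r
  have hdiff := zonalEigenvalue_sub_zonalEigenvalue (hκ.1.trans hμ.1.symm)
  have hfirst := sum_mul_nonneg_of_antitone (κ := fun i => κ i + μ i) (hκ.2.add hμ.2) hpartial
  have hsecond : ∑ r, ∑ i ∈ Iic r, ((κ i : ℝ) - μ i) = 0 :=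
    le_antisymm (by linarith) (sum_nonneg fun r _ => hpartial r)
  refine hdom.antisymm fun r => ?_
  have hr := (sum_eq_zero_iff_of_nonneg fun r _ => hpartial r).1 hsecond r (mem_univ r)
  rw [sum_sub_distrib, sub_eq_zero] at hr
  exact_mod_cast hr.le

lemma laplaceBeltrami_smul (c : ℝ) (P : MvPolynomial (Fin m) ℝ) (y : Fin m → ℝ) :
    laplaceBeltrami (c • P) y = c * laplaceBeltrami P y := by
  simp only [laplaceBeltrami, Derivation.map_smul, MvPolynomial.smul_eval, mul_add, mul_sum,
    mul_left_comm c]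

lemma laplaceBeltrami_add (P Q : MvPolynomial (Fin m) ℝ) (y : Fin m → ℝ) :
    laplaceBeltrami (P + Q) y = laplaceBeltrami P y + laplaceBeltrami Q y := by
  simp only [laplaceBeltrami, map_add, mul_add, sum_add_distrib]
  ring

lemma laplaceBeltrami_sum {ι : Type*} (s : Finset ι) (P : ι → MvPolynomial (Fin m) ℝ)
    (y : Fin m → ℝ) : laplaceBeltrami (∑ i ∈ s, P i) y = ∑ i ∈ s, laplaceBeltrami (P i) y := by
  classical
  induction s using Finset.induction_on with
  | empty => simp [laplaceBeltrami]
  | insert i s hi ih => rw [sum_insert hi, sum_insert hi, laplaceBeltrami_add, ih]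

lemma laplaceBeltrami_smul_sphericalPoly {κ : Fin m → ℕ} (hκ : κ ∈ partitions m t) (c : ℝ)
    {y : Fin m → ℝ} (hy : Function.Injective y) : laplaceBeltrami (c • sphericalPoly κ) y =
      zonalEigenvalue κ * MvPolynomial.eval y (c • sphericalPoly κ) := by
  rw [laplaceBeltrami_smul, laplaceBeltrami_sphericalPoly (mem_partitions.1 hκ).2 hy,
    MvPolynomial.smul_eval, mul_left_comm]

lemma eq_zero_of_eval_eq_zero_of_injective {P : MvPolynomial (Fin m) ℝ}
    (h : ∀ y, Function.Injective y → MvPolynomial.eval y P = 0) : P = 0 := by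
  have hprod : diffProd m * P = 0 := MvPolynomial.funext fun y => by
    rw [map_mul, map_zero, mul_eq_zero, or_iff_not_imp_left]
    exact fun hy => h y (eval_diffProd_ne_zero.1 hy)
  have hinj : Function.Injective fun i : Fin m => ((i : ℕ) : ℝ) :=
    Nat.cast_injective.comp Fin.val_injective
  refine (mul_eq_zero.1 hprod).resolve_left fun hzero => eval_diffProd_ne_zero.2 hinj ?_
  rw [hzero, map_zero]

end Eigenvalues

section ZonalFamily

variable {m t : ℕ} {C : (Fin m → ℕ) → MvPolynomial (Fin m) ℝ} {κ : Fin m → ℕ}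

namespace IsZonalFamily

lemma zonalEigenvalue_eq (hC : IsZonalFamily m t C) (hκ : κ ∈ partitions m t)
    {c : (Fin m → ℕ) → ℝ} (hc : C κ = ∑ μ ∈ partitions m t, c μ • sphericalPoly μ) :
    ∀ μ ∈ partitions m t, c μ ≠ 0 → zonalEigenvalue μ = zonalEigenvalue κ := by
  have hzero : ∑ μ ∈ partitions m t, (c μ * (zonalEigenvalue μ - zonalEigenvalue κ)) •
      sphericalPoly μ = 0 := by
    refine eq_zero_of_eval_eq_zero_of_injective fun y hy => ?_
    have heigen := sub_eq_zero.2 (hC.eigenfunction κ hκ y hy)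
    rw [hc, laplaceBeltrami_sum, map_sum, mul_sum, ← sum_sub_distrib] at heigen
    rw [map_sum, ← heigen]
    refine sum_congr rfl fun μ hμ => ?_
    rw [laplaceBeltrami_smul_sphericalPoly hμ _ hy, MvPolynomial.smul_eval, MvPolynomial.smul_eval]
    ring
  intro μ hμ hne
  have hprod := eq_zero_of_coeff_sum_sphericalPoly_eq_zero (t := t)
    (c := fun μ => c μ * (zonalEigenvalue μ - zonalEigenvalue κ))
    (fun _ _ => by rw [hzero, MvPolynomial.coeff_zero]) μ hμ
  exact sub_eq_zero.1 ((mul_eq_zero.1 hprod).resolve_left hne)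

lemma exists_eq_smul_sphericalPoly (hC : IsZonalFamily m t C) (hκ : κ ∈ partitions m t) :
    ∃ s : ℝ, C κ = s • sphericalPoly κ := by
  classical
  obtain ⟨c, hc⟩ := exists_eq_sum_sphericalPoly (hC.symmetric κ hκ) (hC.homogeneous κ hκ)
  have hsplit : C κ = c κ • sphericalPoly κ +
      ∑ μ ∈ (partitions m t).erase κ, c μ • sphericalPoly μ := by
    rw [hc, add_sum_erase _ (fun μ => c μ • sphericalPoly μ) hκ]
  suffices hrest : ∀ μ ∈ (partitions m t).erase κ, c μ = 0 from
    ⟨c κ, by rw [hsplit, sum_eq_zero fun μ hμ => by rw [hrest μ hμ, zero_smul], add_zero]⟩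
  by_contra! hne
  obtain ⟨μ, hμ, hμc, hcoeff⟩ := exists_coeff_sum_sphericalPoly_ne_zero
    (fun ν hν => (mem_partitions.1 (mem_of_mem_erase hν)).2) hne
  obtain ⟨hμκ, hμt⟩ := mem_erase.1 hμ
  have hnot : ¬ Dominated μ κ := fun hdom =>
    hμκ (hdom.eq_of_zonalEigenvalue_eq hμt hκ (hC.zonalEigenvalue_eq hκ hc μ hμt hμc))
  have hCκ : (C κ).coeff (Finsupp.equivFunOnFinite.symm μ) = 0 :=
    not_imp_comm.1 (hC.triangular κ hκ μ hμt) hnot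
  have hspherical : (sphericalPoly κ).coeff (Finsupp.equivFunOnFinite.symm μ) = 0 :=
    not_imp_comm.1 (domBounded_sphericalPoly (mem_partitions.1 hκ).2 _) hnot
  rw [hsplit, MvPolynomial.coeff_add, MvPolynomial.coeff_smul, hspherical, smul_zero,
    zero_add] at hCκ
  exact hcoeff hCκ

end IsZonalFamily

lemma isSymmetric_sum_X_pow (t : ℕ) :
    ((∑ i, MvPolynomial.X i : MvPolynomial (Fin m) ℝ) ^ t).IsSymmetric := fun σ => by
  simp only [map_pow, map_sum, MvPolynomial.rename_X]
  rw [Equiv.sum_comp σ (fun i => (MvPolynomial.X i : MvPolynomial (Fin m) ℝ))]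

lemma isHomogeneous_sum_X_pow (t : ℕ) :
    ((∑ i, MvPolynomial.X i : MvPolynomial (Fin m) ℝ) ^ t).IsHomogeneous t := by
  simpa using (MvPolynomial.IsHomogeneous.sum univ (fun i => (MvPolynomial.X i :
    MvPolynomial (Fin m) ℝ)) 1 fun i _ => MvPolynomial.isHomogeneous_X _ _).pow t

lemma exists_isZonalFamily (m t : ℕ) : ∃ C, IsZonalFamily m t C := by
  obtain ⟨s, hs⟩ := exists_eq_sum_sphericalPoly (m := m) (isSymmetric_sum_X_pow t)
    (isHomogeneous_sum_X_pow t)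
  refine ⟨fun κ => s κ • sphericalPoly κ, fun κ hκ => isSymmetric_smul_sphericalPoly hκ _,
    fun κ hκ => isHomogeneous_smul_sphericalPoly hκ _, fun κ hκ μ _ hne => ?_,
    fun κ hκ y hy => laplaceBeltrami_smul_sphericalPoly hκ _ hy, hs.symm⟩
  rw [MvPolynomial.coeff_smul, smul_eq_mul] at hne
  exact domBounded_sphericalPoly (mem_partitions.1 hκ).2 _ (right_ne_zero_of_mul hne)

lemma exists_zonalPoly_eq_smul (m : ℕ) : ∃ s : (Fin m → ℕ) → ℝ,
    (∀ κ, Antitone κ → zonalPoly κ = s κ • sphericalPoly κ) ∧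
    ∀ t, ∑ κ ∈ partitions m t, s κ • sphericalPoly κ = (∑ i, MvPolynomial.X i) ^ t := by
  have hfamily : ∀ t, IsZonalFamily m t (Classical.epsilon (IsZonalFamily m t)) := fun t =>
    Classical.epsilon_spec (exists_isZonalFamily m t)
  have hmultiple : ∀ κ : Fin m → ℕ, ∃ s : ℝ, Antitone κ → zonalPoly κ = s • sphericalPoly κ :=
    fun κ => by
      by_cases hκ : Antitone κ
      · obtain ⟨s, hs⟩ :=
          (hfamily (∑ i, κ i)).exists_eq_smul_sphericalPoly (mem_partitions.2 ⟨rfl, hκ⟩)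
        exact ⟨s, fun _ => hs⟩
      · exact ⟨0, fun h => absurd h hκ⟩
  choose s hs using hmultiple
  refine ⟨s, hs, fun t => ?_⟩
  rw [← (hfamily t).sum_eq]
  refine sum_congr rfl fun κ hκ => ?_
  obtain ⟨hsum, hanti⟩ := mem_partitions.1 hκ
  rw [← hs κ hanti, zonalPoly, hsum]

end ZonalFamily

/-! ### Spherical functions and means of powers of traces -/

section SphericalFn

variable {m n t : ℕ}

/-- The spherical function: the mean of the power function over the orthogonal orbit of `S`. -/
def sphericalFn (κ : Fin m → ℕ) (S : Matrix (Fin m) (Fin m) ℝ) : ℝ :=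
  ∫ H : orthogonalGroup (Fin m) ℝ, powerFn κ (H.1 * S * H.1ᵀ) ∂haarO m

lemma isHermitian_conj {S : Matrix (Fin n) (Fin n) ℝ} (hS : S.IsHermitian)
    (g : Matrix (Fin m) (Fin n) ℝ) : (g * S * gᵀ).IsHermitian := by
  simpa only [conjTranspose_eq_transpose_of_trivial] using isHermitian_mul_mul_conjTranspose g hS

lemma sum_mul_sphericalFn {s : (Fin m → ℕ) → ℝ}
    (hs : ∑ κ ∈ partitions m t, s κ • sphericalPoly κ = (∑ i, MvPolynomial.X i) ^ t)
    {S : Matrix (Fin m) (Fin m) ℝ} (hS : S.IsHermitian) :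
    ∑ κ ∈ partitions m t, s κ * sphericalFn κ S = S.trace ^ t := by
  have heval := congrArg (MvPolynomial.eval hS.eigenvalues) hs
  simp only [map_sum, map_pow, MvPolynomial.smul_eval, MvPolynomial.eval_X] at heval
  rw [hS.trace_eq_sum_eigenvalues]
  refine Eq.trans (sum_congr rfl fun κ hκ => ?_) heval
  rw [sphericalFn, integral_powerFn_conj_hermitian (mem_partitions.1 hκ).2 hS]

lemma integral_sphericalFn_conj (h : m ≤ n) (κ : Fin m → ℕ) (g : Matrix (Fin m) (Fin n) ℝ)
    (Λ : Matrix (Fin n) (Fin n) ℝ) :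
    ∫ Q : orthogonalGroup (Fin n) ℝ, sphericalFn κ (g * (Q.1 * Λ * Q.1ᵀ) * gᵀ) ∂haarO n =
      sphericalFn κ (g * gᵀ) * orbitMean h κ Λ := by
  simp only [sphericalFn]
  rw [integral_integral_swap_of_hasCompactSupport, ← integral_mul_const]
  · refine integral_congr_ae (.of_forall fun H => ?_)
    simpa only [transpose_mul, Matrix.mul_assoc] using integral_powerFn_conj h κ (H.1 * g) Λ
  · have hH : Continuous fun p : orthogonalGroup (Fin n) ℝ × orthogonalGroup (Fin m) ℝ => p.2.1 :=
      continuous_subtype_val.comp continuous_snd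
    exact continuous_powerFn κ ((hH.matrix_mul ((continuous_const.matrix_mul
      ((continuous_orthogonal_conj Λ).comp continuous_fst)).matrix_mul
        continuous_const)).matrix_mul hH.matrix_transpose)
  · exact HasCompactSupport.of_compactSpace _

instance : SecondCountableTopology (Matrix (Fin n) (Fin n) ℝ) :=
  inferInstanceAs (SecondCountableTopology (Fin n → Fin n → ℝ))

instance : SecondCountableTopology (orthogonalGroup (Fin n) ℝ) :=
  inferInstanceAs
    (SecondCountableTopology (orthogonalGroup (Fin n) ℝ : Set (Matrix (Fin n) (Fin n) ℝ)))

lemma continuous_sphericalFn {α : Type*} [TopologicalSpace α] [FirstCountableTopology α]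
    [LocallyCompactSpace α] (κ : Fin m → ℕ) {S : α → Matrix (Fin m) (Fin m) ℝ}
    (hS : Continuous S) : Continuous fun x => sphericalFn κ (S x) := by
  have hH : Continuous fun p : α × orthogonalGroup (Fin m) ℝ => p.2.1 :=
    continuous_subtype_val.comp continuous_snd
  have hpower : Continuous fun p : α × orthogonalGroup (Fin m) ℝ =>
      powerFn κ (p.2.1 * S p.1 * p.2.1ᵀ) :=
    continuous_powerFn κ ((hH.matrix_mul (hS.comp continuous_fst)).matrix_mul hH.matrix_transpose)
  simpa only [sphericalFn, Measure.restrict_univ] using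
    continuous_parametric_integral_of_continuous (μ := haarO m) hpower isCompact_univ

lemma integral_trace_conj_pow {s : (Fin m → ℕ) → ℝ}
    (hs : ∑ κ ∈ partitions m t, s κ • sphericalPoly κ = (∑ i, MvPolynomial.X i) ^ t)
    (h : m ≤ n) (g : Matrix (Fin m) (Fin n) ℝ) {Λ : Matrix (Fin n) (Fin n) ℝ}
    (hΛ : Λ.IsHermitian) :
    ∫ Q : orthogonalGroup (Fin n) ℝ, (g * (Q.1 * Λ * Q.1ᵀ) * gᵀ).trace ^ t ∂haarO n =
      ∑ κ ∈ partitions m t, s κ * (sphericalFn κ (g * gᵀ) * orbitMean h κ Λ) := by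
  simp_rw [fun Q : orthogonalGroup (Fin n) ℝ =>
    (sum_mul_sphericalFn hs (isHermitian_conj (isHermitian_conj hΛ Q.1) g)).symm]
  rw [integral_finsetSum]
  · simp only [integral_const_mul, integral_sphericalFn_conj h]
  · exact fun κ _ => (integrable_haarO (continuous_sphericalFn κ ((continuous_const.matrix_mul
      (continuous_orthogonal_conj Λ)).matrix_mul continuous_const))).const_mul _

end SphericalFn

section Positivity

variable {m t : ℕ}

lemma trace_mul_transpose_pow {ι R : Type*} [Fintype ι] [CommSemiring R] (A B : Matrix ι ι R)
    (t : ℕ) : (A * Bᵀ).trace ^ t = ∑ I : Fin t → ι × ι,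
      (∏ k, A (I k).1 (I k).2) * ∏ k, B (I k).1 (I k).2 := by
  rw [← sum_hadamard_eq, ← Fintype.sum_prod_type' (A ⊙ B), Fintype.sum_pow]
  simp only [hadamard_apply, prod_mul_distrib]

/-- The mean over the orthogonal orbit of `A` of the product of the entries indexed by `I`. -/
def entryMoment (I : Fin t → Fin m × Fin m) (A : Matrix (Fin m) (Fin m) ℝ) : ℝ :=
  ∫ Q : orthogonalGroup (Fin m) ℝ, ∏ k, (Q.1 * A * Q.1ᵀ) (I k).1 (I k).2 ∂haarO m

lemma integrable_prod_orthogonal_conj (I : Fin t → Fin m × Fin m) (A : Matrix (Fin m) (Fin m) ℝ) :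
    Integrable (fun Q : orthogonalGroup (Fin m) ℝ => ∏ k, (Q.1 * A * Q.1ᵀ) (I k).1 (I k).2)
      (haarO m) :=
  integrable_haarO (continuous_finsetProd _ fun _ _ =>
    (continuous_orthogonal_conj A).matrix_elem _ _)

lemma integral_trace_orthogonal_conj_mul (f : ℝ → ℝ) (P : orthogonalGroup (Fin m) ℝ)
    (A B : Matrix (Fin m) (Fin m) ℝ) :
    ∫ Q : orthogonalGroup (Fin m) ℝ, f ((P.1 * A * P.1ᵀ) * (Q.1 * B * Q.1ᵀ)).trace ∂haarO m =
      ∫ Q : orthogonalGroup (Fin m) ℝ, f (A * (Q.1 * B * Q.1ᵀ)).trace ∂haarO m := by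
  rw [← integral_mul_left_eq_self (μ := haarO m) (fun Q : orthogonalGroup (Fin m) ℝ =>
    f ((P.1 * A * P.1ᵀ) * (Q.1 * B * Q.1ᵀ)).trace) P]
  have hcancel : ∀ Z : Matrix (Fin m) (Fin m) ℝ, P.1ᵀ * (P.1 * Z) = Z := fun Z => by
    rw [← Matrix.mul_assoc, transpose_mul_of_orthogonal, Matrix.one_mul]
  refine integral_congr_ae (.of_forall fun Q => congrArg f ?_)
  simp only [Submonoid.coe_mul, transpose_mul, Matrix.mul_assoc, hcancel]
  rw [trace_mul_comm P.1]
  simp only [Matrix.mul_assoc, transpose_mul_of_orthogonal, Matrix.mul_one]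

/-- By invariance one may average over the orbits of both matrices; expanding the power of the
trace then separates the variables. -/
lemma integral_trace_mul_orthogonal_conj_pow (A : Matrix (Fin m) (Fin m) ℝ)
    {B : Matrix (Fin m) (Fin m) ℝ} (hB : B.IsHermitian) :
    ∫ Q : orthogonalGroup (Fin m) ℝ, (A * (Q.1 * B * Q.1ᵀ)).trace ^ t ∂haarO m =
      ∑ I : Fin t → Fin m × Fin m, entryMoment I A * entryMoment I B := by
  have hpow : ∀ P Q : orthogonalGroup (Fin m) ℝ,
      (P.1 * A * P.1ᵀ * (Q.1 * B * Q.1ᵀ)).trace ^ t = ∑ I : Fin t → Fin m × Fin m,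
        (∏ k, (P.1 * A * P.1ᵀ) (I k).1 (I k).2) * ∏ k, (Q.1 * B * Q.1ᵀ) (I k).1 (I k).2 :=
    fun P Q => by
      rw [← trace_mul_transpose_pow, ← conjTranspose_eq_transpose_of_trivial (Q.1 * B * Q.1ᵀ),
        (isHermitian_conj hB Q.1).eq]
  have hexpand : ∀ P : orthogonalGroup (Fin m) ℝ,
      ∫ Q : orthogonalGroup (Fin m) ℝ, (A * (Q.1 * B * Q.1ᵀ)).trace ^ t ∂haarO m =
        ∑ I : Fin t → Fin m × Fin m,
          (∏ k, (P.1 * A * P.1ᵀ) (I k).1 (I k).2) * entryMoment I B := fun P => by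
    rw [← integral_trace_orthogonal_conj_mul (· ^ t) P]
    simp_rw [hpow]
    rw [integral_finsetSum _ fun I _ => (integrable_prod_orthogonal_conj I B).const_mul _]
    simp_rw [integral_const_mul, entryMoment]
  have haverage := integral_congr_ae (μ := haarO m) (.of_forall hexpand)
  rw [integral_const, probReal_univ, one_smul] at haverage
  rw [haverage, integral_finsetSum _ fun I _ => (integrable_prod_orthogonal_conj I A).mul_const _]
  simp_rw [integral_mul_const, entryMoment]

lemma sum_mul_integral_trace_pow_nonneg {ι : Type*} (T : Finset ι) (u : ι → ℝ)
    {A : ι → Matrix (Fin m) (Fin m) ℝ} (hA : ∀ i, (A i).IsHermitian) :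
    0 ≤ ∑ i ∈ T, ∑ j ∈ T, u i * u j *
      ∫ Q : orthogonalGroup (Fin m) ℝ, (A i * (Q.1 * A j * Q.1ᵀ)).trace ^ t ∂haarO m := by
  calc (0 : ℝ)
    _ ≤ ∑ I : Fin t → Fin m × Fin m,
          (∑ i ∈ T, u i * entryMoment I (A i)) * ∑ j ∈ T, u j * entryMoment I (A j) :=
        sum_nonneg fun I _ => mul_self_nonneg _
    _ = _ := by
        simp_rw [sum_mul_sum]
        rw [sum_comm]
        refine sum_congr rfl fun i _ => ?_
        rw [sum_comm]
        refine sum_congr rfl fun j _ => ?_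
        rw [integral_trace_mul_orthogonal_conj_pow _ (hA j), mul_sum]
        exact sum_congr rfl fun I _ => by ring

lemma exists_finsupp_sum_eq_ite {ι α K : Type*} [Finite ι] [DecidableEq ι] [Field K]
    {f : ι → α → K} (hf : LinearIndependent K f) (i : ι) :
    ∃ u : α →₀ K, ∀ j, ∑ x ∈ u.support, u x * f j x = if j = i then 1 else 0 := by
  have hmem : Pi.single i 1 ∈ Submodule.span K (Set.range (flip f)) := by
    rw [span_flip_eq_top_iff_linearIndependent.2 hf]
    exact Submodule.mem_top
  obtain ⟨u, hu⟩ := Finsupp.mem_span_range_iff_exists_finsupp.1 hmem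
  refine ⟨u, fun j => ?_⟩
  simpa only [Finsupp.sum, Finset.sum_apply, Pi.smul_apply, smul_eq_mul, flip,
    Pi.single_apply] using congrFun hu j

lemma linearIndependent_eval_sphericalPoly (m t : ℕ) : LinearIndependent ℝ
    fun (κ : partitions m t) (y : {y : Fin m → ℝ // 0 ≤ y}) =>
      MvPolynomial.eval y.1 (sphericalPoly κ.1) := by
  classical
  refine Fintype.linearIndependent_iff.2 fun b hb κ => ?_
  obtain ⟨c, rfl⟩ : ∃ c : (Fin m → ℕ) → ℝ, (fun κ : partitions m t => c κ) = b :=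
    ⟨Function.extend Subtype.val b 0, funext fun κ => Subtype.val_injective.extend_apply b 0 κ⟩
  have hzero : ∑ ν ∈ partitions m t, c ν • sphericalPoly ν = 0 := by
    refine MvPolynomial.funext_set (fun _ => Set.Ici (0 : ℝ)) (fun _ => Set.Ici_infinite _)
      fun y hy => ?_
    have hy₀ := congrFun hb ⟨y, fun i => hy i (Set.mem_univ i)⟩
    simpa only [Finset.sum_apply, Pi.smul_apply, Pi.zero_apply, smul_eq_mul, map_zero, map_sum,
      MvPolynomial.smul_eval,
      sum_coe_sort (partitions m t) fun ν => c ν * MvPolynomial.eval y (sphericalPoly ν)] using hy₀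
  exact eq_zero_of_coeff_sum_sphericalPoly_eq_zero
    (fun μ _ => by rw [hzero, MvPolynomial.coeff_zero]) κ.1 κ.2

lemma integral_trace_diagonal_mul_orthogonal_conj_pow {s : (Fin m → ℕ) → ℝ}
    (hs : ∑ κ ∈ partitions m t, s κ • sphericalPoly κ = (∑ i, MvPolynomial.X i) ^ t)
    {y : Fin m → ℝ} (hy : 0 ≤ y) (z : Fin m → ℝ) :
    ∫ Q : orthogonalGroup (Fin m) ℝ,
        (diagonal y * (Q.1 * diagonal z * Q.1ᵀ)).trace ^ t ∂haarO m =
      ∑ κ ∈ partitions m t, s κ * (MvPolynomial.eval y (sphericalPoly κ) *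
        MvPolynomial.eval z (sphericalPoly κ)) := by
  set g : Matrix (Fin m) (Fin m) ℝ := diagonal fun i => √(y i) with hg
  have hgg : g * gᵀ = diagonal y := by
    simp only [hg, diagonal_transpose, diagonal_mul_diagonal, Real.mul_self_sqrt (hy _)]
  have hg' : gᵀ * g = diagonal y := by rw [← hgg, hg, diagonal_transpose]
  have hmean := integral_trace_conj_pow hs le_rfl g (isHermitian_diagonal z)
  simp_rw [trace_mul_comm _ gᵀ, ← Matrix.mul_assoc gᵀ g, hg', hgg] at hmean
  refine hmean.trans (sum_congr rfl fun κ hκ => ?_)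
  rw [eval_sphericalPoly (mem_partitions.1 hκ).2, eval_sphericalPoly (mem_partitions.1 hκ).2]
  rfl

/-- The powers of the trace define a positive semidefinite kernel on diagonal matrices, whose
expansion in the linearly independent spherical polynomials has the coefficients `s κ`. -/
lemma coeff_trace_pow_nonneg {s : (Fin m → ℕ) → ℝ}
    (hs : ∑ κ ∈ partitions m t, s κ • sphericalPoly κ = (∑ i, MvPolynomial.X i) ^ t)
    {κ : Fin m → ℕ} (hκ : κ ∈ partitions m t) : 0 ≤ s κ := by
  classical
  obtain ⟨u, hu⟩ :=
    exists_finsupp_sum_eq_ite (linearIndependent_eval_sphericalPoly m t) ⟨κ, hκ⟩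
  calc (0 : ℝ)
    _ ≤ ∑ y ∈ u.support, ∑ z ∈ u.support, u y * u z * ∫ Q : orthogonalGroup (Fin m) ℝ,
          (diagonal y.1 * (Q.1 * diagonal z.1 * Q.1ᵀ)).trace ^ t ∂haarO m :=
        sum_mul_integral_trace_pow_nonneg u.support u fun y => isHermitian_diagonal y.1
    _ = ∑ ν ∈ partitions m t, s ν *
          ((∑ y ∈ u.support, u y * MvPolynomial.eval y.1 (sphericalPoly ν)) *
            ∑ z ∈ u.support, u z * MvPolynomial.eval z.1 (sphericalPoly ν)) := by
        simp_rw [fun y : {y : Fin m → ℝ // 0 ≤ y} =>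
          integral_trace_diagonal_mul_orthogonal_conj_pow hs y.2, sum_mul_sum, mul_sum]
        rw [sum_congr rfl fun _ _ => sum_comm, sum_comm]
        exact sum_congr rfl fun ν _ => sum_congr rfl fun y _ => sum_congr rfl fun z _ => by ring
    _ = ∑ ν ∈ partitions m t, s ν * if ν = κ then 1 else 0 := by
        refine sum_congr rfl fun ν hν => ?_
        have hν' := hu ⟨ν, hν⟩
        simp only [Subtype.mk.injEq] at hν'
        rw [hν']
        split_ifs <;> norm_num
    _ = s κ := by simp only [mul_ite, mul_one, mul_zero, sum_ite_eq', hκ, if_true]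

end Positivity

/-! ### Gaussian moments of quadratic forms of projections -/

section GaussianReal

open scoped NNReal

lemma hasDerivAt_gaussianPDFReal (μ : ℝ) (v : ℝ≥0) (x : ℝ) :
    HasDerivAt (gaussianPDFReal μ v) (-((x - μ) / v * gaussianPDFReal μ v x)) x := by
  have hexponent : HasDerivAt (fun y : ℝ => -(y - μ) ^ 2 / (2 * v)) (-((x - μ) / v)) x := by
    refine ((((hasDerivAt_id x).sub_const μ).pow 2).neg.div_const (2 * (v : ℝ))).congr_deriv ?_
    simp only [id, Nat.cast_ofNat, Nat.add_one_sub_one, pow_one, mul_one]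
    rw [neg_div, mul_div_mul_left _ _ two_ne_zero]
  rw [gaussianPDFReal_def]
  exact (hexponent.exp.const_mul _).congr_deriv (by ring)

lemma integrable_pow_gaussianReal (μ : ℝ) (v : ℝ≥0) (k : ℕ) :
    Integrable (fun x => x ^ k) (gaussianReal μ v) :=
  (memLp_id_gaussianReal (k : ℝ≥0)).integrable_norm_pow'.mono' (by fun_prop)
    (.of_forall fun x => (norm_pow x k).le)

lemma integrable_pow_mul_gaussianPDFReal (μ : ℝ) (v : ℝ≥0) (k : ℕ) :
    Integrable fun x => x ^ k * gaussianPDFReal μ v x := by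
  rcases eq_or_ne v 0 with rfl | hv
  · simp only [gaussianPDFReal_zero_var, Pi.zero_apply, mul_zero]
    exact integrable_zero ..
  have hint := integrable_pow_gaussianReal μ v k
  rw [gaussianReal_of_var_ne_zero μ hv, integrable_withDensity_iff_integrable_smul'
    (measurable_gaussianPDF μ v) (.of_forall fun _ => gaussianPDF_lt_top)] at hint
  simpa only [toReal_gaussianPDF, smul_eq_mul, mul_comm] using hint

/-- Integration by parts. -/
lemma integral_pow_succ_gaussianReal (v : ℝ≥0) (k : ℕ) :
    ∫ x, x ^ (k + 1) ∂gaussianReal 0 v = v * k * ∫ x, x ^ (k - 1) ∂gaussianReal 0 v := by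
  rcases eq_or_ne v 0 with rfl | hv
  · simp only [gaussianReal_zero_var, integral_dirac, zero_pow k.succ_ne_zero, NNReal.coe_zero,
      zero_mul]
  have hv' : (v : ℝ) ≠ 0 := NNReal.coe_ne_zero.2 hv
  have hparts := integral_mul_deriv_eq_deriv_mul_of_integrable (u := fun x : ℝ => x ^ k)
    (fun x _ => hasDerivAt_pow k x) (fun x _ => hasDerivAt_gaussianPDFReal 0 v x)
    (((integrable_pow_mul_gaussianPDFReal 0 v (k + 1)).const_mul (-(v : ℝ)⁻¹)).congr
      (.of_forall fun x => by simp only [Pi.mul_apply]; ring))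
    (((integrable_pow_mul_gaussianPDFReal 0 v (k - 1)).const_mul (k : ℝ)).congr
      (.of_forall fun x => by simp only [Pi.mul_apply]; ring))
    (integrable_pow_mul_gaussianPDFReal 0 v k)
  simp_rw [integral_gaussianReal_eq_integral_smul hv, smul_eq_mul]
  calc ∫ x : ℝ, gaussianPDFReal 0 v x * x ^ (k + 1)
    _ = -(v * ∫ x : ℝ, x ^ k * -((x - 0) / v * gaussianPDFReal 0 v x)) := by
        rw [← integral_const_mul, ← integral_neg]
        exact integral_congr_ae (.of_forall fun x => by field_simp; ring)
    _ = v * k * ∫ x : ℝ, gaussianPDFReal 0 v x * x ^ (k - 1) := by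
        rw [hparts, mul_neg, neg_neg, mul_assoc, ← integral_const_mul (k : ℝ)]
        exact congrArg _ (integral_congr_ae (.of_forall fun x => by ring))

end GaussianReal

section GaussianPi

variable {ι : Type*} [Fintype ι]

/-- The standard Gaussian measure on `ι → ℝ`. -/
def gaussianPi (ι : Type*) [Fintype ι] : Measure (ι → ℝ) := Measure.pi fun _ => gaussianReal 0 1

instance : IsProbabilityMeasure (gaussianPi ι) :=
  inferInstanceAs (IsProbabilityMeasure (Measure.pi _))

lemma eval_monomial_eq_mul_prod (s : ι →₀ ℕ) (a : ℝ) (x : ι → ℝ) :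
    MvPolynomial.eval x (MvPolynomial.monomial s a) = a * ∏ i, x i ^ s i := by
  rw [MvPolynomial.eval_monomial, Finsupp.prod_fintype _ _ fun i => pow_zero _]

lemma integrable_eval_gaussianPi (P : MvPolynomial ι ℝ) :
    Integrable (fun x => MvPolynomial.eval x P) (gaussianPi ι) := by
  induction P using MvPolynomial.induction_on' with
  | monomial s a =>
    simp only [eval_monomial_eq_mul_prod]
    exact (Integrable.fintype_prod (f := fun i (x : ℝ) => x ^ s i)
      fun i => integrable_pow_gaussianReal 0 1 (s i)).const_mul a
  | add P Q hP hQ =>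
    simp only [map_add]
    exact hP.add hQ

/-- The Gaussian mean as a linear functional on polynomials. -/
def gaussianMean (ι : Type*) [Fintype ι] : MvPolynomial ι ℝ →ₗ[ℝ] ℝ where
  toFun P := ∫ x, MvPolynomial.eval x P ∂gaussianPi ι
  map_add' P Q := by
    simp only [map_add]
    exact integral_add (integrable_eval_gaussianPi P) (integrable_eval_gaussianPi Q)
  map_smul' c P := by
    simp only [MvPolynomial.smul_eval, integral_const_mul, RingHom.id_apply, smul_eq_mul]

lemma gaussianMean_apply (P : MvPolynomial ι ℝ) :
    gaussianMean ι P = ∫ x, MvPolynomial.eval x P ∂gaussianPi ι := rfl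

lemma gaussianMean_monomial (s : ι →₀ ℕ) (a : ℝ) :
    gaussianMean ι (MvPolynomial.monomial s a) = a * ∏ i, ∫ x, x ^ s i ∂gaussianReal 0 1 := by
  simp only [gaussianMean_apply, eval_monomial_eq_mul_prod, integral_const_mul]
  rw [gaussianPi, integral_fintype_prod_eq_prod (𝕜 := ℝ) (fun i (x : ℝ) => x ^ s i)]

/-- Stein's identity for polynomials. -/
lemma gaussianMean_X_mul (i : ι) (P : MvPolynomial ι ℝ) :
    gaussianMean ι (MvPolynomial.X i * P) = gaussianMean ι (MvPolynomial.pderiv i P) := by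
  classical
  induction P using MvPolynomial.induction_on' with
  | monomial s a =>
    have hprod :
        ∏ j ∈ univ.erase i, ∫ x, x ^ (Finsupp.single i 1 + s : ι →₀ ℕ) j ∂gaussianReal 0 1 =
          ∏ j ∈ univ.erase i, ∫ x, x ^ (s - Finsupp.single i 1 : ι →₀ ℕ) j ∂gaussianReal 0 1 := by
      refine prod_congr rfl fun j hj => ?_
      have hji : j ≠ i := ne_of_mem_erase hj
      simp only [Finsupp.add_apply, Finsupp.tsub_apply, Finsupp.single_eq_of_ne hji, zero_add,
        tsub_zero]
    rw [MvPolynomial.X, MvPolynomial.monomial_mul, one_mul, MvPolynomial.pderiv_monomial,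
      gaussianMean_monomial, gaussianMean_monomial, ← mul_prod_erase univ _ (mem_univ i),
      ← mul_prod_erase univ _ (mem_univ i), hprod]
    simp only [Finsupp.add_apply, Finsupp.tsub_apply, Finsupp.single_eq_same, add_comm 1]
    rw [integral_pow_succ_gaussianReal, NNReal.coe_one]
    ring
  | add P Q hP hQ => simp only [mul_add, map_add, hP, hQ]

end GaussianPi

section QuadForm

variable {ι : Type*} [Fintype ι] {R : Matrix ι ι ℝ}

lemma transpose_eq_of_isStarProjection (hR : IsStarProjection R) : Rᵀ = R := by
  rw [← conjTranspose_eq_transpose_of_trivial]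
  exact hR.isSelfAdjoint

lemma isStarProjection_of_transpose_eq (hsymm : Rᵀ = R) (hidem : R * R = R) :
    IsStarProjection R where
  isIdempotentElem := hidem
  isSelfAdjoint := (conjTranspose_eq_transpose_of_trivial R).trans hsymm

/-- The linear form with coefficients in the `i`-th row of `R`. -/
def rowForm (R : Matrix ι ι ℝ) (i : ι) : MvPolynomial ι ℝ :=
  ∑ j, MvPolynomial.C (R i j) * MvPolynomial.X j

/-- The quadratic form of `R`. -/
def quadForm (R : Matrix ι ι ℝ) : MvPolynomial ι ℝ :=
  ∑ i, MvPolynomial.X i * rowForm R i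

lemma eval_rowForm (R : Matrix ι ι ℝ) (i : ι) (x : ι → ℝ) :
    MvPolynomial.eval x (rowForm R i) = (R *ᵥ x) i := by
  simp only [rowForm, mulVec, dotProduct, map_sum, map_mul, MvPolynomial.eval_C,
    MvPolynomial.eval_X]

lemma eval_quadForm (R : Matrix ι ι ℝ) (x : ι → ℝ) :
    MvPolynomial.eval x (quadForm R) = x ⬝ᵥ R *ᵥ x := by
  simp only [quadForm, dotProduct, map_sum, map_mul, MvPolynomial.eval_X, eval_rowForm]

lemma pderiv_rowForm (R : Matrix ι ι ℝ) (i k : ι) :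
    MvPolynomial.pderiv k (rowForm R i) = MvPolynomial.C (R i k) := by
  classical
  simp [rowForm, MvPolynomial.pderiv_X, Pi.single_apply]

lemma pderiv_quadForm (hR : Rᵀ = R) (k : ι) :
    MvPolynomial.pderiv k (quadForm R) = 2 * rowForm R k := by
  classical
  have hcolumn : ∑ i, MvPolynomial.X i * MvPolynomial.C (R i k) = rowForm R k := by
    refine sum_congr rfl fun i _ => ?_
    rw [mul_comm, ← transpose_apply R, hR]
  simp only [quadForm, map_sum, Derivation.leibniz, pderiv_rowForm, smul_eq_mul,
    sum_add_distrib, hcolumn, MvPolynomial.pderiv_X, Pi.single_apply, mul_ite, mul_one, mul_zero,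
    sum_ite_eq', mem_univ, if_true]
  ring

lemma dotProduct_mulVec_of_isStarProjection (hR : IsStarProjection R) (x : ι → ℝ) :
    x ⬝ᵥ R *ᵥ x = (R *ᵥ x) ⬝ᵥ (R *ᵥ x) := by
  rw [dotProduct_mulVec (R *ᵥ x), vecMul_mulVec, transpose_eq_of_isStarProjection hR,
    hR.isIdempotentElem.eq, dotProduct_mulVec]

lemma dotProduct_mulVec_nonneg_of_isStarProjection (hR : IsStarProjection R) (x : ι → ℝ) :
    0 ≤ x ⬝ᵥ R *ᵥ x := by
  rw [dotProduct_mulVec_of_isStarProjection hR]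
  exact sum_nonneg fun i _ => mul_self_nonneg _

lemma sum_rowForm_mul_self (hR : IsStarProjection R) :
    ∑ i, rowForm R i * rowForm R i = quadForm R := by
  refine MvPolynomial.funext fun x => ?_
  rw [eval_quadForm, dotProduct_mulVec_of_isStarProjection hR]
  simp only [map_sum, map_mul, eval_rowForm, dotProduct]

lemma sum_pderiv_rowForm_mul_quadForm_pow (hR : IsStarProjection R) (k : ℕ) :
    ∑ i, MvPolynomial.pderiv i (rowForm R i * quadForm R ^ k) =
      (R.trace + 2 * k) • quadForm R ^ k := by
  have hterm : ∀ i, MvPolynomial.pderiv i (rowForm R i * quadForm R ^ k) =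
      MvPolynomial.C (R i i) * quadForm R ^ k +
        2 * (k : MvPolynomial ι ℝ) * quadForm R ^ (k - 1) * (rowForm R i * rowForm R i) :=
    fun i => by
      rw [Derivation.leibniz, Derivation.leibniz_pow, pderiv_rowForm,
        pderiv_quadForm (transpose_eq_of_isStarProjection hR)]
      simp only [smul_eq_mul, nsmul_eq_mul]
      ring
  simp_rw [hterm]
  rw [sum_add_distrib, ← sum_mul, ← mul_sum, sum_rowForm_mul_self hR, ← map_sum,
    MvPolynomial.smul_eq_C_mul, map_add, map_mul, map_natCast, map_ofNat, add_mul]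
  congr 1
  rcases k with _ | k
  · simp only [Nat.cast_zero, mul_zero, zero_mul]
  · rw [Nat.add_sub_cancel, pow_succ, mul_assoc]

/-- The moments of the chi-squared distribution with `R.trace` degrees of freedom. -/
lemma gaussianMean_quadForm_pow (hR : IsStarProjection R) (k : ℕ) :
    gaussianMean ι (quadForm R ^ k) = ∏ j ∈ range k, (R.trace + 2 * j) := by
  induction k with
  | zero =>
    simp only [pow_zero, range_zero, prod_empty, gaussianMean_apply, map_one, integral_const,
      probReal_univ, smul_eq_mul, mul_one]
  | succ k ih =>
    have hexpand : quadForm R ^ (k + 1) =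
        ∑ i, MvPolynomial.X i * (rowForm R i * quadForm R ^ k) := by
      simp only [← mul_assoc, ← sum_mul]
      exact pow_succ' _ _
    rw [prod_range_succ, ← ih, hexpand, map_sum, sum_congr rfl fun i _ => gaussianMean_X_mul i _,
      ← map_sum, sum_pderiv_rowForm_mul_quadForm_pow hR, map_smul, smul_eq_mul, mul_comm]

lemma lintegral_quadForm_pow (hR : IsStarProjection R) (k : ℕ) :
    ∫⁻ x, ENNReal.ofReal ((x ⬝ᵥ R *ᵥ x) ^ k) ∂gaussianPi ι =
      ENNReal.ofReal (∏ j ∈ range k, (R.trace + 2 * j)) := by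
  rw [← gaussianMean_quadForm_pow hR, gaussianMean_apply,
    ofReal_integral_eq_lintegral_ofReal (integrable_eval_gaussianPi _)]
  · simp only [map_pow, eval_quadForm]
  · refine .of_forall fun x => ?_
    simp only [map_pow, eval_quadForm]
    exact pow_nonneg (dotProduct_mulVec_nonneg_of_isStarProjection hR x) k

end QuadForm

/-! ### Gaussian moments of power functions of Gram matrices -/

section Gram

variable {m n : ℕ} {R : Matrix (Fin n) (Fin n) ℝ}

lemma mul_mul_transpose_of_isStarProjection {ι κ : Type*} [Fintype ι] {P : Matrix ι ι ℝ}
    (hP : IsStarProjection P) (A : Matrix κ ι ℝ) : A * P * Aᵀ = (A * P) * (A * P)ᵀ := by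
  rw [transpose_mul, transpose_eq_of_isStarProjection hP, Matrix.mul_assoc A P (P * Aᵀ),
    ← Matrix.mul_assoc P P, hP.isIdempotentElem.eq, Matrix.mul_assoc]

lemma posSemidef_mul_transpose {ι κ : Type*} [Fintype ι] [Finite κ] (A : Matrix κ ι ℝ) :
    (A * Aᵀ).PosSemidef := by
  simpa only [conjTranspose_eq_transpose_of_trivial] using posSemidef_self_mul_conjTranspose A

lemma posSemidef_conj_of_isStarProjection {ι κ : Type*} [Fintype ι] [Finite κ] {P : Matrix ι ι ℝ}
    (hP : IsStarProjection P) (A : Matrix κ ι ℝ) : (A * P * Aᵀ).PosSemidef := by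
  rw [mul_mul_transpose_of_isStarProjection hP]
  exact posSemidef_mul_transpose _

lemma det_eq_zero_of_det_submatrix_eq_zero {ι κ : Type*} [Fintype ι] [DecidableEq ι] [Fintype κ]
    [DecidableEq κ] {S : Matrix ι ι ℝ} (hS : S.PosSemidef) {f : κ → ι}
    (hf : Function.Injective f) (hdet : (S.submatrix f f).det = 0) : S.det = 0 := by
  by_contra hne
  exact ((hS.posDef_iff_det_ne_zero.2 hne).submatrix hf).det_pos.ne' hdet

/-- The orthogonal projection onto the row space of `B`. The formula is meaningful when the rows of
`B` are linearly independent, that is, when `B * Bᵀ` is invertible. -/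
def rowProj (B : Matrix (Fin m) (Fin n) ℝ) : Matrix (Fin n) (Fin n) ℝ := Bᵀ * (B * Bᵀ)⁻¹ * B

lemma isStarProjection_rowProj {B : Matrix (Fin m) (Fin n) ℝ} (hB : (B * Bᵀ).det ≠ 0) :
    IsStarProjection (rowProj B) := by
  refine isStarProjection_of_transpose_eq ?_ ?_
  · simp only [rowProj, transpose_mul, transpose_transpose, transpose_nonsing_inv,
      Matrix.mul_assoc]
  · calc rowProj B * rowProj B
      _ = Bᵀ * ((B * Bᵀ)⁻¹ * (B * Bᵀ)) * (B * Bᵀ)⁻¹ * B := by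
          simp only [rowProj, Matrix.mul_assoc]
      _ = rowProj B := by
          rw [nonsing_inv_mul _ (isUnit_iff_ne_zero.2 hB), Matrix.mul_one, rowProj]

lemma trace_rowProj {B : Matrix (Fin m) (Fin n) ℝ} (hB : (B * Bᵀ).det ≠ 0) :
    (rowProj B).trace = m := by
  rw [rowProj, Matrix.mul_assoc, trace_mul_comm, Matrix.mul_assoc,
    nonsing_inv_mul _ (isUnit_iff_ne_zero.2 hB), trace_one, Fintype.card_fin]

lemma isStarProjection_sub_rowProj (hR : IsStarProjection R) {A : Matrix (Fin m) (Fin n) ℝ}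
    (hA : (A * R * Aᵀ).det ≠ 0) : IsStarProjection (R - rowProj (A * R)) := by
  rw [mul_mul_transpose_of_isStarProjection hR] at hA
  refine (isStarProjection_rowProj hA).sub_of_mul_eq_left hR ?_
  rw [rowProj, Matrix.mul_assoc, Matrix.mul_assoc A R R, hR.isIdempotentElem.eq]

/-- The matrix `A` with the row `x` appended. -/
def appendRow (A : Matrix (Fin m) (Fin n) ℝ) (x : Fin n → ℝ) : Matrix (Fin (m + 1)) (Fin n) ℝ :=
  of (Fin.snoc (α := fun _ => Fin n → ℝ) A x)

lemma submatrix_castSucc_appendRow (A : Matrix (Fin m) (Fin n) ℝ) (x : Fin n → ℝ) :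
    (appendRow A x).submatrix Fin.castSucc id = A := by
  ext i j
  exact congrFun (Fin.snoc_castSucc (α := fun _ => Fin n → ℝ) x A i) j

lemma submatrix_finSumFinEquiv_appendRow (A : Matrix (Fin m) (Fin n) ℝ) (x : Fin n → ℝ) :
    (appendRow A x).submatrix finSumFinEquiv id = fromRows A (replicateRow (Fin 1) x) := by
  ext i j
  rcases i with i | i
  · exact congrFun (Fin.snoc_castSucc (α := fun _ => Fin n → ℝ) x A i) j
  · rw [Subsingleton.elim i 0]
    exact congrFun (Fin.snoc_last (α := fun _ => Fin n → ℝ) x A) j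

lemma submatrix_castSucc_appendRow_conj (R : Matrix (Fin n) (Fin n) ℝ)
    (A : Matrix (Fin m) (Fin n) ℝ) (x : Fin n → ℝ) :
    (appendRow A x * R * (appendRow A x)ᵀ).submatrix Fin.castSucc Fin.castSucc = A * R * Aᵀ := by
  conv_rhs => rw [← submatrix_castSucc_appendRow A x]
  rfl

/-- The Schur complement of the Gram matrix of the rows of `A`. -/
lemma det_appendRow_conj (hR : IsStarProjection R) {A : Matrix (Fin m) (Fin n) ℝ}
    (hA : (A * R * Aᵀ).det ≠ 0) (x : Fin n → ℝ) :
    (appendRow A x * R * (appendRow A x)ᵀ).det =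
      (A * R * Aᵀ).det * (x ⬝ᵥ (R - rowProj (A * R)) *ᵥ x) := by
  set X : Matrix (Fin 1) (Fin n) ℝ := replicateRow (Fin 1) x
  have hblocks : (appendRow A x * R * (appendRow A x)ᵀ).submatrix finSumFinEquiv finSumFinEquiv =
      fromBlocks (A * R * Aᵀ) (A * R * Xᵀ) (X * R * Aᵀ) (X * R * Xᵀ) := by
    change (appendRow A x).submatrix finSumFinEquiv id * R *
      ((appendRow A x).submatrix finSumFinEquiv id)ᵀ = _
    rw [submatrix_finSumFinEquiv_appendRow, fromRows_mul, transpose_fromRows,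
      fromRows_mul_fromCols]
  have hschur : X * R * Xᵀ - X * R * Aᵀ * (A * R * Aᵀ)⁻¹ * (A * R * Xᵀ) =
      X * (R - rowProj (A * R)) * Xᵀ := by
    rw [rowProj, ← mul_mul_transpose_of_isStarProjection hR, transpose_mul,
      transpose_eq_of_isStarProjection hR]
    simp only [Matrix.mul_sub, Matrix.sub_mul, Matrix.mul_assoc]
  have : Invertible (A * R * Aᵀ) := invertibleOfIsUnitDet _ (isUnit_iff_ne_zero.2 hA)
  rw [← det_submatrix_equiv_self finSumFinEquiv, hblocks, det_fromBlocks₁₁, invOf_eq_nonsing_inv,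
    hschur]
  congr 1
  rw [det_unique, mul_apply, dotProduct_mulVec, dotProduct]
  rfl

lemma lintegral_det_appendRow_pow (hR : IsStarProjection R) (A : Matrix (Fin m) (Fin n) ℝ)
    (k : ℕ) :
    ∫⁻ x, ENNReal.ofReal ((appendRow A x * R * (appendRow A x)ᵀ).det ^ k) ∂gaussianPi (Fin n) =
      ENNReal.ofReal ((A * R * Aᵀ).det ^ k) *
        ENNReal.ofReal (∏ j ∈ range k, (R.trace - m + 2 * j)) := by
  by_cases hA : (A * R * Aᵀ).det = 0
  · have hzero : ∀ x, (appendRow A x * R * (appendRow A x)ᵀ).det = 0 := fun x =>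
      det_eq_zero_of_det_submatrix_eq_zero (posSemidef_conj_of_isStarProjection hR _)
        (Fin.castSucc_injective m) (by rw [submatrix_castSucc_appendRow_conj, hA])
    simp_rw [hzero, hA]
    rcases k with _ | k <;> simp
  · have htrace : (R - rowProj (A * R)).trace = R.trace - m := by
      rw [trace_sub, trace_rowProj (by rwa [← mul_mul_transpose_of_isStarProjection hR])]
    simp_rw [det_appendRow_conj hR hA, mul_pow, ENNReal.ofReal_mul
      (pow_nonneg (posSemidef_conj_of_isStarProjection hR A).det_nonneg k)]
    rw [lintegral_const_mul' _ _ ENNReal.ofReal_ne_top,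
      lintegral_quadForm_pow (isStarProjection_sub_rowProj hR hA), htrace]

/-- The variant of the power function of the exponents `e 0, …, e (m - 1)` in which the determinant
carries the exponent `e (m - 1)` instead of being lowered by `e m`, so that an induction on `m` is
possible. -/
def minorPower (e : ℕ → ℕ) (S : Matrix (Fin m) (Fin m) ℝ) : ℝ :=
  (∏ i : Fin m, leadMinor S i ^ (e i - e (i + 1))) * S.det ^ e m

lemma powerFn_eq_minorPower (κ : Fin m → ℕ) (S : Matrix (Fin m) (Fin m) ℝ) :
    powerFn κ S = minorPower (extendZero κ) S := by
  rw [minorPower, extendZero_self, pow_zero, mul_one]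
  rfl

lemma continuous_minorPower (e : ℕ → ℕ) {α : Type*} [TopologicalSpace α]
    {S : α → Matrix (Fin m) (Fin m) ℝ} (hS : Continuous S) :
    Continuous fun x => minorPower e (S x) :=
  (continuous_finsetProd _ fun i _ => (continuous_leadMinor hS i).pow _).mul (hS.matrix_det.pow _)

lemma minorPower_appendRow_conj {e : ℕ → ℕ} (he : Antitone e) (R : Matrix (Fin n) (Fin n) ℝ)
    (A : Matrix (Fin m) (Fin n) ℝ) (x : Fin n → ℝ) :
    minorPower e (appendRow A x * R * (appendRow A x)ᵀ) =
      (∏ i : Fin m, leadMinor (A * R * Aᵀ) i ^ (e i - e (i + 1))) *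
        (appendRow A x * R * (appendRow A x)ᵀ).det ^ e m := by
  set S := appendRow A x * R * (appendRow A x)ᵀ
  have hminor : ∀ i : Fin m, leadMinor S i.castSucc = leadMinor (A * R * Aᵀ) i := fun i => by
    rw [← submatrix_castSucc_appendRow_conj R A x]
    rfl
  have hlast : leadMinor S (Fin.last m) = S.det := rfl
  rw [minorPower, Fin.prod_univ_castSucc, hlast, mul_assoc, ← pow_add]
  simp only [hminor, Fin.val_castSucc, Fin.val_last]
  rw [Nat.sub_add_cancel (he m.le_succ)]

lemma lintegral_minorPower_appendRow (hR : IsStarProjection R) {e : ℕ → ℕ} (he : Antitone e)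
    (A : Matrix (Fin m) (Fin n) ℝ) :
    ∫⁻ x, ENNReal.ofReal (minorPower e (appendRow A x * R * (appendRow A x)ᵀ))
        ∂gaussianPi (Fin n) =
      ENNReal.ofReal (minorPower e (A * R * Aᵀ)) *
        ENNReal.ofReal (∏ j ∈ range (e m), (R.trace - m + 2 * j)) := by
  have hminors : 0 ≤ ∏ i : Fin m, leadMinor (A * R * Aᵀ) i ^ (e i - e (i + 1)) :=
    prod_nonneg fun i _ =>
      pow_nonneg (leadMinor_nonneg (posSemidef_conj_of_isStarProjection hR A) i) _
  simp_rw [minorPower_appendRow_conj he, ENNReal.ofReal_mul hminors]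
  rw [lintegral_const_mul' _ _ ENNReal.ofReal_ne_top, lintegral_det_appendRow_pow hR, minorPower,
    ENNReal.ofReal_mul hminors, mul_assoc]

/-- The standard Gaussian measure on `m × n` matrices, given by their rows. -/
def gaussianRows (m n : ℕ) : Measure (Fin m → Fin n → ℝ) := Measure.pi fun _ => gaussianPi (Fin n)

instance : IsProbabilityMeasure (gaussianRows m n) :=
  inferInstanceAs (IsProbabilityMeasure (Measure.pi _))

lemma continuous_gaussianRows_conj (R : Matrix (Fin n) (Fin n) ℝ) :
    Continuous fun G : Fin m → Fin n → ℝ => of G * R * (of G)ᵀ :=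
  (continuous_id.matrix_mul continuous_const).matrix_mul (Continuous.matrix_transpose continuous_id)

lemma lintegral_gaussianRows_succ {f : (Fin (m + 1) → Fin n → ℝ) → ENNReal} (hf : Measurable f) :
    ∫⁻ G, f G ∂gaussianRows (m + 1) n =
      ∫⁻ A, ∫⁻ x, f (appendRow (of A) x) ∂gaussianPi (Fin n) ∂gaussianRows m n := by
  have hmp := (measurePreserving_piFinSuccAbove (fun _ : Fin (m + 1) => gaussianPi (Fin n))
    (Fin.last m)).symm
  have happend : ∀ (A : Fin m → Fin n → ℝ) (x : Fin n → ℝ),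
      (MeasurableEquiv.piFinSuccAbove (fun _ => Fin n → ℝ) (Fin.last m)).symm (x, A) =
        appendRow (of A) x := fun A x => Fin.insertNth_last' x A
  calc ∫⁻ G, f G ∂gaussianRows (m + 1) n
    _ = ∫⁻ z, f ((MeasurableEquiv.piFinSuccAbove (fun _ => Fin n → ℝ) (Fin.last m)).symm z)
          ∂(gaussianPi (Fin n)).prod (gaussianRows m n) := (hmp.lintegral_comp hf).symm
    _ = ∫⁻ A, ∫⁻ x, f ((MeasurableEquiv.piFinSuccAbove (fun _ => Fin n → ℝ) (Fin.last m)).symm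
          (x, A)) ∂gaussianPi (Fin n) ∂gaussianRows m n :=
        lintegral_prod_symm _ (hf.comp (MeasurableEquiv.measurable _)).aemeasurable
    _ = _ := lintegral_congr fun A => lintegral_congr fun x => congrArg f (happend A x)

lemma lintegral_minorPower_gaussianRows (hR : IsStarProjection R) {e : ℕ → ℕ} (he : Antitone e)
    (hm : (m : ℝ) ≤ R.trace) :
    ∫⁻ G : Fin m → Fin n → ℝ, ENNReal.ofReal (minorPower e (of G * R * (of G)ᵀ))
        ∂gaussianRows m n =
      ENNReal.ofReal (∏ i ∈ range m, ∏ j ∈ range (e i), (R.trace - i + 2 * j)) := by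
  induction m with
  | zero => simp [minorPower]
  | succ m ih =>
    have hm' : (m : ℝ) ≤ R.trace := (Nat.cast_le.2 m.le_succ).trans hm
    have hfactor : 0 ≤ ∏ i ∈ range m, ∏ j ∈ range (e i), (R.trace - i + 2 * j) :=
      prod_nonneg fun i hi => prod_nonneg fun j _ => add_nonneg (sub_nonneg.2
        ((Nat.cast_le.2 (mem_range.1 hi).le).trans hm')) (by positivity)
    rw [lintegral_gaussianRows_succ ((continuous_minorPower e
      (continuous_gaussianRows_conj R)).measurable.ennreal_ofReal)]
    change ∫⁻ A : Fin m → Fin n → ℝ, ∫⁻ x, ENNReal.ofReal (minorPower e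
      (appendRow (of A) x * R * (appendRow (of A) x)ᵀ)) ∂gaussianPi (Fin n) ∂gaussianRows m n = _
    simp_rw [lintegral_minorPower_appendRow hR he]
    rw [lintegral_mul_const' _ _ ENNReal.ofReal_ne_top, ih hm', prod_range_succ,
      ENNReal.ofReal_mul hfactor]

end Gram

/-! ### Kummer's relation at half-integral parameters -/

section HalfIntegers

variable {m n : ℕ}

/-- The Gaussian mean of the power function `powerFn κ` of the Gram matrix `G * R * Gᵀ`, where `R`
is an orthogonal projection of rank `r`. -/
def wishartMoment (κ : Fin m → ℕ) (r : ℝ) : ℝ :=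
  ∏ i : Fin m, ∏ j ∈ range (κ i), (r - (i : ℕ) + 2 * j)

lemma wishartMoment_pos (κ : Fin m → ℕ) {r : ℝ} (hr : (m : ℝ) ≤ r) : 0 < wishartMoment κ r :=
  prod_pos fun i _ => prod_pos fun j _ => add_pos_of_pos_of_nonneg
    (sub_pos.2 ((Nat.cast_lt.2 i.isLt).trans_le hr)) (by positivity)

lemma lintegral_powerFn_gaussianRows {R : Matrix (Fin n) (Fin n) ℝ} (hR : IsStarProjection R)
    {κ : Fin m → ℕ} (hκ : Antitone κ) (hm : (m : ℝ) ≤ R.trace) :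
    ∫⁻ G : Fin m → Fin n → ℝ, ENNReal.ofReal (powerFn κ (of G * R * (of G)ᵀ)) ∂gaussianRows m n =
      ENNReal.ofReal (wishartMoment κ R.trace) := by
  simp_rw [powerFn_eq_minorPower]
  rw [lintegral_minorPower_gaussianRows hR (extendZero_antitone hκ) hm, wishartMoment,
    ← Fin.prod_univ_eq_prod_range
      (fun i => ∏ j ∈ range (extendZero κ i), (R.trace - (i : ℝ) + 2 * j)) m]
  simp only [extendZero_val]

lemma isStarProjection_orthogonal_conj {Λ : Matrix (Fin n) (Fin n) ℝ} (hΛ : IsStarProjection Λ)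
    (Q : orthogonalGroup (Fin n) ℝ) : IsStarProjection (Q.1 * Λ * Q.1ᵀ) := by
  refine isStarProjection_of_transpose_eq ?_ ?_
  · simp only [transpose_mul, transpose_transpose, transpose_eq_of_isStarProjection hΛ,
      Matrix.mul_assoc]
  · calc Q.1 * Λ * Q.1ᵀ * (Q.1 * Λ * Q.1ᵀ)
      _ = Q.1 * Λ * (Q.1ᵀ * Q.1) * Λ * Q.1ᵀ := by simp only [Matrix.mul_assoc]
      _ = Q.1 * (Λ * Λ) * Q.1ᵀ := by
          rw [transpose_mul_of_orthogonal, Matrix.mul_one, Matrix.mul_assoc Q.1]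
      _ = Q.1 * Λ * Q.1ᵀ := by rw [hΛ.isIdempotentElem.eq]

lemma trace_orthogonal_conj (Λ : Matrix (Fin n) (Fin n) ℝ) (Q : orthogonalGroup (Fin n) ℝ) :
    (Q.1 * Λ * Q.1ᵀ).trace = Λ.trace := by
  rw [trace_mul_comm, ← Matrix.mul_assoc, transpose_mul_of_orthogonal, Matrix.one_mul]

lemma posSemidef_of_isStarProjection {Λ : Matrix (Fin n) (Fin n) ℝ} (hΛ : IsStarProjection Λ) :
    Λ.PosSemidef := by
  simpa only [Matrix.one_mul, transpose_one, Matrix.mul_one] using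
    posSemidef_conj_of_isStarProjection hΛ (1 : Matrix (Fin n) (Fin n) ℝ)

lemma lintegral_powerFn_conj (h : m ≤ n) {Λ : Matrix (Fin n) (Fin n) ℝ}
    (hΛ : IsStarProjection Λ) (κ : Fin m → ℕ) (g : Matrix (Fin m) (Fin n) ℝ) :
    ∫⁻ Q : orthogonalGroup (Fin n) ℝ,
        ENNReal.ofReal (powerFn κ (g * (Q.1 * Λ * Q.1ᵀ) * gᵀ)) ∂haarO n =
      ENNReal.ofReal (powerFn κ (g * (1 : Matrix (Fin n) (Fin n) ℝ) * gᵀ)) *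
        ENNReal.ofReal (orbitMean h κ Λ) := by
  rw [Matrix.mul_one, ← ENNReal.ofReal_mul (powerFn_nonneg κ (posSemidef_mul_transpose g)),
    ← integral_powerFn_conj h κ g Λ, ofReal_integral_eq_lintegral_ofReal]
  · exact integrable_haarO (continuous_powerFn κ ((continuous_const.matrix_mul
      (continuous_orthogonal_conj Λ)).matrix_mul continuous_const))
  · exact .of_forall fun Q => powerFn_nonneg κ
      (posSemidef_conj_of_isStarProjection (isStarProjection_orthogonal_conj hΛ Q) g)

lemma measurable_powerFn_gaussianRows_conj (κ : Fin m → ℕ) (Λ : Matrix (Fin n) (Fin n) ℝ) :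
    Measurable fun z : orthogonalGroup (Fin n) ℝ × (Fin m → Fin n → ℝ) =>
      ENNReal.ofReal (powerFn κ (of z.2 * (z.1.1 * Λ * z.1.1ᵀ) * (of z.2)ᵀ)) := by
  have hG : Continuous fun z : orthogonalGroup (Fin n) ℝ × (Fin m → Fin n → ℝ) =>
      (of z.2 : Matrix (Fin m) (Fin n) ℝ) := continuous_snd
  exact (continuous_powerFn κ ((hG.matrix_mul ((continuous_orthogonal_conj Λ).comp
    continuous_fst)).matrix_mul hG.matrix_transpose)).measurable.ennreal_ofReal

/-- The Gaussian mean of `powerFn κ (G * (Q * Λ * Qᵀ) * Gᵀ)` does not depend on the orthogonal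
matrix `Q`, so averaging over `Q` before averaging over `G` gives the orbit mean. -/
lemma orbitMean_of_isStarProjection (h : m ≤ n) {Λ : Matrix (Fin n) (Fin n) ℝ}
    (hΛ : IsStarProjection Λ) {κ : Fin m → ℕ} (hκ : Antitone κ) (hm : (m : ℝ) ≤ Λ.trace) :
    orbitMean h κ Λ = wishartMoment κ Λ.trace / wishartMoment κ n := by
  have hn : (m : ℝ) ≤ n := Nat.cast_le.2 h
  have hnonneg : 0 ≤ orbitMean h κ Λ :=
    integral_nonneg fun Q => powerFn_nonneg κ (posSemidef_conj_of_isStarProjection hΛ _)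
  have hmean : ∀ Q : orthogonalGroup (Fin n) ℝ, ∫⁻ G : Fin m → Fin n → ℝ,
      ENNReal.ofReal (powerFn κ (of G * (Q.1 * Λ * Q.1ᵀ) * (of G)ᵀ)) ∂gaussianRows m n =
        ENNReal.ofReal (wishartMoment κ Λ.trace) := fun Q => by
    rw [lintegral_powerFn_gaussianRows (isStarProjection_orthogonal_conj hΛ Q) hκ
      (by rwa [trace_orthogonal_conj]), trace_orthogonal_conj]
  have hswap : ∫⁻ G : Fin m → Fin n → ℝ, ∫⁻ Q : orthogonalGroup (Fin n) ℝ,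
      ENNReal.ofReal (powerFn κ (of G * (Q.1 * Λ * Q.1ᵀ) * (of G)ᵀ)) ∂haarO n ∂gaussianRows m n =
        ENNReal.ofReal (wishartMoment κ Λ.trace) := by
    rw [← lintegral_lintegral_swap (measurable_powerFn_gaussianRows_conj κ Λ).aemeasurable]
    simp_rw [hmean]
    rw [lintegral_const, measure_univ, mul_one]
  simp_rw [lintegral_powerFn_conj h hΛ κ] at hswap
  rw [lintegral_mul_const' _ _ ENNReal.ofReal_ne_top,
    lintegral_powerFn_gaussianRows (.one _) hκ (by rwa [trace_one, Fintype.card_fin]),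
    trace_one, Fintype.card_fin, ← ENNReal.ofReal_mul (wishartMoment_pos κ hn).le,
    ENNReal.ofReal_eq_ofReal_iff (mul_nonneg (wishartMoment_pos κ hn).le hnonneg)
      (wishartMoment_pos κ hm).le] at hswap
  rw [eq_div_iff (wishartMoment_pos κ hn).ne', mul_comm, hswap]

open scoped MatrixOrder in
lemma exists_mul_transpose_eq (h : m ≤ n) {X : Matrix (Fin m) (Fin m) ℝ} (hX : X.PosSemidef) :
    ∃ g : Matrix (Fin m) (Fin n) ℝ, g * gᵀ = X := by
  obtain ⟨B, hB⟩ := CStarAlgebra.nonneg_iff_eq_mul_star_self.1 hX.nonneg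
  refine ⟨B * topRows h (1 : orthogonalGroup (Fin n) ℝ).1, ?_⟩
  rw [transpose_mul, Matrix.mul_assoc, ← Matrix.mul_assoc (topRows h _),
    topRows_mul_transpose_of_orthogonal, Matrix.one_mul, hB, star_eq_conjTranspose,
    conjTranspose_eq_transpose_of_trivial]

lemma exists_isStarProjection_trace_eq (p q : ℕ) :
    ∃ Λ : Matrix (Fin (p + q)) (Fin (p + q)) ℝ, IsStarProjection Λ ∧ Λ.trace = p := by
  refine ⟨diagonal fun i => if (i : ℕ) < p then 1 else 0,
    isStarProjection_of_transpose_eq (diagonal_transpose _) ?_, ?_⟩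
  · simp only [diagonal_mul_diagonal, mul_ite, mul_one, mul_zero, ← ite_and, and_self]
  · rw [trace_diagonal, Fin.sum_univ_add]
    simp

variable {s : (Fin m → ℕ) → ℝ} {t : ℕ}

lemma integral_trace_conj_pow_of_isStarProjection
    (hs : ∑ κ ∈ partitions m t, s κ • sphericalPoly κ = (∑ i, MvPolynomial.X i) ^ t) (h : m ≤ n)
    (g : Matrix (Fin m) (Fin n) ℝ) {Λ : Matrix (Fin n) (Fin n) ℝ} (hΛ : IsStarProjection Λ)
    (hm : (m : ℝ) ≤ Λ.trace) :
    ∫ Q : orthogonalGroup (Fin n) ℝ, (g * (Q.1 * Λ * Q.1ᵀ) * gᵀ).trace ^ t ∂haarO n =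
      ∑ κ ∈ partitions m t, s κ * sphericalFn κ (g * gᵀ) *
        (wishartMoment κ Λ.trace / wishartMoment κ n) := by
  rw [integral_trace_conj_pow hs h g (posSemidef_of_isStarProjection hΛ).isHermitian]
  refine sum_congr rfl fun κ hκ => ?_
  rw [orbitMean_of_isStarProjection h hΛ (mem_partitions.1 hκ).2 hm, mul_assoc]

lemma trace_conj_pow_eq_sum_one_sub (g : Matrix (Fin m) (Fin n) ℝ) (Λ : Matrix (Fin n) (Fin n) ℝ)
    (Q : orthogonalGroup (Fin n) ℝ) (t : ℕ) :
    (g * (Q.1 * Λ * Q.1ᵀ) * gᵀ).trace ^ t =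
      ∑ k ∈ range (t + 1), (t.choose k : ℝ) * (g * gᵀ).trace ^ (t - k) * (-1) ^ k *
        (g * (Q.1 * (1 - Λ) * Q.1ᵀ) * gᵀ).trace ^ k := by
  have hsplit : (g * (Q.1 * Λ * Q.1ᵀ) * gᵀ).trace =
      -(g * (Q.1 * (1 - Λ) * Q.1ᵀ) * gᵀ).trace + (g * gᵀ).trace := by
    rw [Matrix.mul_sub, Matrix.sub_mul, Matrix.mul_one, mul_transpose_of_orthogonal,
      Matrix.mul_sub, Matrix.sub_mul, Matrix.mul_one, trace_sub]
    ring
  rw [hsplit, add_pow]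
  refine sum_congr rfl fun k _ => ?_
  rw [neg_pow]
  ring

/-- Both sides average `(g * (Q * Λ * Qᵀ) * gᵀ).trace ^ t`, where `Λ` is a projection of rank `p` in
dimension `p + q` and `g * gᵀ = X`: on the left directly, on the right through the complementary
projection `1 - Λ` of rank `q`. -/
lemma sum_wishartMoment_eq
    (hs : ∀ t, ∑ κ ∈ partitions m t, s κ • sphericalPoly κ = (∑ i, MvPolynomial.X i) ^ t)
    {X : Matrix (Fin m) (Fin m) ℝ} (hX : X.PosSemidef) {p q : ℕ} (hp : m ≤ p) (hq : m ≤ q)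
    (t : ℕ) :
    ∑ κ ∈ partitions m t, s κ * sphericalFn κ X *
        (wishartMoment κ p / wishartMoment κ (p + q : ℕ)) =
      ∑ k ∈ range (t + 1), (t.choose k : ℝ) * X.trace ^ (t - k) * (-1) ^ k *
        ∑ κ ∈ partitions m k, s κ * sphericalFn κ X *
          (wishartMoment κ q / wishartMoment κ (p + q : ℕ)) := by
  have hn : m ≤ p + q := le_add_right hp
  obtain ⟨g, rfl⟩ := exists_mul_transpose_eq hn hX
  obtain ⟨Λ, hΛ, htrace⟩ := exists_isStarProjection_trace_eq p q
  have htrace' : (1 - Λ).trace = q := by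
    rw [trace_sub, htrace, trace_one, Fintype.card_fin, Nat.cast_add, add_sub_cancel_left]
  have hint : ∀ k, Integrable (fun Q : orthogonalGroup (Fin (p + q)) ℝ =>
      (g * (Q.1 * (1 - Λ) * Q.1ᵀ) * gᵀ).trace ^ k) (haarO (p + q)) := fun k =>
    integrable_haarO (((continuous_const.matrix_mul
      (continuous_orthogonal_conj _)).matrix_mul continuous_const).matrix_trace.pow k)
  rw [← htrace, ← integral_trace_conj_pow_of_isStarProjection (hs t) hn g hΛ
    (htrace ▸ Nat.cast_le.2 hp)]
  simp_rw [trace_conj_pow_eq_sum_one_sub g Λ]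
  rw [integral_finsetSum _ fun k _ => (hint k).const_mul _]
  refine sum_congr rfl fun k _ => ?_
  rw [integral_const_mul, integral_trace_conj_pow_of_isStarProjection (hs k) hn g hΛ.one_sub
    (htrace' ▸ Nat.cast_le.2 hq), htrace']

end HalfIntegers

/-! ### Continuation from half-integral to complex parameters -/

section Continuation

/-- `f` is given by a complex polynomial. -/
def IsPolynomialFn (f : ℂ → ℂ) : Prop := ∃ P : Polynomial ℂ, ∀ z, f z = P.eval z

namespace IsPolynomialFn

variable {f g : ℂ → ℂ}

protected lemma const (c : ℂ) : IsPolynomialFn fun _ => c :=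
  ⟨.C c, fun _ => Polynomial.eval_C.symm⟩

protected lemma id : IsPolynomialFn fun z => z := ⟨.X, fun _ => Polynomial.eval_X.symm⟩

protected lemma add (hf : IsPolynomialFn f) (hg : IsPolynomialFn g) :
    IsPolynomialFn fun z => f z + g z := by
  obtain ⟨P, hP⟩ := hf
  obtain ⟨Q, hQ⟩ := hg
  exact ⟨P + Q, fun z => by simp only [Polynomial.eval_add, hP, hQ]⟩

protected lemma mul (hf : IsPolynomialFn f) (hg : IsPolynomialFn g) :
    IsPolynomialFn fun z => f z * g z := by
  obtain ⟨P, hP⟩ := hf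
  obtain ⟨Q, hQ⟩ := hg
  exact ⟨P * Q, fun z => by simp only [Polynomial.eval_mul, hP, hQ]⟩

protected lemma sub (hf : IsPolynomialFn f) (hg : IsPolynomialFn g) :
    IsPolynomialFn fun z => f z - g z := by
  obtain ⟨P, hP⟩ := hf
  obtain ⟨Q, hQ⟩ := hg
  exact ⟨P - Q, fun z => by simp only [Polynomial.eval_sub, hP, hQ]⟩

protected lemma sum {ι : Type*} {s : Finset ι} {F : ι → ℂ → ℂ}
    (hF : ∀ i ∈ s, IsPolynomialFn (F i)) : IsPolynomialFn fun z => ∑ i ∈ s, F i z := by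
  choose! P hP using hF
  exact ⟨∑ i ∈ s, P i, fun z =>
    (sum_congr rfl fun i hi => hP i hi z).trans (Polynomial.eval_finsetSum ..).symm⟩

protected lemma prod {ι : Type*} {s : Finset ι} {F : ι → ℂ → ℂ}
    (hF : ∀ i ∈ s, IsPolynomialFn (F i)) : IsPolynomialFn fun z => ∏ i ∈ s, F i z := by
  choose! P hP using hF
  exact ⟨∏ i ∈ s, P i, fun z =>
    (prod_congr rfl fun i hi => hP i hi z).trans (Polynomial.eval_prod ..).symm⟩

lemma eq_zero_of_half_integers (hf : IsPolynomialFn f) (N : ℕ)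
    (h : ∀ p : ℕ, N ≤ p → f ((p : ℂ) / 2) = 0) (z : ℂ) : f z = 0 := by
  obtain ⟨P, hP⟩ := hf
  have hP0 : P = 0 := by
    refine P.eq_zero_of_infinite_isRoot ?_
    have hinj : Function.Injective fun p : ℕ => ((p + N : ℕ) : ℂ) / 2 := fun p q hpq =>
      Nat.add_right_cancel (Nat.cast_injective ((div_left_inj' two_ne_zero).1 hpq))
    refine (Set.infinite_range_of_injective hinj).mono ?_
    rintro _ ⟨p, rfl⟩
    exact (hP _).symm.trans (h _ (Nat.le_add_left N p))
  rw [hP, hP0, Polynomial.eval_zero]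

end IsPolynomialFn

variable {m t : ℕ}

/-- The product that completes `(c)_κ` to `(c)_(t, …, t)`; it clears the denominators of the
quotients `(a)_κ / (c)_κ`. -/
def pochComplement (t : ℕ) (c : ℂ) (κ : Fin m → ℕ) : ℂ :=
  ∏ i : Fin m, ∏ j ∈ Ico (κ i) t, (c - ((i : ℕ) : ℂ) / 2 + j)

lemma pochPartition_mul_pochComplement (c : ℂ) {κ : Fin m → ℕ} (hκ : ∀ i, κ i ≤ t) :
    pochPartition c κ * pochComplement t c κ = pochPartition c fun _ : Fin m => t := by
  rw [pochPartition, pochComplement, pochPartition, ← prod_mul_distrib]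
  exact prod_congr rfl fun i _ => prod_range_mul_prod_Ico _ (hκ i)

lemma le_of_mem_partitions {κ : Fin m → ℕ} (hκ : κ ∈ partitions m t) (i : Fin m) : κ i ≤ t := by
  rw [← (mem_partitions.1 hκ).1]
  exact single_le_sum (fun _ _ => Nat.zero_le _) (mem_univ i)

lemma pochPartition_ne_zero {c : ℂ} (hc : ∀ (i : Fin m) (k : ℕ), c ≠ (i : ℕ) / 2 - k)
    (κ : Fin m → ℕ) : pochPartition c κ ≠ 0 :=
  prod_ne_zero_iff.2 fun i _ => prod_ne_zero_iff.2 fun j _ hj =>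
    hc i j (eq_sub_of_add_eq (sub_eq_zero.1 (by rw [← hj]; ring)))

lemma ne_half_sub_of_lt_re {c : ℂ} (hc : ((m : ℝ) - 1) / 2 < c.re) (i : Fin m) (k : ℕ) :
    c ≠ (i : ℕ) / 2 - k := by
  rintro rfl
  have hi : ((i : ℕ) : ℝ) + 1 ≤ m := by exact_mod_cast i.isLt
  simp only [Complex.sub_re, Complex.div_ofNat_re, Complex.natCast_re] at hc
  linarith [k.cast_nonneg (α := ℝ)]

/-- The involution `G ↦ (∑_{k ≤ t} (t choose k) T^{t-k} (-1)^k G_k)_t` on sequences. Kummer's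
relation says that it exchanges the sums `∑_κ (a)_κ / (c)_κ C_κ(X)` with the parameters `a` and
`c - a`, where `T = tr X`. -/
def binomialTransform (T : ℂ) (G : ℕ → ℂ) (t : ℕ) : ℂ :=
  ∑ k ∈ range (t + 1), (t.choose k : ℂ) * T ^ (t - k) * (-1) ^ k * G k

/-- The sum `∑_κ (a)_κ / (c)_κ z_κ` over the partitions of `t`. -/
def pochSum (z : (Fin m → ℕ) → ℂ) (a c : ℂ) (t : ℕ) : ℂ :=
  ∑ κ ∈ partitions m t, pochPartition a κ / pochPartition c κ * z κ

/-- The sum `pochSum z a c k` with its denominators cleared by the factor `(c)_(t, …, t)`, where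
`k ≤ t`. -/
def clearedPochSum (z : (Fin m → ℕ) → ℂ) (t : ℕ) (a c : ℂ) (k : ℕ) : ℂ :=
  ∑ κ ∈ partitions m k, pochPartition a κ * pochComplement t c κ * z κ

lemma clearedPochSum_eq_mul_pochSum (z : (Fin m → ℕ) → ℂ) (a : ℂ) {c : ℂ} {k : ℕ} (hk : k ≤ t)
    (hc : ∀ κ : Fin m → ℕ, pochPartition c κ ≠ 0) :
    clearedPochSum z t a c k = pochPartition c (fun _ : Fin m => t) * pochSum z a c k := by
  rw [clearedPochSum, pochSum, mul_sum]
  refine sum_congr rfl fun κ hκ => ?_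
  rw [← pochPartition_mul_pochComplement c fun i => (le_of_mem_partitions hκ i).trans hk]
  have := hc κ
  field_simp

/-- The difference of the two sides of Kummer's relation in degree `t` with the parameters `a` and
`c = a + b`, with denominators cleared so that it is a polynomial in `a` and `b`. -/
def kummerDefect (z : (Fin m → ℕ) → ℂ) (T : ℂ) (t : ℕ) (a b : ℂ) : ℂ :=
  clearedPochSum z t a (a + b) t - binomialTransform T (clearedPochSum z t b (a + b)) t

lemma kummerDefect_eq_mul_sub (z : (Fin m → ℕ) → ℂ) (T : ℂ) (t : ℕ) {a b : ℂ}
    (hab : ∀ κ : Fin m → ℕ, pochPartition (a + b) κ ≠ 0) :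
    kummerDefect z T t a b = pochPartition (a + b) (fun _ : Fin m => t) *
      (pochSum z a (a + b) t - binomialTransform T (pochSum z b (a + b)) t) := by
  rw [kummerDefect, clearedPochSum_eq_mul_pochSum z a le_rfl hab, mul_sub, binomialTransform,
    binomialTransform, mul_sum]
  congr 1
  refine sum_congr rfl fun k hk => ?_
  rw [clearedPochSum_eq_mul_pochSum z b (mem_range_succ_iff.1 hk) hab]
  ring

namespace IsPolynomialFn

variable {f g : ℂ → ℂ}

protected lemma clearedPochSum (hf : IsPolynomialFn f) (hg : IsPolynomialFn g)
    (z : (Fin m → ℕ) → ℂ) (t k : ℕ) :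
    IsPolynomialFn fun x => clearedPochSum z t (f x) (g x) k :=
  have hlinear {f : ℂ → ℂ} (hf : IsPolynomialFn f) (i : Fin m) (j : ℕ) :
      IsPolynomialFn fun x => f x - ((i : ℕ) : ℂ) / 2 + j :=
    (hf.sub (.const _)).add (.const _)
  .sum fun _ _ => ((IsPolynomialFn.prod fun i _ => .prod fun j _ => hlinear hf i j).mul
    (.prod fun i _ => .prod fun j _ => hlinear hg i j)).mul (.const _)

protected lemma kummerDefect (hf : IsPolynomialFn f) (hg : IsPolynomialFn g)
    (z : (Fin m → ℕ) → ℂ) (T : ℂ) (t : ℕ) :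
    IsPolynomialFn fun x => kummerDefect z T t (f x) (g x) :=
  (hf.clearedPochSum (hf.add hg) z t t).sub
    (.sum fun k _ => (IsPolynomialFn.const _).mul (hg.clearedPochSum (hf.add hg) z t k))

end IsPolynomialFn

lemma pochSum_eq_of_half_integers {z : (Fin m → ℕ) → ℂ} {T : ℂ}
    (h : ∀ p q : ℕ, m ≤ p → m ≤ q → pochSum z ((p : ℂ) / 2) ((p : ℂ) / 2 + (q : ℂ) / 2) =
      binomialTransform T (pochSum z ((q : ℂ) / 2) ((p : ℂ) / 2 + (q : ℂ) / 2)))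
    (a : ℂ) {c : ℂ} (hc : ∀ κ : Fin m → ℕ, pochPartition c κ ≠ 0) :
    pochSum z a c = binomialTransform T (pochSum z (c - a) c) := by
  ext t
  have hhalf : ∀ p q : ℕ, m ≤ p → m ≤ q → kummerDefect z T t ((p : ℂ) / 2) ((q : ℂ) / 2) = 0 := by
    intro p q hp hq
    rw [kummerDefect_eq_mul_sub, h p q hp hq, sub_self, mul_zero]
    refine pochPartition_ne_zero (ne_half_sub_of_lt_re ?_)
    have hp' : (m : ℝ) ≤ p := Nat.cast_le.2 hp
    simp only [Complex.add_re, Complex.div_ofNat_re, Complex.natCast_re]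
    linarith [q.cast_nonneg (α := ℝ)]
  have hleft : ∀ q : ℕ, m ≤ q → ∀ b, kummerDefect z T t b ((q : ℂ) / 2) = 0 := fun q hq =>
    (IsPolynomialFn.id.kummerDefect (.const _) z T t).eq_zero_of_half_integers m
      fun p hp => hhalf p q hp hq
  have hzero : kummerDefect z T t a (c - a) = 0 :=
    ((IsPolynomialFn.const a).kummerDefect .id z T t).eq_zero_of_half_integers m
      (fun q hq => hleft q hq a) (c - a)
  rw [← add_sub_cancel a c] at hc
  rw [kummerDefect_eq_mul_sub z T t hc, mul_eq_zero, or_iff_right (hc _), sub_eq_zero,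
    add_sub_cancel] at hzero
  exact hzero

end Continuation

/-! ### Zonal polynomials of a matrix -/

section Zonal

variable {m t : ℕ}

lemma wishartMoment_eq_pochPartition (κ : Fin m → ℕ) (r : ℝ) :
    (wishartMoment κ r : ℂ) = 2 ^ (∑ i, κ i) * pochPartition ((r : ℂ) / 2) κ := by
  rw [wishartMoment, pochPartition, ← prod_pow_eq_pow_sum, ← prod_mul_distrib]
  push_cast
  refine prod_congr rfl fun i _ => ?_
  rw [poch, pow_eq_prod_const, ← prod_mul_distrib]
  exact prod_congr rfl fun j _ => by ring

lemma wishartMoment_div_eq_pochPartition_div (κ : Fin m → ℕ) (r s : ℝ) :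
    ((wishartMoment κ r / wishartMoment κ s : ℝ) : ℂ) =
      pochPartition ((r : ℂ) / 2) κ / pochPartition ((s : ℂ) / 2) κ := by
  rw [Complex.ofReal_div, wishartMoment_eq_pochPartition, wishartMoment_eq_pochPartition,
    mul_div_mul_left _ _ (pow_ne_zero _ two_ne_zero)]

lemma zonal_eq_mul_sphericalFn {s : (Fin m → ℕ) → ℝ}
    (hs : ∀ κ, Antitone κ → zonalPoly κ = s κ • sphericalPoly κ) {κ : Fin m → ℕ}
    (hκ : Antitone κ) {X : Matrix (Fin m) (Fin m) ℝ} (hX : X.IsHermitian) :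
    zonal κ X hX = s κ * sphericalFn κ X := by
  rw [zonal, hs κ hκ, MvPolynomial.smul_eval, sphericalFn, integral_powerFn_conj_hermitian hκ hX]

lemma zonal_nonneg {X : Matrix (Fin m) (Fin m) ℝ} (hX : X.PosSemidef) {κ : Fin m → ℕ}
    (hκ : Antitone κ) : 0 ≤ zonal κ X hX.isHermitian := by
  obtain ⟨s, hs, hsum⟩ := exists_zonalPoly_eq_smul m
  rw [zonal, hs κ hκ, MvPolynomial.smul_eval]
  exact mul_nonneg (coeff_trace_pow_nonneg (hsum _) (mem_partitions.2 ⟨rfl, hκ⟩))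
    (eval_sphericalPoly_nonneg hκ hX.eigenvalues_nonneg)

lemma sum_zonal {X : Matrix (Fin m) (Fin m) ℝ} (hX : X.IsHermitian) (t : ℕ) :
    ∑ κ ∈ partitions m t, zonal κ X hX = X.trace ^ t := by
  obtain ⟨s, hs, hsum⟩ := exists_zonalPoly_eq_smul m
  rw [← sum_mul_sphericalFn (hsum t) hX]
  exact sum_congr rfl fun κ hκ => zonal_eq_mul_sphericalFn hs (mem_partitions.1 hκ).2 hX

lemma sphericalFn_neg {κ : Fin m → ℕ} (hκ : Antitone κ) (X : Matrix (Fin m) (Fin m) ℝ) :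
    sphericalFn κ (-X) = (-1) ^ (∑ i, κ i) * sphericalFn κ X := by
  rw [sphericalFn, sphericalFn, ← integral_const_mul]
  refine integral_congr_ae (.of_forall fun H => ?_)
  simp only [← powerFn_smul hκ, neg_one_smul, Matrix.mul_neg, Matrix.neg_mul]

lemma zonal_neg {X : Matrix (Fin m) (Fin m) ℝ} (hX : X.IsHermitian) {κ : Fin m → ℕ}
    (hκ : κ ∈ partitions m t) : zonal κ (-X) hX.neg = (-1) ^ t * zonal κ X hX := by
  obtain ⟨s, hs, -⟩ := exists_zonalPoly_eq_smul m
  obtain ⟨hsum, hanti⟩ := mem_partitions.1 hκ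
  rw [zonal_eq_mul_sphericalFn hs hanti, zonal_eq_mul_sphericalFn hs hanti,
    sphericalFn_neg hanti, hsum, mul_left_comm]

/-- At `a = p / 2` and `c = (p + q) / 2` with integers `p, q ≥ m` this is `sum_wishartMoment_eq`. -/
lemma pochSum_zonal_kummer {X : Matrix (Fin m) (Fin m) ℝ} (hX : X.PosSemidef) (a : ℂ) {c : ℂ}
    (hc : ∀ κ : Fin m → ℕ, pochPartition c κ ≠ 0) :
    pochSum (fun κ => (zonal κ X hX.isHermitian : ℂ)) a c =
      binomialTransform X.trace
        (pochSum (fun κ => (zonal κ X hX.isHermitian : ℂ)) (c - a) c) := by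
  obtain ⟨s, hs, hsum⟩ := exists_zonalPoly_eq_smul m
  refine pochSum_eq_of_half_integers (fun p q hp hq => funext fun t => ?_) a hc
  have hreal : ∀ r k : ℕ, pochSum (fun κ => (zonal κ X hX.isHermitian : ℂ)) ((r : ℂ) / 2)
      ((p : ℂ) / 2 + (q : ℂ) / 2) k = ((∑ κ ∈ partitions m k, s κ * sphericalFn κ X *
        (wishartMoment κ r / wishartMoment κ (p + q : ℕ)) : ℝ) : ℂ) := fun r k => by
    rw [pochSum, Complex.ofReal_sum]
    refine sum_congr rfl fun κ hκ => ?_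
    rw [Complex.ofReal_mul, wishartMoment_div_eq_pochPartition_div,
      zonal_eq_mul_sphericalFn hs (mem_partitions.1 hκ).2, mul_comm]
    push_cast
    rw [add_div]
  simp_rw [binomialTransform, hreal]
  rw [sum_wishartMoment_eq hsum hX hp hq t]
  push_cast
  rfl

end Zonal

/-! ### The two series -/

section Growth

variable {m : ℕ}

/-- The quotient of consecutive terms `(u + k) / (v + k)` tends to `1`. -/
lemma exists_norm_poch_div_le (u v : ℂ) {ρ : ℝ} (hρ : 1 < ρ) :
    ∃ M, ∀ k, ‖poch u k / poch v k‖ ≤ M * ρ ^ k := by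
  have hρ0 : 0 < ρ := one_pos.trans hρ
  obtain ⟨σ, hσ, hσρ⟩ := exists_between hρ
  have hquot : Filter.Tendsto (fun k : ℕ => ‖(u + k) / (v + k)‖) Filter.atTop (nhds 1) := by
    simpa only [one_mul, div_one, norm_one] using
      (tendsto_add_mul_div_add_mul_atTop_nhds u v (1 : ℂ) one_ne_zero).norm
  have hsummable : Summable fun k => ‖poch u k / poch v k‖ / ρ ^ k := by
    refine summable_of_ratio_norm_eventually_le ((div_lt_one hρ0).2 hσρ) ?_
    filter_upwards [hquot.eventually_le_const hσ] with k hk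
    rw [poch, poch, prod_range_succ, prod_range_succ, mul_div_mul_comm, norm_mul, pow_succ',
      mul_comm, ← div_mul_div_comm, norm_mul, Real.norm_of_nonneg (by positivity)]
    exact mul_le_mul_of_nonneg_right (by gcongr) (norm_nonneg _)
  obtain ⟨M, hM⟩ := hsummable.tendsto_atTop_zero.bddAbove_range
  exact ⟨M, fun k => (div_le_iff₀ (pow_pos hρ0 k)).1 (hM ⟨k, rfl⟩)⟩

lemma exists_norm_pochPartition_div_le (a c : ℂ) {ρ : ℝ} (hρ : 1 < ρ) :
    ∃ M, ∀ κ : Fin m → ℕ, ‖pochPartition a κ / pochPartition c κ‖ ≤ M * ρ ^ ∑ i, κ i := by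
  choose M hM using fun i : Fin m =>
    exists_norm_poch_div_le (a - ((i : ℕ) : ℂ) / 2) (c - ((i : ℕ) : ℂ) / 2) hρ
  refine ⟨∏ i, M i, fun κ => ?_⟩
  rw [pochPartition, pochPartition, ← prod_div_distrib, norm_prod, ← prod_pow_eq_pow_sum,
    ← prod_mul_distrib]
  exact prod_le_prod (fun i _ => norm_nonneg _) fun i _ => hM i _

lemma exists_norm_pochSum_zonal_le {X : Matrix (Fin m) (Fin m) ℝ} (hX : X.PosSemidef) (a c : ℂ)
    {r : ℝ} (hr : X.trace < r) :
    ∃ M, ∀ t, ‖pochSum (fun κ => (zonal κ X hX.isHermitian : ℂ)) a c t‖ ≤ M * r ^ t := by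
  have hT : 0 ≤ X.trace := hX.trace_nonneg
  obtain ⟨ρ, hρ, hρr⟩ : ∃ ρ > 1, ρ * X.trace ≤ r := by
    refine ⟨2 * r / (X.trace + r), (one_lt_div (by linarith)).2 (by linarith), ?_⟩
    rw [div_mul_eq_mul_div, div_le_iff₀ (by linarith)]
    nlinarith
  obtain ⟨M, hM⟩ := exists_norm_pochPartition_div_le (m := m) a c hρ
  have hM0 : 0 ≤ M := by simpa using (norm_nonneg _).trans (hM 0)
  refine ⟨M, fun t => ?_⟩
  calc ‖pochSum (fun κ => (zonal κ X hX.isHermitian : ℂ)) a c t‖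
      ≤ ∑ κ ∈ partitions m t, M * ρ ^ t * zonal κ X hX.isHermitian := by
        refine (norm_sum_le _ _).trans (sum_le_sum fun κ hκ => ?_)
        obtain ⟨rfl, hanti⟩ := mem_partitions.1 hκ
        have hzonal := zonal_nonneg hX hanti
        rw [norm_mul, Complex.norm_real, Real.norm_of_nonneg hzonal]
        exact mul_le_mul_of_nonneg_right (hM κ) hzonal
    _ = M * (ρ * X.trace) ^ t := by rw [← mul_sum, sum_zonal, mul_pow, mul_assoc]
    _ ≤ M * r ^ t := by gcongr

end Growth

section BinomialSeries

lemma poch_eq_eval_ascPochhammer (β : ℂ) (j : ℕ) : poch β j = (ascPochhammer ℂ j).eval β := by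
  induction j with
  | zero => rw [poch, prod_range_zero, ascPochhammer_zero, Polynomial.eval_one]
  | succ j ih => rw [poch, prod_range_succ, ← poch, ih, ascPochhammer_succ_eval]

lemma poch_div_factorial (β : ℂ) (j : ℕ) :
    poch β j / (j.factorial : ℂ) = Ring.choose (β + j - 1) j := by
  rw [poch_eq_eval_ascPochhammer, ← Polynomial.ascPochhammer_smeval_eq_eval,
    ← Ring.factorial_nsmul_multichoose_eq_ascPochhammer, nsmul_eq_mul,
    mul_div_cancel_left₀ _ (Nat.cast_ne_zero.2 j.factorial_ne_zero), Ring.choose]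
  congr 1
  ring

lemma poch_add (β : ℂ) (k j : ℕ) : poch β (k + j) = poch β k * poch (β + k) j := by
  rw [poch, poch, poch, prod_range_add]
  exact congrArg _ (prod_congr rfl fun i _ => by push_cast; ring)

lemma poch_neg_natCast_div_factorial (n t : ℕ) :
    poch (-(n : ℂ)) t / (t.factorial : ℂ) = (-1) ^ t * (n.choose t : ℂ) := by
  rw [poch_eq_eval_ascPochhammer, ascPochhammer_eval_neg_eq_descPochhammer,
    descPochhammer_eval_eq_descFactorial, Nat.descFactorial_eq_factorial_mul_choose, Nat.cast_mul,
    mul_left_comm, mul_div_cancel_left₀ _ (Nat.cast_ne_zero.2 t.factorial_ne_zero)]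

lemma hasSum_poch_mul_pow (β : ℂ) {x : ℂ} (hx : ‖x‖ < 1) :
    HasSum (fun j => poch β j / (j.factorial : ℂ) * x ^ j) ((1 - x) ^ (-β)) := by
  have hball := (Complex.one_div_one_sub_cpow_hasFPowerSeriesOnBall_zero β).hasSum (y := x)
    (by rwa [Metric.mem_eball, edist_eq_enorm_sub, sub_zero, ← ofReal_norm, ENNReal.ofReal_lt_one])
  simp only [FormalMultilinearSeries.ofScalars_apply_eq, smul_eq_mul, zero_add] at hball
  rw [Complex.cpow_neg, ← one_div]
  simpa only [poch_div_factorial] using hball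

lemma summable_norm_poch_mul_pow (β : ℂ) {r : ℝ} (hr0 : 0 ≤ r) (hr : r < 1) :
    Summable fun j => ‖poch β j / (j.factorial : ℂ)‖ * r ^ j := by
  have hnorm : ‖(r : ℂ)‖ = r := by rw [Complex.norm_real, Real.norm_of_nonneg hr0]
  refine (hasSum_poch_mul_pow β (hnorm.trans_lt hr)).summable.norm.congr fun j => ?_
  rw [norm_mul, norm_pow, hnorm]

variable {G : ℕ → ℂ} {r M : ℝ}

lemma summable_poch_mul_pow_mul (hr : 0 ≤ r) (hG : ∀ t, ‖G t‖ ≤ M * r ^ t) (b : ℂ) {x : ℂ}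
    (hx : ‖x‖ * r < 1) : Summable fun t => poch b t / (t.factorial : ℂ) * x ^ t * G t := by
  refine Summable.of_norm_bounded
    ((summable_norm_poch_mul_pow b (mul_nonneg (norm_nonneg x) hr) hx).mul_left M) fun t => ?_
  calc ‖poch b t / (t.factorial : ℂ) * x ^ t * G t‖
      ≤ ‖poch b t / (t.factorial : ℂ)‖ * ‖x‖ ^ t * (M * r ^ t) := by
        rw [norm_mul, norm_mul, norm_pow]
        exact mul_le_mul_of_nonneg_left (hG t) (by positivity)
    _ = M * (‖poch b t / (t.factorial : ℂ)‖ * (‖x‖ * r) ^ t) := by rw [mul_pow]; ring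

/-- The term with index `(k, j)` of the double series that arises when the binomial transform is
expanded in `∑_t (b)_t / t! x^t (binomialTransform T G)_t`, where `t = k + j`. -/
def transformTerm (b x T : ℂ) (G : ℕ → ℂ) (p : ℕ × ℕ) : ℂ :=
  poch b (p.1 + p.2) / ((p.1 + p.2).factorial : ℂ) * x ^ (p.1 + p.2) *
    (((p.1 + p.2).choose p.1 : ℂ) * T ^ p.2 * (-1) ^ p.1 * G p.1)

lemma sum_antidiagonal_transformTerm (b x T : ℂ) (G : ℕ → ℂ) (t : ℕ) :
    ∑ p ∈ antidiagonal t, transformTerm b x T G p =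
      poch b t / (t.factorial : ℂ) * x ^ t * binomialTransform T G t := by
  rw [Nat.sum_antidiagonal_eq_sum_range_succ_mk, binomialTransform, mul_sum]
  refine sum_congr rfl fun k hk => ?_
  rw [transformTerm, Nat.add_sub_of_le (mem_range_succ_iff.1 hk)]

lemma sum_antidiagonal_norm_transformTerm_le (hG : ∀ t, ‖G t‖ ≤ M * r ^ t) (b x T : ℂ) (t : ℕ) :
    ∑ p ∈ antidiagonal t, ‖transformTerm b x T G p‖ ≤
      M * (‖poch b t / (t.factorial : ℂ)‖ * (‖x‖ * (r + ‖T‖)) ^ t) := by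
  rw [mul_pow, (Commute.all r ‖T‖).add_pow', mul_sum, mul_sum, mul_sum]
  refine sum_le_sum fun p hp => ?_
  have hterm : ‖transformTerm b x T G p‖ = ‖poch b t / (t.factorial : ℂ)‖ * ‖x‖ ^ t *
      ((t.choose p.1 : ℝ) * ‖T‖ ^ p.2) * ‖G p.1‖ := by
    rw [transformTerm, mem_antidiagonal.1 hp]
    simp only [norm_mul, norm_pow, norm_neg, norm_one, one_pow, mul_one, Complex.norm_natCast]
    ring
  calc ‖transformTerm b x T G p‖
      ≤ ‖poch b t / (t.factorial : ℂ)‖ * ‖x‖ ^ t * ((t.choose p.1 : ℝ) * ‖T‖ ^ p.2) *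
        (M * r ^ p.1) := hterm.trans_le (mul_le_mul_of_nonneg_left (hG _) (by positivity))
    _ = _ := by rw [nsmul_eq_mul]; ring

lemma summable_transformTerm (hr : 0 ≤ r) (hG : ∀ t, ‖G t‖ ≤ M * r ^ t) (b : ℂ) {x T : ℂ}
    (hx : ‖x‖ * (r + ‖T‖) < 1) : Summable (transformTerm b x T G) := by
  rw [← HasAntidiagonal.sigmaAntidiagonalEquivProd.summable_iff]
  refine Summable.of_norm ((summable_sigma_of_nonneg fun _ => norm_nonneg _).2
    ⟨fun _ => Summable.of_finite, ?_⟩)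
  refine ((summable_norm_poch_mul_pow b (by positivity) hx).mul_left M).of_nonneg_of_le
    (fun _ => tsum_nonneg fun _ => norm_nonneg _) fun t => ?_
  rw [tsum_fintype]
  exact (sum_coe_sort (antidiagonal t) fun p => ‖transformTerm b x T G p‖).trans_le
    (sum_antidiagonal_norm_transformTerm_le hG b x T t)

lemma hasSum_transformTerm_row (b : ℂ) {x T : ℂ} (hx : ‖x * T‖ < 1) (G : ℕ → ℂ) (k : ℕ) :
    HasSum (fun j => transformTerm b x T G (k, j)) ((1 - x * T) ^ (-b) *
      (poch b k / (k.factorial : ℂ) * (-x / (1 - x * T)) ^ k * G k)) := by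
  have hne : 1 - x * T ≠ 0 := fun h => by
    rw [← sub_eq_zero.1 h, norm_one] at hx
    exact hx.false
  have hsum : poch b k / (k.factorial : ℂ) * x ^ k * (-1) ^ k * G k *
      (1 - x * T) ^ (-(b + k)) =
      (1 - x * T) ^ (-b) * (poch b k / (k.factorial : ℂ) * (-x / (1 - x * T)) ^ k * G k) := by
    rw [neg_add', Complex.cpow_sub _ _ hne, Complex.cpow_natCast, div_pow, neg_pow x]
    ring
  rw [← hsum]
  refine ((hasSum_poch_mul_pow (b + k) hx).mul_left _).congr_fun fun j => ?_
  have hfactorial : ((k + j).factorial : ℂ) ≠ 0 := Nat.cast_ne_zero.2 (Nat.factorial_ne_zero _)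
  rw [transformTerm, Nat.cast_add_choose ℂ, poch_add, mul_pow, pow_add]
  field_simp

/-- Sum the double series once along the antidiagonals and once along the rows. -/
lemma tsum_poch_mul_binomialTransform (hr : 0 ≤ r) (hG : ∀ t, ‖G t‖ ≤ M * r ^ t) (b : ℂ)
    {x T : ℂ} (hx : ‖x‖ * (r + ‖T‖) < 1) :
    ∑' t, poch b t / (t.factorial : ℂ) * x ^ t * binomialTransform T G t = (1 - x * T) ^ (-b) *
      ∑' k, poch b k / (k.factorial : ℂ) * (-x / (1 - x * T)) ^ k * G k := by
  have hxT : ‖x * T‖ < 1 := by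
    rw [norm_mul]
    exact (mul_le_mul_of_nonneg_left (le_add_of_nonneg_left hr) (norm_nonneg x)).trans_lt hx
  have hdouble := (summable_transformTerm hr hG b hx).hasSum
  have hrows := hdouble.prod_fiberwise (hasSum_transformTerm_row b hxT G)
  have hdiag := (HasAntidiagonal.sigmaAntidiagonalEquivProd.hasSum_iff.2 hdouble).sigma
    fun t => hasSum_fintype _
  rw [← tsum_mul_left, hrows.tsum_eq, ← hdiag.tsum_eq]
  exact tsum_congr fun t => (sum_antidiagonal_transformTerm b x T G t).symm.trans
    (sum_coe_sort (antidiagonal t) (transformTerm b x T G)).symm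

lemma tsum_poch_mul_inv_pow_binomialTransform {T e : ℝ} (hr : 0 ≤ r) (hT : 0 ≤ T)
    (he : r + T < e) (hG : ∀ t, ‖G t‖ ≤ M * r ^ t) (b : ℂ) :
    ∑' t, poch b t / (t.factorial : ℂ) * (e : ℂ)⁻¹ ^ t * binomialTransform T G t =
      (((e - T) / e : ℝ) : ℂ) ^ (-b) *
        ∑' k, poch b k / (k.factorial : ℂ) * (-((e - T : ℝ) : ℂ)⁻¹) ^ k * G k := by
  have he0 : 0 < e := (add_nonneg hr hT).trans_lt he
  have hne : (e : ℂ) ≠ 0 := Complex.ofReal_ne_zero.2 he0.ne'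
  have hx : ‖(e : ℂ)⁻¹‖ * (r + ‖(T : ℂ)‖) < 1 := by
    rwa [norm_inv, Complex.norm_real, Complex.norm_real, Real.norm_of_nonneg he0.le,
      Real.norm_of_nonneg hT, inv_mul_lt_one₀ he0]
  have hbase : 1 - (e : ℂ)⁻¹ * T = (((e - T) / e : ℝ) : ℂ) := by
    push_cast
    field_simp
  have harg : -(e : ℂ)⁻¹ / (((e - T) / e : ℝ) : ℂ) = -((e - T : ℝ) : ℂ)⁻¹ := by
    rw [Complex.ofReal_div]
    field_simp
  rw [tsum_poch_mul_binomialTransform hr hG b hx, hbase, harg]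

lemma ofReal_cpow_mul_div_cpow {y z : ℝ} (hyz : 0 < z / y) (w : ℂ) :
    (y : ℂ) ^ w * ((z / y : ℝ) : ℂ) ^ w = (z : ℂ) ^ w := by
  have hy : y ≠ 0 := (div_ne_zero_iff.1 hyz.ne').2
  have hy' : (y : ℂ) ≠ 0 := Complex.ofReal_ne_zero.2 hy
  have hyz' : ((z / y : ℝ) : ℂ) ≠ 0 := Complex.ofReal_ne_zero.2 hyz.ne'
  rw [← div_mul_cancel₀ z hy, Complex.ofReal_mul, mul_div_cancel_right₀ _ hy,
    Complex.cpow_def_of_ne_zero (mul_ne_zero hyz' hy'), Complex.cpow_def_of_ne_zero hy',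
    Complex.cpow_def_of_ne_zero hyz', Complex.log_ofReal_mul hyz hy', ← Complex.exp_add,
    Complex.ofReal_log hyz.le, add_mul, add_comm]

/-- For `d > 0` expand `F = binomialTransform T G` in the left series; for `d < 0` expand
`G = binomialTransform T F` in the right one. In each case the double series converges absolutely,
and the quotient of `d` and `d - T` is positive, so that their powers combine. -/
lemma cpow_mul_tsum_eq_of_binomialTransform {F : ℕ → ℂ} {T d : ℝ} (hT : 0 ≤ T) (hTr : T ≤ r)
    (hFG : F = binomialTransform T G) (hGF : G = binomialTransform T F)
    (hF : ∃ M, ∀ t, ‖F t‖ ≤ M * r ^ t) (hG : ∃ M, ∀ t, ‖G t‖ ≤ M * r ^ t)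
    (hd : r < |d|) (hdT : r < |d - T|) (b : ℂ) :
    (d : ℂ) ^ (-b) * ∑' t, poch b t / (t.factorial : ℂ) * (d : ℂ)⁻¹ ^ t * F t =
      ((d - T : ℝ) : ℂ) ^ (-b) *
        ∑' t, poch b t / (t.factorial : ℂ) * (-((d - T : ℝ) : ℂ)⁻¹) ^ t * G t := by
  have hr : 0 ≤ r := hT.trans hTr
  have hd0 : d ≠ 0 := abs_pos.1 (hr.trans_lt hd)
  rcases hd0.lt_or_gt with hneg | hpos
  · rw [abs_of_neg hneg] at hd
    obtain ⟨M, hM⟩ := hF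
    have hquot : 0 < d / (d - T) := div_pos_of_neg_of_neg hneg (by linarith)
    have hseries := tsum_poch_mul_inv_pow_binomialTransform (e := T - d) hr hT (by linarith) hM b
    rw [← hGF, sub_sub_cancel_left, ← neg_sub d T, neg_div_neg_eq] at hseries
    simp only [Complex.ofReal_neg, inv_neg, neg_neg] at hseries
    rw [hseries, ← mul_assoc, ofReal_cpow_mul_div_cpow hquot]
  · rw [abs_of_pos hpos] at hd
    rw [abs_of_pos (by linarith)] at hdT
    obtain ⟨M, hM⟩ := hG
    have hquot : 0 < (d - T) / d := div_pos (by linarith) hpos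
    rw [hFG, tsum_poch_mul_inv_pow_binomialTransform hr hT (by linarith) hM b, ← mul_assoc,
      ofReal_cpow_mul_div_cpow hquot]

lemma sum_choose_mul_binomialTransform (T : ℂ) (G : ℕ → ℂ) (n : ℕ) (d : ℂ) :
    ∑ t ∈ range (n + 1), (-1) ^ t * (n.choose t : ℂ) * d ^ (n - t) * binomialTransform T G t =
      ∑ k ∈ range (n + 1), (n.choose k : ℂ) * (d - T) ^ (n - k) * G k := by
  simp_rw [binomialTransform, mul_sum]
  rw [sum_comm' (t' := range (n + 1)) (s' := fun k => Ico k (n + 1)) fun t k => by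
    simp only [mem_range, mem_Ico]
    lia]
  refine sum_congr rfl fun k hk => ?_
  have hkn : k ≤ n := mem_range_succ_iff.1 hk
  rw [sum_Ico_eq_sum_range, sub_eq_neg_add, add_pow, mul_sum, sum_mul, Nat.sub_add_comm hkn]
  refine sum_congr rfl fun j _ => ?_
  have hchoose : (n.choose (k + j) : ℂ) * ((k + j).choose k : ℂ) =
      (n.choose k : ℂ) * ((n - k).choose j : ℂ) := by
    have hnat := Nat.choose_mul (n := n) (Nat.le_add_right k j)
    rw [Nat.add_sub_cancel_left] at hnat
    exact_mod_cast hnat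
  have hsign : (-1 : ℂ) ^ (k + j) * (-1) ^ k = (-1) ^ j := by
    rw [pow_add, mul_right_comm, ← mul_pow, neg_mul_neg, one_mul, one_pow, one_mul]
  rw [Nat.add_sub_cancel_left, neg_pow T, Nat.sub_sub, ← hsign]
  linear_combination ((-1) ^ (k + j) * (-1) ^ k * d ^ (n - (k + j)) * T ^ j * G k) * hchoose

end BinomialSeries

section OnePone

variable {m : ℕ} {X : Matrix (Fin m) (Fin m) ℝ}

lemma onePoneTerm_eq_mul_pochSum (f : ℕ → ℂ) (a c : ℂ) (hX : X.IsHermitian) (t : ℕ) :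
    onePoneTerm f a c X hX t =
      f t / (t.factorial : ℂ) * pochSum (fun κ => (zonal κ X hX : ℂ)) a c t := rfl

lemma onePoneTerm_neg (f : ℕ → ℂ) (a c : ℂ) (hX : X.IsHermitian) (t : ℕ) :
    onePoneTerm f a c (-X) hX.neg t =
      f t / (t.factorial : ℂ) * ((-1) ^ t * pochSum (fun κ => (zonal κ X hX : ℂ)) a c t) := by
  rw [onePoneTerm, pochSum, mul_sum (partitions m t) _ ((-1) ^ t)]
  refine congrArg (f t / (t.factorial : ℂ) * ·) (sum_congr rfl fun κ hκ => ?_)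
  rw [zonal_neg hX hκ]
  push_cast
  ring

lemma onePoneTerm_poch_mul_cpow (b : ℂ) {d : ℂ} (hd : d ≠ 0) (a c : ℂ) (hX : X.IsHermitian)
    (t : ℕ) : onePoneTerm (fun t => poch b t * d ^ (-b - (t : ℂ))) a c X hX t = d ^ (-b) *
      (poch b t / (t.factorial : ℂ) * d⁻¹ ^ t *
        pochSum (fun κ => (zonal κ X hX : ℂ)) a c t) := by
  rw [onePoneTerm_eq_mul_pochSum, Complex.cpow_sub _ _ hd, Complex.cpow_natCast, inv_pow]
  ring

lemma onePoneTerm_neg_poch_mul_cpow (b e a c : ℂ) (hX : X.IsHermitian) (t : ℕ) :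
    onePoneTerm (fun t => poch b t * e ^ (-(t : ℂ))) a c (-X) hX.neg t =
      poch b t / (t.factorial : ℂ) * (-e⁻¹) ^ t *
        pochSum (fun κ => (zonal κ X hX : ℂ)) a c t := by
  rw [onePoneTerm_neg _ _ _ hX, Complex.cpow_neg, Complex.cpow_natCast, neg_pow e⁻¹, inv_pow]
  ring

lemma onePoneTerm_poch_neg_natCast (n : ℕ) (d a c : ℂ) (hX : X.IsHermitian) (t : ℕ) :
    onePoneTerm (fun t => poch (-(n : ℂ)) t * d ^ (-(-(n : ℂ)) - (t : ℂ))) a c X hX t =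
      (-1) ^ t * (n.choose t : ℂ) * d ^ (n - t) *
        pochSum (fun κ => (zonal κ X hX : ℂ)) a c t := by
  rw [onePoneTerm_eq_mul_pochSum, mul_div_right_comm, poch_neg_natCast_div_factorial]
  rcases le_or_gt t n with htn | hnt
  · rw [neg_neg, ← Nat.cast_sub htn, Complex.cpow_natCast]
  · simp only [Nat.choose_eq_zero_of_lt hnt, Nat.cast_zero, mul_zero, zero_mul]

lemma pow_mul_onePoneTerm_neg_poch_neg_natCast (n : ℕ) {e : ℂ} (he : e ≠ 0) (a c : ℂ)
    (hX : X.IsHermitian) (t : ℕ) :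
    e ^ n * onePoneTerm (fun t => poch (-(n : ℂ)) t * e ^ (-(t : ℂ))) a c (-X) hX.neg t =
      (n.choose t : ℂ) * e ^ (n - t) * pochSum (fun κ => (zonal κ X hX : ℂ)) a c t := by
  rw [onePoneTerm_neg_poch_mul_cpow _ _ _ _ hX, poch_neg_natCast_div_factorial]
  rcases le_or_gt t n with htn | hnt
  · have hsign : (-1 : ℂ) ^ t * (-1) ^ t = 1 := by
      rw [← mul_pow, neg_mul_neg, one_mul, one_pow]
    rw [pow_sub₀ _ he htn, neg_pow e⁻¹, inv_pow]
    linear_combination (e ^ n * (n.choose t : ℂ) * (e ^ t)⁻¹ *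
      pochSum (fun κ => (zonal κ X hX : ℂ)) a c t) * hsign
  · simp only [Nat.choose_eq_zero_of_lt hnt, Nat.cast_zero, mul_zero, zero_mul]

lemma onePone_kummer_of_lt_abs (hX : X.PosSemidef) (a : ℂ) {c : ℂ}
    (hc : ∀ κ : Fin m → ℕ, pochPartition c κ ≠ 0) (b : ℂ) {d : ℝ} (hd : X.trace < |d|)
    (hdT : X.trace < |d - X.trace|) :
    Summable (onePoneTerm (fun t => poch b t * (d : ℂ) ^ (-b - (t : ℂ))) a c X
      hX.isHermitian) ∧
    Summable (onePoneTerm (fun t => poch b t * ((d - X.trace : ℝ) : ℂ) ^ (-(t : ℂ)))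
      (c - a) c (-X) hX.isHermitian.neg) ∧
    onePone (fun t => poch b t * (d : ℂ) ^ (-b - (t : ℂ))) a c X hX.isHermitian =
      ((d - X.trace : ℝ) : ℂ) ^ (-b) *
        onePone (fun t => poch b t * ((d - X.trace : ℝ) : ℂ) ^ (-(t : ℂ))) (c - a) c (-X)
          hX.isHermitian.neg := by
  have hT : 0 ≤ X.trace := hX.trace_nonneg
  obtain ⟨r, hTr, hr⟩ := exists_between (lt_min hd hdT)
  obtain ⟨hrd, hrdT⟩ := lt_min_iff.1 hr
  have hinv {y : ℝ} (hy : r < |y|) : ‖(y : ℂ)⁻¹‖ * r < 1 := by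
    rwa [norm_inv, Complex.norm_real, Real.norm_eq_abs,
      inv_mul_lt_one₀ ((hT.trans_lt hTr).trans hy)]
  have hF := exists_norm_pochSum_zonal_le hX a c hTr
  have hG := exists_norm_pochSum_zonal_le hX (c - a) c hTr
  have hGF := pochSum_zonal_kummer hX (c - a) hc
  rw [sub_sub_cancel] at hGF
  have hd0 : (d : ℂ) ≠ 0 := Complex.ofReal_ne_zero.2 (abs_pos.1 (hT.trans_lt hd))
  have hterm := funext (onePoneTerm_poch_mul_cpow b hd0 a c hX.isHermitian)
  have hterm_neg := funext
    (onePoneTerm_neg_poch_mul_cpow b ((d - X.trace : ℝ) : ℂ) (c - a) c hX.isHermitian)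
  refine ⟨?_, ?_, ?_⟩
  · rw [hterm]
    exact (summable_poch_mul_pow_mul (hT.trans hTr.le) hF.choose_spec b (hinv hrd)).mul_left _
  · rw [hterm_neg]
    exact summable_poch_mul_pow_mul (hT.trans hTr.le) hG.choose_spec b
      (by rw [norm_neg]; exact hinv hrdT)
  · rw [onePone, onePone, hterm, hterm_neg, tsum_mul_left]
    exact cpow_mul_tsum_eq_of_binomialTransform hT hTr.le (pochSum_zonal_kummer hX a hc) hGF
      hF hG hrd hrdT b

lemma onePone_kummer_neg_natCast (hX : X.PosSemidef) (a : ℂ) {c : ℂ}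
    (hc : ∀ κ : Fin m → ℕ, pochPartition c κ ≠ 0) (n : ℕ) {d : ℝ} (hd : d ≠ X.trace) :
    Summable (onePoneTerm (fun t => poch (-(n : ℂ)) t * (d : ℂ) ^ (-(-(n : ℂ)) - (t : ℂ))) a c X
      hX.isHermitian) ∧
    Summable (onePoneTerm (fun t => poch (-(n : ℂ)) t * ((d - X.trace : ℝ) : ℂ) ^ (-(t : ℂ)))
      (c - a) c (-X) hX.isHermitian.neg) ∧
    onePone (fun t => poch (-(n : ℂ)) t * (d : ℂ) ^ (-(-(n : ℂ)) - (t : ℂ))) a c X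
      hX.isHermitian = ((d - X.trace : ℝ) : ℂ) ^ (-(-(n : ℂ))) *
        onePone (fun t => poch (-(n : ℂ)) t * ((d - X.trace : ℝ) : ℂ) ^ (-(t : ℂ))) (c - a) c (-X)
          hX.isHermitian.neg := by
  have he : ((d - X.trace : ℝ) : ℂ) ≠ 0 := Complex.ofReal_ne_zero.2 (sub_ne_zero.2 hd)
  have hterm := funext (onePoneTerm_poch_neg_natCast n (d : ℂ) a c hX.isHermitian)
  have hterm_neg := funext
    (pow_mul_onePoneTerm_neg_poch_neg_natCast n he (c - a) c hX.isHermitian)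
  have hchoose : ∀ t ∉ range (n + 1), (n.choose t : ℂ) = 0 := fun t ht => by
    rw [Nat.choose_eq_zero_of_lt (lt_of_not_ge fun h => ht (mem_range_succ_iff.2 h)),
      Nat.cast_zero]
  refine ⟨?_, ?_, ?_⟩
  · rw [hterm]
    exact summable_of_ne_finset_zero (s := range (n + 1)) fun t ht => by
      rw [hchoose t ht, mul_zero, zero_mul, zero_mul]
  · rw [← summable_mul_left_iff (pow_ne_zero n he), hterm_neg]
    exact summable_of_ne_finset_zero (s := range (n + 1)) fun t ht => by
      rw [hchoose t ht, zero_mul, zero_mul]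
  · rw [onePone, onePone, hterm, neg_neg, Complex.cpow_natCast, ← tsum_mul_left, hterm_neg,
      pochSum_zonal_kummer hX a hc,
      tsum_eq_sum (s := range (n + 1)) fun t ht => by
        rw [hchoose t ht, mul_zero, zero_mul, zero_mul],
      tsum_eq_sum (s := range (n + 1)) fun t ht => by rw [hchoose t ht, zero_mul, zero_mul],
      sum_choose_mul_binomialTransform, Complex.ofReal_sub]

end OnePone

end KummerPearson

end

theorem mainTheorem1_general {m : ℕ} {X : Matrix (Fin m) (Fin m) ℝ} (hX : X.PosSemidef) (a : ℂ)
    {c : ℂ} (hc : ∀ (i : Fin m) (k : ℕ), c ≠ (i : ℕ) / 2 - k) {b : ℂ} {d : ℝ}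
    (hbd : (X.trace < |d| ∧ X.trace < |d - X.trace|) ∨
      ((∃ n : ℕ, b = -(n : ℂ)) ∧ d ≠ X.trace)) :
    Summable (KummerPearson.onePoneTerm
      (fun t => KummerPearson.poch b t * (d : ℂ) ^ (-b - (t : ℂ))) a c X hX.isHermitian) ∧
    Summable (KummerPearson.onePoneTerm
      (fun t => KummerPearson.poch b t * ((d - X.trace : ℝ) : ℂ) ^ (-(t : ℂ)))
      (c - a) c (-X) hX.isHermitian.neg) ∧
    KummerPearson.onePone
      (fun t => KummerPearson.poch b t * (d : ℂ) ^ (-b - (t : ℂ))) a c X hX.isHermitian =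
    ((d - X.trace : ℝ) : ℂ) ^ (-b) *
      KummerPearson.onePone
        (fun t => KummerPearson.poch b t * ((d - X.trace : ℝ) : ℂ) ^ (-(t : ℂ)))
        (c - a) c (-X) hX.isHermitian.neg := by
  have hpoch := KummerPearson.pochPartition_ne_zero hc
  rcases hbd with ⟨hd, hdT⟩ | ⟨⟨n, rfl⟩, hd⟩
  · exact KummerPearson.onePone_kummer_of_lt_abs hX a hpoch b hd hdT
  · exact KummerPearson.onePone_kummer_neg_natCast hX a hpoch n hd

theorem mainTheorem1 {m : ℕ} (X : Matrix (Fin m) (Fin m) ℝ) (hX : X.PosDef) (a c : ℂ)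
    (ha : ((m : ℝ) - 1) / 2 < a.re) (hc : ((m : ℝ) - 1) / 2 < c.re)
    (hca : ((m : ℝ) - 1) / 2 < (c - a).re) (b d : ℝ)
    (hbd : (X.trace < |d| ∧ X.trace < |d - X.trace|) ∨
      ((∃ n : ℕ, b = -(n : ℝ)) ∧ d ≠ X.trace)) :
    Summable (KummerPearson.onePoneTerm
      (fun t => KummerPearson.poch b t * (d : ℂ) ^ (-(b : ℂ) - (t : ℂ)))
      a c X hX.isHermitian) ∧
    Summable (KummerPearson.onePoneTerm
      (fun t => KummerPearson.poch b t * ((d - X.trace : ℝ) : ℂ) ^ (-(t : ℂ)))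
      (c - a) c (-X) hX.isHermitian.neg) ∧
    KummerPearson.onePone
      (fun t => KummerPearson.poch b t * (d : ℂ) ^ (-(b : ℂ) - (t : ℂ)))
      a c X hX.isHermitian =
    ((d - X.trace : ℝ) : ℂ) ^ (-(b : ℂ)) *
      KummerPearson.onePone
        (fun t => KummerPearson.poch b t * ((d - X.trace : ℝ) : ℂ) ^ (-(t : ℂ)))
        (c - a) c (-X) hX.isHermitian.neg :=
  mainTheorem1_general hX.posSemidef a (KummerPearson.ne_half_sub_of_lt_re hc)
    (hbd.imp_right (And.imp_left fun ⟨n, hn⟩ => ⟨n, by rw [hn]; push_cast; rfl⟩))
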